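/- Let $m\ge 2$ and let $\mathbb{C}_m$ be the complex Clifford algebra with generators $e_1,\dots,e_m$, $e_j^2=-1$, $e_je_k+e_ke_j=0$ ($j\neq k$). Identify $x\in\mathbb{R}^m$ with $\underline{x}=\sum_j e_jx_j\in\mathbb{C}_m$, let $\partial_{\underline{x}}=\sum_j e_j\partial_{x_j}$ be the Dirac operator (acting from the left), and let the Clifford–Fourier transform be $\widehat{f}(\underline{u})=\int_{\mathbb{R}^m}e^{-i\langle \underline{x},\underline{u}\rangle}f(\underline{x})\,dV(\underline{x})$. For real $a,b$ put $$\omega_{a,b}(\underline{x})=\big|1-|\underline{x}|^2\big|^{a}\,(1+|\underline{x}|^2)^{b}.$$ Let $\ell\ge 0$ be an integer and $\alpha,\beta\in\mathbb{R}$ with $\alpha>-1$, or with $\alpha+\ell$ an even non-negative integer, and let $$\psi_{\ell,m}^{\alpha,\beta}=(-1)^\ell\,\partial_{\underline{x}}^{\ell}\,\omega_{\alpha+\ell,\beta+\ell}$$ (defined off the unit sphere, hence almost everywhere). (1) If $k$ is an integer with $0<k<-m-3\ell-2(\alpha+\beta)$ and $k<\ell$, then $\underline{x}^k\psi_{\ell,m}^{\alpha,\beta}$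 is integrable and $$\int_{\mathbb{R}^m}\underline{x}^k\,\psi_{\ell,m}^{\alpha,\beta}(\underline{x})\,dV(\underline{x})=0 .$$ (2) Suppose $m+3\ell+2(\alpha+\beta)<0$. Then $\psi_{\ell,m}^{\alpha,\beta}$ is integrable, and for $\underline{u}=\rho\,\underline{\xi}$ with $\rho>0$, $|\underline{\xi}|=1$, $$\widehat{\psi_{\ell,m}^{\alpha,\beta}}(\underline{u})=(-i)^\ell\,\underline{\xi}^\ell\,(2\pi)^{\frac m2}\,\rho^{1-\frac m2+\ell}\int_0^\infty\widetilde{\omega}^{\ell}_{\alpha,\beta}(r)\,J_{\frac m2-1}(r\rho)\,dr,$$ $$\widetilde{\omega}^{\ell}_{\alpha,\beta}(r)=\big((1-r^2)\varepsilon_r\big)^{\alpha+\ell}(1+r^2)^{\beta+\ell}\,r^{\frac m2},\qquad \varepsilon_r=\operatorname{sign}(1-r),$$ whenever the integral on the right converges, possibly only as the improper integral $\lim_{R\to\infty}\int_0^R$. Here $J_\nu$ is the Bessel function of the first kind. If $m+4\ell+2(\alpha+\beta)<0$, the integral on the right converges absolutely, so that the formula holds for every $\underline{u}\neq0$. -/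

import Mathlib

open MeasureTheory Set Filter Topology

noncomputable section

/-- The quadratic form `z ↦ -(z₁² + ⋯ + z_m²)` on `ℂ^m`. -/
def cliffordForm (m : ℕ) : QuadraticForm ℂ (Fin m → ℂ) :=
  QuadraticMap.weightedSumSquares ℂ (fun _ : Fin m => (-1 : ℂ))

/-- The complex Clifford algebra `ℂ_m`, generated by `e_1, …, e_m` with `e_j² = -1` and
`e_j e_k + e_k e_j = 0` for `j ≠ k`. It contains the real Clifford algebra `ℝ_m`. -/
def Cl (m : ℕ) : Type := CliffordAlgebra (cliffordForm m)

namespace Cl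

instance instRing (m : ℕ) : Ring (Cl m) :=
  inferInstanceAs (Ring (CliffordAlgebra (cliffordForm m)))

instance instAlgebra (m : ℕ) : Algebra ℂ (Cl m) :=
  inferInstanceAs (Algebra ℂ (CliffordAlgebra (cliffordForm m)))

/-- The standard linear basis `(e_A)`, indexed by the subsets `A` of `{1, …, m}`. -/
def basis (m : ℕ) : Module.Basis (Finset (Fin m)) ℂ (Cl m) :=
  letI : Invertible (2 : ℂ) := invertibleOfNonzero two_ne_zero
  ((Pi.basisFun ℂ (Fin m)).ExteriorAlgebra).map
    (CliffordAlgebra.equivExterior (cliffordForm m)).symm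

instance instFiniteDimensional (m : ℕ) : FiniteDimensional ℂ (Cl m) :=
  Module.Finite.of_basis (basis m)

/-- The largest modulus of a coordinate in the basis `(e_A)`. The space `Cl m` has finite dimension,
so that derivatives and integrals of `Cl m`-valued functions do not depend on the choice of norm:
they are computed coordinate by coordinate. -/
instance instNormedAddCommGroup (m : ℕ) : NormedAddCommGroup (Cl m) :=
  NormedAddCommGroup.induced (Cl m) (Finset (Fin m) → ℂ) (basis m).equivFun
    (basis m).equivFun.injective

instance instNormedSpace (m : ℕ) : NormedSpace ℂ (Cl m) :=
  NormedSpace.induced ℂ (Cl m) (Finset (Fin m) → ℂ) (basis m).equivFun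

/-- The generator `e_j`. -/
def gen {m : ℕ} (j : Fin m) : Cl m :=
  CliffordAlgebra.ι (cliffordForm m) (Pi.single j 1)

/-- The embedding `x ↦ ∑ e_j x_j` of `ℝ^m` into the Clifford algebra. -/
def vec {m : ℕ} (x : EuclideanSpace ℝ (Fin m)) : Cl m :=
  ∑ j, ((x j : ℝ) : ℂ) • gen j

end Cl

/-- The Dirac operator `∂ f = ∑ e_j ∂f/∂x_j`, acting from the left on `Cl m`-valued functions. -/
def diracOp {m : ℕ} (f : EuclideanSpace ℝ (Fin m) → Cl m) : EuclideanSpace ℝ (Fin m) → Cl m :=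
  fun x => ∑ j, Cl.gen j * lineDeriv ℝ f x (EuclideanSpace.single j 1)

/-- The weight `((1 - |x|²) ε)^a (1 + |x|²)^b` with `ε = sign (1 - |x|)`, that is,
`|1 - |x|²|^a (1 + |x|²)^b`. -/
def jacobiWeight {m : ℕ} (a b : ℝ) (x : EuclideanSpace ℝ (Fin m)) : ℝ :=
  |1 - ‖x‖ ^ 2| ^ a * (1 + ‖x‖ ^ 2) ^ b

/-- The Clifford-Jacobi wavelet `(-1)^ℓ ∂^ℓ ω_{α+ℓ,β+ℓ}`. -/
def jacobiWavelet (m ℓ : ℕ) (α β : ℝ) : EuclideanSpace ℝ (Fin m) → Cl m :=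
  fun x => (-1 : Cl m) ^ ℓ *
    diracOp^[ℓ] (fun y => algebraMap ℂ (Cl m) ((jacobiWeight (α + ℓ) (β + ℓ) y : ℝ) : ℂ)) x

/-- The Clifford-Fourier transform `u ↦ ∫ exp(-i⟨x,u⟩) f(x) dx`. -/
def cliffordFourier {m : ℕ} (f : EuclideanSpace ℝ (Fin m) → Cl m)
    (u : EuclideanSpace ℝ (Fin m)) : Cl m :=
  ∫ x, Complex.exp (-Complex.I * ((inner ℝ x u : ℝ) : ℂ)) • f x

/-- The Bessel function of the first kind `J_ν(z)` for real `ν ≥ 0` and `z ≥ 0`, by its power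
series. -/
def besselJ (ν z : ℝ) : ℝ :=
  ∑' n : ℕ, (-1) ^ n / ((n.factorial : ℝ) * Real.Gamma (n + ν + 1)) * (z / 2) ^ (2 * (n : ℝ) + ν)

/-- The radial profile `((1 - r²) ε_r)^(α+ℓ) (1 + r²)^(β+ℓ) r^(m/2)` with `ε_r = sign (1 - r)`. -/
def radialWeight (m ℓ : ℕ) (α β r : ℝ) : ℝ :=
  ((1 - r ^ 2) * Real.sign (1 - r)) ^ (α + ℓ) * (1 + r ^ 2) ^ (β + ℓ) * r ^ ((m : ℝ) / 2)

/-- The factor `(-i)^ℓ (2π)^(m/2) ρ^(1-m/2+ℓ)`. -/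
def fourierFactor (m ℓ : ℕ) (ρ : ℝ) : ℂ :=
  (-Complex.I) ^ ℓ *
    (((2 * Real.pi) ^ ((m : ℝ) / 2) * ρ ^ (1 - (m : ℝ) / 2 + ℓ) : ℝ) : ℂ)

end

/-! ### Clifford identities and the Dirac operator on radial functions. -/

noncomputable section

namespace Cl

variable {m : ℕ}

/-! Off the unit sphere, with s = |x|², the Dirac operator sends h(s) to 2h'(s)x and h(s)x to -(m
h(s) + 2s h'(s)). Hence the wavelet is ±H_ℓ(|x|²) for even ℓ and ±H_ℓ(|x|²)x for odd ℓ, where the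
profiles H_q form a `RadialChain` starting from |1-s|^a (1+s)^b with a = α+ℓ, b = β+ℓ. In the
radius, r H_{q+1}(r²) = (H_q(r²))' for even q and r^{m-1} H_{q+1}(r²) = -(r^m H_q(r²))' for odd q,
so both claims reduce to integration by parts on a half-line.

Two properties of the profiles are needed (`exists_radialChain`, `JacobiChain.exists_abs_le`). If α
> -1, then H_q is of size at most |1-s|^{a-q} near s = 1, so it is continuous for q < ℓ and
integrable for q = ℓ; if a is an even integer, the weight is smooth. At infinity H_q(r²) =
O(r^{2(a+b)-2⌈q/2⌉}), which gives integrability of the wavelet under the stated condition.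

Moments: if k and ℓ have different parity, the integrand is odd. Otherwise each integration by parts
lowers both k and q by one, until an exact derivative is left; the boundary terms decay
(`JacobiChain.tendsto_integral_mul_pow`).

Fourier transform: integration over spheres turns the exponential into the Bessel-type kernels C =
`sphereCos` and S = `sphereSin`, with C' = -S and (z^{m-1}S)' = z^{m-1}C. Each integration by parts
then lowers q by one and contributes a factor -ρ and a boundary term. The decay hypothesis concerns
H_ℓ only, so the boundary terms for q < ℓ are not controlled by decay. They are controlled by the
convergence of the pairing of H_0 with its kernel: its partial integrals P(R) are bounded, and the
boundary terms are, after at most one further integration by parts, slowly varying multiples of P'.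
Averaged over [N, 2N] against a smooth weight they are O(1/N)
(`JacobiChain.tendsto_bump_boundaryTerm`). Since the pairing of H_ℓ converges absolutely, its
averages converge to its value, which is therefore (-ρ)^ℓ times the limit for H_0
(`JacobiChain.integral_Ioi_fourierKernel_eq`). -/

theorem gen_mul_gen_self (j : Fin m) : gen j * gen j = (-1 : Cl m) := by
  have h := CliffordAlgebra.ι_sq_scalar (cliffordForm m) (Pi.single j 1)
  have h2 : cliffordForm m (Pi.single j 1) = -1 := by
    simp [cliffordForm, QuadraticMap.weightedSumSquares_apply, Pi.single_apply]
  rw [h2] at h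
  rw [gen]
  refine Eq.trans h ?_
  rw [map_neg, map_one]
  rfl

theorem vec_eq_ι (x : EuclideanSpace ℝ (Fin m)) :
    vec x = CliffordAlgebra.ι (cliffordForm m) (fun j => ((x j : ℝ) : ℂ)) := by
  have h : (fun j => ((x j : ℝ) : ℂ)) = ∑ j, ((x j : ℝ) : ℂ) • (Pi.single j 1 : Fin m → ℂ) := by
    ext i
    simp [Finset.sum_apply, Pi.single_apply]
  rw [h, map_sum]
  simp only [map_smul]
  rfl

theorem vec_mul_vec_self (x : EuclideanSpace ℝ (Fin m)) :
    vec x * vec x = ((-‖x‖ ^ 2 : ℝ) : ℂ) • (1 : Cl m) := by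
  rw [vec_eq_ι]
  refine Eq.trans (CliffordAlgebra.ι_sq_scalar (cliffordForm m) _) ?_
  have h2 : cliffordForm m (fun j => ((x j : ℝ) : ℂ)) = ((-‖x‖ ^ 2 : ℝ) : ℂ) := by
    rw [EuclideanSpace.norm_sq_eq]
    simp [cliffordForm, QuadraticMap.weightedSumSquares_apply, ← sq]
  rw [h2]
  exact Algebra.algebraMap_eq_smul_one (A := Cl m) _

theorem vec_pow_two_mul (x : EuclideanSpace ℝ (Fin m)) (n : ℕ) :
    vec x ^ (2 * n) = (((-‖x‖ ^ 2) ^ n : ℝ) : ℂ) • (1 : Cl m) := by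
  rw [pow_mul, sq, vec_mul_vec_self, smul_pow, one_pow]
  push_cast
  rfl

theorem vec_pow_two_mul_add_one (x : EuclideanSpace ℝ (Fin m)) (n : ℕ) :
    vec x ^ (2 * n + 1) = (((-‖x‖ ^ 2) ^ n : ℝ) : ℂ) • vec x := by
  rw [pow_succ, vec_pow_two_mul, smul_mul_assoc, one_mul]

/-- `vec` as a real-linear map into the Clifford algebra. -/
def vecL : EuclideanSpace ℝ (Fin m) →ₗ[ℝ] Cl m where
  toFun := vec
  map_add' x y := by simp [vec, add_smul, Finset.sum_add_distrib]
  map_smul' c x := by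
    simp only [vec, Finset.smul_sum, PiLp.smul_apply, smul_eq_mul, Complex.ofReal_mul, mul_smul,
      RingHom.id_apply]
    rfl

/-- The real structure in which derivatives are taken is the restriction of the complex one. -/
theorem real_smul_eq (c : ℝ) (v : Cl m) : c • v = (c : ℂ) • v := rfl

theorem continuous_vec : Continuous (vec : EuclideanSpace ℝ (Fin m) → Cl m) :=
  (vecL (m := m)).continuous_of_finiteDimensional

theorem vec_smul (c : ℝ) (x : EuclideanSpace ℝ (Fin m)) : vec (c • x) = (c : ℂ) • vec x :=
  (vecL (m := m)).map_smul c x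

theorem vec_single (j : Fin m) : vec (EuclideanSpace.single j 1) = gen j := by
  simp [vec]

end Cl

variable {m : ℕ}

theorem hasLineDerivAt_norm_sq (x : EuclideanSpace ℝ (Fin m)) (j : Fin m) :
    HasDerivAt (fun t : ℝ => ‖x + t • EuclideanSpace.single j (1 : ℝ)‖ ^ 2) (2 * x j) 0 := by
  have h : ∀ t : ℝ, ‖x + t • EuclideanSpace.single j (1 : ℝ)‖ ^ 2 =
      ‖x‖ ^ 2 + 2 * x j * t + t ^ 2 := by
    intro t
    rw [norm_add_sq_real, inner_smul_right, EuclideanSpace.inner_single_right, norm_smul]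
    simp
    ring
  simp only [h]
  exact ((((hasDerivAt_id (0:ℝ)).const_mul (2 * x j)).const_add (‖x‖ ^ 2)).add
    ((hasDerivAt_id (0:ℝ)).pow 2)).congr_deriv (by simp)

theorem hasLineDerivAt_radial {h : ℝ → ℝ} {h' : ℝ} (x : EuclideanSpace ℝ (Fin m))
    (hh : HasDerivAt h h' (‖x‖ ^ 2)) (j : Fin m) :
    HasDerivAt (fun t : ℝ => h (‖x + t • EuclideanSpace.single j (1 : ℝ)‖ ^ 2))
      (h' * (2 * x j)) 0 := by
  have h1 := hasLineDerivAt_norm_sq x j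
  have h2 : HasDerivAt h h' (‖x + (0:ℝ) • EuclideanSpace.single j (1 : ℝ)‖ ^ 2) := by
    simpa using hh
  exact h2.comp (0:ℝ) h1

theorem diracOp_congr {f g : EuclideanSpace ℝ (Fin m) → Cl m} {x : EuclideanSpace ℝ (Fin m)}
    (h : f =ᶠ[𝓝 x] g) : diracOp f x = diracOp g x := by
  simp only [diracOp]
  refine Finset.sum_congr rfl fun j _ => ?_
  rw [h.lineDeriv_eq]

/-- The Dirac operator on a radial scalar function. -/
theorem diracOp_radial {h : ℝ → ℝ} {h' : ℝ} (x : EuclideanSpace ℝ (Fin m))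
    (hh : HasDerivAt h h' (‖x‖ ^ 2)) :
    diracOp (fun y => ((h (‖y‖ ^ 2) : ℝ) : ℂ) • (1 : Cl m)) x = ((2 * h' : ℝ) : ℂ) • Cl.vec x := by
  simp only [diracOp, Cl.vec, Finset.smul_sum]
  refine Finset.sum_congr rfl fun j _ => ?_
  have h1 : HasLineDerivAt ℝ (fun y : EuclideanSpace ℝ (Fin m) =>
      ((h (‖y‖ ^ 2) : ℝ) : ℂ) • (1 : Cl m)) ((h' * (2 * x j)) • (1 : Cl m)) x
      (EuclideanSpace.single j 1) :=
    (hasLineDerivAt_radial x hh j).smul_const (1 : Cl m)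
  rw [h1.lineDeriv, Cl.real_smul_eq, mul_smul_comm, mul_one, smul_smul]
  push_cast
  ring_nf

/-- The Dirac operator on the product of a radial scalar function and the vector variable. -/
theorem diracOp_radial_smul_vec {h : ℝ → ℝ} {h' : ℝ} (x : EuclideanSpace ℝ (Fin m))
    (hh : HasDerivAt h h' (‖x‖ ^ 2)) :
    diracOp (fun y => ((h (‖y‖ ^ 2) : ℝ) : ℂ) • Cl.vec y) x =
      ((-(m * h (‖x‖ ^ 2) + 2 * ‖x‖ ^ 2 * h') : ℝ) : ℂ) • (1 : Cl m) := by
  have h1 : ∀ j : Fin m, HasLineDerivAt ℝ (fun y : EuclideanSpace ℝ (Fin m) =>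
      ((h (‖y‖ ^ 2) : ℝ) : ℂ) • Cl.vec y)
      (h (‖x‖ ^ 2) • Cl.gen j + (h' * (2 * x j)) • Cl.vec x) x
      (EuclideanSpace.single j 1) := by
    intro j
    have hv : HasDerivAt (fun t : ℝ => Cl.vec (x + t • EuclideanSpace.single j (1 : ℝ)))
        (Cl.gen j) 0 := by
      have : (fun t : ℝ => Cl.vec (x + t • EuclideanSpace.single j (1 : ℝ))) =
          fun t : ℝ => Cl.vec x + t • Cl.gen j := by
        ext t
        rw [← Cl.vec_single]
        exact ((Cl.vecL (m := m)).map_add _ _).trans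
          (congrArg _ ((Cl.vecL (m := m)).map_smul _ _))
      rw [this]
      simpa using ((hasDerivAt_id (0:ℝ)).smul_const (Cl.gen j)).const_add (Cl.vec x)
    have := (hasLineDerivAt_radial x hh j).smul hv
    simp only [zero_smul, add_zero] at this
    exact this
  simp only [diracOp, (h1 _).lineDeriv, mul_add, Cl.real_smul_eq, mul_smul_comm,
    Cl.gen_mul_gen_self, Finset.sum_add_distrib]
  -- The terms in which the profile is differentiated reassemble to x·x = -|x|²; the others
  -- contribute e_j² = -1 for each of the m directions.
  have h2 : ∑ j : Fin m, ((h' * (2 * x j) : ℝ) : ℂ) • (Cl.gen j * Cl.vec x) =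
      ((2 * h' : ℝ) : ℂ) • (Cl.vec x * Cl.vec x) := by
    conv_rhs => rw [Cl.vec]
    rw [Finset.sum_mul, Finset.smul_sum]
    refine Finset.sum_congr rfl fun j _ => ?_
    rw [smul_mul_assoc, smul_smul]
    push_cast
    ring_nf
    rfl
  rw [h2, Cl.vec_mul_vec_self, smul_smul, Finset.sum_const, Finset.card_univ, Fintype.card_fin,
    ← Nat.cast_smul_eq_nsmul ℂ, smul_neg, smul_neg, smul_smul, ← neg_smul, ← add_smul]
  push_cast
  ring_nf

end

/-! ### Chains of radial profiles. -/

noncomputable section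

/-- A sequence of radial profiles, as functions of `s = |x|²`, in which each profile arises from
the preceding one by the Dirac operator; `dH q` is the derivative of `H q` off `s = 1`. -/
structure RadialChain (m : ℕ) (H dH : ℕ → ℝ → ℝ) : Prop where
  hasDerivAt : ∀ q s, 0 ≤ s → s ≠ 1 → HasDerivAt (H q) (dH q s) s
  even_succ : ∀ q s, Even q → 0 ≤ s → s ≠ 1 → H (q + 1) s = 2 * dH q s
  odd_succ : ∀ q s, Odd q → 0 ≤ s → s ≠ 1 → H (q + 1) s = -(m * H q s + 2 * s * dH q s)

/-- The `Cl m`-valued function with radial profile `h`, scalar for even `q` and a multiple of the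
vector variable for odd `q`. -/
def cliffordRadial {m : ℕ} (q : ℕ) (h : ℝ → ℝ) (x : EuclideanSpace ℝ (Fin m)) : Cl m :=
  ((h (‖x‖ ^ 2) : ℝ) : ℂ) • (if Even q then 1 else Cl.vec x)

theorem RadialChain.diracOp_iterate {m : ℕ} {H dH : ℕ → ℝ → ℝ} (hH : RadialChain m H dH) (q : ℕ)
    {x : EuclideanSpace ℝ (Fin m)} (hx : ‖x‖ ^ 2 ≠ 1) :
    diracOp^[q] (cliffordRadial 0 (H 0)) x = cliffordRadial q (H q) x := by
  induction q generalizing x with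
  | zero => rfl
  | succ q ih =>
    rw [Function.iterate_succ_apply']
    have hev : diracOp^[q] (cliffordRadial 0 (H 0)) =ᶠ[𝓝 x] cliffordRadial q (H q) := by
      have ho : ∀ᶠ y : EuclideanSpace ℝ (Fin m) in 𝓝 x, ‖y‖ ^ 2 ≠ 1 :=
        (by fun_prop : Continuous fun y : EuclideanSpace ℝ (Fin m) => ‖y‖ ^ 2).continuousAt
          |>.eventually_ne hx
      filter_upwards [ho] with y hy using ih hy
    rw [diracOp_congr hev]
    have h0 : 0 ≤ ‖x‖ ^ 2 := by positivity
    have hd := hH.hasDerivAt q _ h0 hx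
    rcases Nat.even_or_odd q with hq | hq
    · have hf : (cliffordRadial q (H q) : EuclideanSpace ℝ (Fin m) → Cl m) =
          fun y => ((H q (‖y‖ ^ 2) : ℝ) : ℂ) • (1 : Cl m) := by
        ext y; simp [cliffordRadial, hq]
      rw [hf, diracOp_radial x hd, cliffordRadial, if_neg (by simpa [Nat.even_add_one] using hq),
        hH.even_succ q _ hq h0 hx]
    · have hf : (cliffordRadial q (H q) : EuclideanSpace ℝ (Fin m) → Cl m) =
          fun y => ((H q (‖y‖ ^ 2) : ℝ) : ℂ) • Cl.vec y := by
        ext y; simp [cliffordRadial, Nat.not_even_iff_odd.2 hq]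
      rw [hf, diracOp_radial_smul_vec x hd, cliffordRadial,
        if_pos (by simpa [Nat.even_add_one] using hq), hH.odd_succ q _ hq h0 hx]

/-- Outside the unit ball a chain is determined by its first member. This carries the decay
estimates of the Jacobi chain over to the smooth chain that replaces it when the exponent a is an
even integer. -/
theorem RadialChain.eq_of_zero_eq {m : ℕ} {H dH G dG : ℕ → ℝ → ℝ} (hH : RadialChain m H dH)
    (hG : RadialChain m G dG) (h0 : ∀ s, 1 < s → H 0 s = G 0 s) (q : ℕ) :
    ∀ s, 1 < s → H q s = G q s := by
  induction q with
  | zero => exact h0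
  | succ q ih =>
    intro s hs
    have hs0 : 0 ≤ s := by linarith
    have hs1 : s ≠ 1 := ne_of_gt hs
    have hev : H q =ᶠ[𝓝 s] G q := by
      filter_upwards [lt_mem_nhds hs] with t ht using ih t ht
    have hd : dH q s = dG q s :=
      ((hH.hasDerivAt q s hs0 hs1).congr_of_eventuallyEq hev.symm).unique
        (hG.hasDerivAt q s hs0 hs1)
    rcases Nat.even_or_odd q with hq | hq
    · rw [hH.even_succ q s hq hs0 hs1, hG.even_succ q s hq hs0 hs1, hd]
    · rw [hH.odd_succ q s hq hs0 hs1, hG.odd_succ q s hq hs0 hs1, hd, ih s hs]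

open Polynomial in
/-- The numerator of the derivative of `W Q / D ^ q`, where `D W' = L W`. -/
def chainDeriv (D L Q : ℝ[X]) (q : ℕ) : ℝ[X] :=
  L * Q + D * derivative Q - (q : ℝ[X]) * derivative D * Q

open Polynomial in
/-- The numerators of the radial profiles `W Q_q / D ^ q`, where `D W' = L W`. -/
def chainPoly (m : ℕ) (D L Q : ℝ[X]) : ℕ → ℝ[X]
  | 0 => Q
  | q + 1 =>
    if Even q then 2 * chainDeriv D L (chainPoly m D L Q q) q
    else -((m : ℝ[X]) * D * chainPoly m D L Q q +
      2 * X * chainDeriv D L (chainPoly m D L Q q) q)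

open Polynomial in
theorem hasDerivAt_mul_eval_div_pow (D L Q : ℝ[X]) (q : ℕ) {W : ℝ → ℝ} {s : ℝ}
    (hD0 : D.eval s ≠ 0) (hW : HasDerivAt W (W s * L.eval s / D.eval s) s) :
    HasDerivAt (fun s => W s * Q.eval s / D.eval s ^ q)
      (W s * (chainDeriv D L Q q).eval s / D.eval s ^ (q + 1)) s := by
  have h := ((hW.mul (Q.hasDerivAt s)).div ((D.hasDerivAt s).pow q) (pow_ne_zero q hD0))
  refine h.congr_deriv ?_
  simp only [chainDeriv, eval_sub, eval_add, eval_mul, eval_natCast, Pi.mul_apply, Pi.pow_apply]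
  -- The derivative of D ^ q involves the truncated exponent q - 1, so q = 0 is separate.
  rcases q with _ | q
  · simp
    field_simp
  · simp only [Nat.add_sub_cancel]
    push_cast
    field_simp
    ring

open Polynomial in
theorem radialChain_chainPoly (m : ℕ) (D L Q : ℝ[X]) (W : ℝ → ℝ)
    (hD : ∀ s, 0 ≤ s → s ≠ 1 → D.eval s ≠ 0)
    (hW : ∀ s, 0 ≤ s → s ≠ 1 → HasDerivAt W (W s * L.eval s / D.eval s) s) :
    RadialChain m (fun q s => W s * (chainPoly m D L Q q).eval s / D.eval s ^ q)
      (fun q s => W s * (chainDeriv D L (chainPoly m D L Q q) q).eval s / D.eval s ^ (q + 1)) := by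
  refine ⟨fun q s hs hs1 => ?_, fun q s hq hs hs1 => ?_, fun q s hq hs hs1 => ?_⟩
  · exact hasDerivAt_mul_eval_div_pow D L _ q (hD s hs hs1) (hW s hs hs1)
  · simp only [chainPoly, if_pos hq, eval_mul, eval_ofNat]
    ring
  · have hD0 := hD s hs hs1
    simp only [chainPoly, if_neg (Nat.not_even_iff_odd.2 hq), eval_mul, eval_ofNat, eval_neg,
      eval_add, eval_X, eval_natCast]
    field_simp
    ring

end

/-! ### Algebraic form and decay of the Jacobi profiles. -/

noncomputable section

open Polynomial in
/-- The denominator `1 - s²`. -/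
def jacobiDen : ℝ[X] := 1 - X ^ 2

open Polynomial in
/-- `(1 - s²)` times the logarithmic derivative of `|1 - s|^a (1 + s)^b`. -/
def jacobiLog (a b : ℝ) : ℝ[X] := -(C a * (1 + X)) + C b * (1 - X)

/-- The quotient of the `q`-th radial profile of `|1 - s|^a (1 + s)^b` by the zeroth one. -/
def jacobiSymbol (m : ℕ) (a b : ℝ) (q : ℕ) (s : ℝ) : ℝ :=
  (chainPoly m jacobiDen (jacobiLog a b) 1 q).eval s / (1 - s ^ 2) ^ q

theorem eval_jacobiDen (s : ℝ) : jacobiDen.eval s = 1 - s ^ 2 := by simp [jacobiDen]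

theorem hasDerivAt_jacobiWeight_profile (a b : ℝ) {s : ℝ} (hs : 0 ≤ s) (hs1 : s ≠ 1) :
    HasDerivAt (fun s : ℝ => |1 - s| ^ a * (1 + s) ^ b)
      (|1 - s| ^ a * (1 + s) ^ b * (jacobiLog a b).eval s / jacobiDen.eval s) s := by
  have h1 : HasDerivAt (fun s : ℝ => |1 - s| ^ a) (|1 - s| ^ a * (-a / (1 - s))) s := by
    have hne : 1 - s ≠ 0 := sub_ne_zero.2 hs1.symm
    have hpos : 0 < |1 - s| := abs_pos.2 hne
    -- `Real.log` ignores the sign of its argument, so one formula covers both sides of s = 1.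
    have hf : (fun s : ℝ => |1 - s| ^ a) =ᶠ[𝓝 s] fun s => Real.exp (Real.log (1 - s) * a) := by
      have : ∀ᶠ t in 𝓝 s, 1 - t ≠ 0 :=
        (by fun_prop : Continuous fun t : ℝ => 1 - t).continuousAt.eventually_ne hne
      filter_upwards [this] with t ht
      rw [Real.rpow_def_of_pos (abs_pos.2 ht), Real.log_abs]
    refine HasDerivAt.congr_of_eventuallyEq ?_ hf
    have := ((((hasDerivAt_id s).const_sub 1).log hne).mul_const a).exp
    refine this.congr_deriv ?_
    rw [Real.rpow_def_of_pos hpos, Real.log_abs]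
    simp only [id]
    ring
  have h2 : HasDerivAt (fun s : ℝ => (1 + s) ^ b) ((1 + s) ^ b * (b / (1 + s))) s := by
    have hpos : 0 < 1 + s := by linarith
    have := ((hasDerivAt_id s).const_add 1).rpow_const (p := b) (Or.inl hpos.ne')
    refine this.congr_deriv ?_
    simp only [id]
    rw [Real.rpow_sub_one hpos.ne']
    field_simp
  refine (h1.mul h2).congr_deriv ?_
  have hne : 1 - s ≠ 0 := sub_ne_zero.2 hs1.symm
  have hpos : 1 + s ≠ 0 := by linarith
  have : (1 - s ^ 2) = (1 - s) * (1 + s) := by ring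
  rw [eval_jacobiDen, this]
  simp only [jacobiLog, Polynomial.eval_add, Polynomial.eval_neg, Polynomial.eval_mul,
    Polynomial.eval_C, Polynomial.eval_sub, Polynomial.eval_one, Polynomial.eval_X]
  field_simp

theorem one_sub_sq_ne_zero {s : ℝ} (hs : 0 ≤ s) (hs1 : s ≠ 1) : 1 - s ^ 2 ≠ 0 := by
  have : (1 - s ^ 2) = (1 - s) * (1 + s) := by ring
  rw [this]
  exact mul_ne_zero (sub_ne_zero.2 hs1.symm) (by linarith)

/-- The derivative of the `q`-th profile divided by the zeroth one. -/
def jacobiDerivSymbol (m : ℕ) (a b : ℝ) (q : ℕ) (s : ℝ) : ℝ :=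
  (chainDeriv jacobiDen (jacobiLog a b) (chainPoly m jacobiDen (jacobiLog a b) 1 q) q).eval s /
    (1 - s ^ 2) ^ (q + 1)

theorem radialChain_jacobi (m : ℕ) (a b : ℝ) :
    RadialChain m (fun q s => |1 - s| ^ a * (1 + s) ^ b * jacobiSymbol m a b q s)
      (fun q s => |1 - s| ^ a * (1 + s) ^ b * jacobiDerivSymbol m a b q s) := by
  have h := radialChain_chainPoly m jacobiDen (jacobiLog a b) 1
    (fun s => |1 - s| ^ a * (1 + s) ^ b)
    (fun s hs hs1 => by rw [eval_jacobiDen]; exact one_sub_sq_ne_zero hs hs1)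
    (fun s hs hs1 => hasDerivAt_jacobiWeight_profile a b hs hs1)
  simpa only [eval_jacobiDen, mul_div_assoc, jacobiSymbol, jacobiDerivSymbol] using h

open Polynomial in
theorem natDegree_jacobiLog_le (a b : ℝ) : (jacobiLog a b).natDegree ≤ 1 := by
  unfold jacobiLog; compute_degree

open Polynomial in
theorem natDegree_chainDeriv_jacobi_le {L : ℝ[X]} (hL : L.natDegree ≤ 1) (Q : ℝ[X]) (q : ℕ) :
    (chainDeriv jacobiDen L Q q).natDegree ≤ Q.natDegree + 1 := by
  have hD : jacobiDen.natDegree ≤ 2 := by unfold jacobiDen; compute_degree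
  have hD' : (derivative jacobiDen).natDegree ≤ 1 :=
    (natDegree_derivative_le _).trans (by omega)
  unfold chainDeriv
  refine (natDegree_sub_le _ _).trans (max_le ((natDegree_add_le _ _).trans (max_le ?_ ?_)) ?_)
  · exact natDegree_mul_le.trans (by omega)
  -- For constant Q the degree of Q' does not drop below zero, and the product bound would be off by
  -- one; there Q' = 0 is used instead.
  · rcases Nat.eq_zero_or_pos Q.natDegree with h0 | h0
    · have : derivative Q = 0 := by
        rw [Polynomial.natDegree_eq_zero.1 h0 |>.choose_spec.symm, derivative_C]
      rw [this]; simp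
    · exact natDegree_mul_le.trans (by have := natDegree_derivative_le Q; omega)
  · have h1 : ((q : ℝ[X]) * derivative jacobiDen).natDegree ≤ 1 :=
      natDegree_mul_le.trans (by simpa using hD')
    exact natDegree_mul_le.trans (by omega)

open Polynomial in
-- Each step raises the degree of the denominator (1 - s²)^q by two. The numerator gains one degree
-- at an even step, where a derivative is taken, and two at an odd step, where m + 2s d/ds preserves
-- the order at infinity. So the quotient decays like s^{-⌈q/2⌉}.
theorem natDegree_chainPoly_jacobi_le (m : ℕ) (a b : ℝ) (q : ℕ) :
    (chainPoly m jacobiDen (jacobiLog a b) 1 q).natDegree + (q + 1) / 2 ≤ 2 * q := by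
  induction q with
  | zero => simp [chainPoly]
  | succ q ih =>
    have hD : jacobiDen.natDegree ≤ 2 := by unfold jacobiDen; compute_degree
    have hP := natDegree_chainDeriv_jacobi_le (natDegree_jacobiLog_le a b)
      (chainPoly m jacobiDen (jacobiLog a b) 1 q) q
    rcases Nat.even_or_odd q with hq | hq
    · obtain ⟨n, rfl⟩ := hq
      have h2 : (2 * chainDeriv jacobiDen (jacobiLog a b)
          (chainPoly m jacobiDen (jacobiLog a b) 1 (n + n)) (n + n)).natDegree ≤
          (chainPoly m jacobiDen (jacobiLog a b) 1 (n + n)).natDegree + 1 :=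
        natDegree_mul_le.trans (by
          have : (2 : ℝ[X]).natDegree = 0 := natDegree_ofNat 2
          omega)
      simp only [chainPoly, if_pos (Even.add_self n)]
      omega
    · have hne : ¬ Even q := Nat.not_even_iff_odd.2 hq
      simp only [chainPoly, if_neg hne, natDegree_neg]
      obtain ⟨n, rfl⟩ := hq
      have h2 : ((m : ℝ[X]) * jacobiDen * chainPoly m jacobiDen (jacobiLog a b) 1 (2 * n + 1) +
          2 * X * chainDeriv jacobiDen (jacobiLog a b)
          (chainPoly m jacobiDen (jacobiLog a b) 1 (2 * n + 1)) (2 * n + 1)).natDegree ≤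
          (chainPoly m jacobiDen (jacobiLog a b) 1 (2 * n + 1)).natDegree + 2 := by
        refine (natDegree_add_le _ _).trans (max_le ?_ ?_)
        · have : ((m : ℝ[X]) * jacobiDen).natDegree ≤ 2 :=
            natDegree_mul_le.trans (by simpa using hD)
          exact natDegree_mul_le.trans (by omega)
        · have : ((2 : ℝ[X]) * X).natDegree ≤ 1 :=
            natDegree_mul_le.trans (by
              have : (2 : ℝ[X]).natDegree = 0 := natDegree_ofNat 2
              have : (X : ℝ[X]).natDegree ≤ 1 := natDegree_X_le
              omega)
          exact natDegree_mul_le.trans (by omega)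
      omega

open Polynomial in
theorem exists_abs_eval_le_pow (P : ℝ[X]) {d : ℕ} (hd : P.natDegree ≤ d) :
    ∃ C, 0 ≤ C ∧ ∀ s : ℝ, 1 ≤ s → |P.eval s| ≤ C * s ^ d := by
  refine ⟨∑ i ∈ Finset.range (P.natDegree + 1), |P.coeff i|,
    Finset.sum_nonneg fun _ _ => abs_nonneg _, fun s hs => ?_⟩
  rw [eval_eq_sum_range, Finset.sum_mul]
  refine (Finset.abs_sum_le_sum_abs _ _).trans (Finset.sum_le_sum fun i hi => ?_)
  rw [abs_mul, abs_pow, abs_of_nonneg (by linarith : (0:ℝ) ≤ s)]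
  have : i ≤ d := (Nat.lt_succ_iff.1 (Finset.mem_range.1 hi)).trans hd
  gcongr

open Polynomial in
theorem exists_abs_eval_div_le (P : ℝ[X]) {q e : ℕ} (hd : P.natDegree + e ≤ 2 * q) :
    ∃ C, 0 ≤ C ∧ ∀ s : ℝ, 2 ≤ s → |P.eval s / (1 - s ^ 2) ^ q| * s ^ e ≤ C := by
  obtain ⟨C, hC0, hC⟩ := exists_abs_eval_le_pow P (d := 2 * q - e) (by omega)
  refine ⟨C * 2 ^ q, by positivity, fun s hs => ?_⟩
  -- This comparison, available since s ≥ 2, is the source of the factor 2 ^ q in the constant.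
  have h1 : s ^ 2 / 2 ≤ |1 - s ^ 2| := by
    rw [abs_sub_comm]
    refine le_trans ?_ (le_abs_self _)
    nlinarith
  have hpos : 0 < s ^ 2 / 2 := by positivity
  rw [abs_div, abs_pow, div_mul_eq_mul_div, div_le_iff₀ (pow_pos (hpos.trans_le h1) q)]
  calc |P.eval s| * s ^ e ≤ C * s ^ (2 * q - e) * s ^ e := by
        gcongr; exact hC s (by linarith)
    _ = C * 2 ^ q * (s ^ 2 / 2) ^ q := by
        rw [mul_assoc, ← pow_add, Nat.sub_add_cancel (by omega), div_pow, ← pow_mul]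
        field_simp
    _ ≤ C * 2 ^ q * |1 - s ^ 2| ^ q := by gcongr

theorem exists_jacobiSymbol_le (m : ℕ) (a b : ℝ) (q : ℕ) :
    ∃ C, 0 ≤ C ∧ ∀ s : ℝ, 2 ≤ s → |jacobiSymbol m a b q s| * s ^ ((q + 1) / 2) ≤ C :=
  exists_abs_eval_div_le _ (natDegree_chainPoly_jacobi_le m a b q)

/-- The derivative of `jacobiSymbol`. -/
def jacobiSymbolDeriv (m : ℕ) (a b : ℝ) (q : ℕ) (s : ℝ) : ℝ :=
  (chainDeriv jacobiDen 0 (chainPoly m jacobiDen (jacobiLog a b) 1 q) q).eval s /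
    (1 - s ^ 2) ^ (q + 1)

theorem hasDerivAt_jacobiSymbol (m : ℕ) (a b : ℝ) (q : ℕ) {s : ℝ} (hs : 1 < s) :
    HasDerivAt (jacobiSymbol m a b q) (jacobiSymbolDeriv m a b q s) s := by
  have h := hasDerivAt_mul_eval_div_pow jacobiDen 0 (chainPoly m jacobiDen (jacobiLog a b) 1 q) q
    (W := fun _ => 1) (s := s)
    (by rw [eval_jacobiDen]; exact one_sub_sq_ne_zero (by linarith) hs.ne')
    (by simpa using hasDerivAt_const s (1 : ℝ))
  simp only [eval_jacobiDen, one_mul] at h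
  exact h

theorem exists_jacobiSymbolDeriv_le (m : ℕ) (a b : ℝ) (q : ℕ) :
    ∃ C, 0 ≤ C ∧ ∀ s : ℝ, 2 ≤ s → |jacobiSymbolDeriv m a b q s| * s ^ ((q + 1) / 2 + 1) ≤ C := by
  refine exists_abs_eval_div_le _ ?_
  have h1 := natDegree_chainPoly_jacobi_le m a b q
  have h2 := natDegree_chainDeriv_jacobi_le (L := 0) (by simp)
    (chainPoly m jacobiDen (jacobiLog a b) 1 q) q
  omega

end

/-! ### Regularity of the profiles at the unit sphere. -/

noncomputable section

theorem intervalIntegrable_abs_one_sub_rpow {c : ℝ} (hc : -1 < c) {R : ℝ} (hR : 0 ≤ R) :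
    IntervalIntegrable (fun r : ℝ => |1 - r| ^ c) volume 0 R := by
  have h1 : IntervalIntegrable (fun r : ℝ => |1 - r| ^ c) volume 0 1 := by
    have := (intervalIntegral.intervalIntegrable_rpow' hc (a := 0) (b := 1)).comp_sub_left 1
    simp only [sub_zero, sub_self] at this
    refine this.symm.congr ?_
    intro r hr
    rw [uIoc_of_le zero_le_one] at hr
    simp only
    rw [abs_of_nonneg (by linarith [hr.2])]
  have h2 : IntervalIntegrable (fun r : ℝ => |1 - r| ^ c) volume 1 (R + 2) := by
    have := (intervalIntegral.intervalIntegrable_rpow' hc (a := 0) (b := R + 1)).comp_sub_right 1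
    rw [zero_add, add_assoc, one_add_one_eq_two] at this
    refine this.congr ?_
    intro r hr
    rw [uIoc_of_le (by linarith)] at hr
    simp only
    rw [abs_of_nonpos (by linarith [hr.1]), neg_sub]
  refine (h1.trans h2).mono_set ?_
  rw [uIcc_of_le hR, uIcc_of_le (by linarith)]
  exact Icc_subset_Icc_right (by linarith)

/-- Isolates the singular factor |1 - s|^{a-q}. The case a = q is excluded because the convention 0
^ 0 = 1 spoils the identity at s = 1. -/
theorem abs_jacobi_profile_eq (m : ℕ) {a b : ℝ} {q : ℕ} (haq : a ≠ q) {s : ℝ}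
    (hs : 0 ≤ s) :
    |(|1 - s| ^ a * (1 + s) ^ b * jacobiSymbol m a b q s)| = |1 - s| ^ (a - q) *
      ((1 + s) ^ (b - q) *
        |(chainPoly m jacobiDen (jacobiLog a b) 1 q).eval s|) := by
  have hpos : 0 < 1 + s := by linarith
  rw [jacobiSymbol]
  rcases eq_or_ne s 1 with rfl | hs1
  · rw [sub_self, abs_zero, Real.zero_rpow (sub_ne_zero.2 haq)]
    rcases Nat.eq_zero_or_pos q with rfl | hq
    · rw [Real.zero_rpow (by simpa using haq)]; simp
    · simp [hq.ne']
  · have h1 : 0 < |1 - s| := abs_pos.2 (sub_ne_zero.2 hs1.symm)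
    have h2 : (1 - s ^ 2) = (1 - s) * (1 + s) := by ring
    rw [h2, abs_mul, abs_mul, abs_div, abs_pow, abs_mul, abs_of_pos hpos,
      abs_of_nonneg (Real.rpow_nonneg h1.le _), abs_of_nonneg (Real.rpow_nonneg hpos.le _),
      Real.rpow_sub_natCast h1.ne', Real.rpow_sub_natCast hpos.ne', mul_pow]
    field_simp

/-- The radial profiles of the iterated Dirac operator on `|1 - |x|²|^a (1 + |x|²)^b`. -/
theorem exists_radialChain (m ℓ : ℕ) (a b : ℝ) (ha : (ℓ : ℝ) - 1 < a ∨ ∃ n : ℕ, a = 2 * n) :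
    ∃ H dH : ℕ → ℝ → ℝ, RadialChain m H dH ∧
      (∀ s, 0 ≤ s → H 0 s = |1 - s| ^ a * (1 + s) ^ b) ∧
      (∀ q < ℓ, ContinuousOn (H q) (Ici 0)) ∧
      (∀ q ≤ ℓ, ∀ R, 0 ≤ R → IntervalIntegrable (fun r => H q (r ^ 2)) volume 0 R) ∧
      (∀ q s, 1 < s → H q s = |1 - s| ^ a * (1 + s) ^ b * jacobiSymbol m a b q s) := by
  -- Either the exponents a - q exceed -1 for q ≤ ℓ and are positive for q < ℓ, or the weight is (1
  -- - s)^{2n} (1 + s)^b and has no singularity on [0, ∞).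
  rcases ha with ha | ⟨n, hn⟩
  · have hc := radialChain_jacobi m a b
    refine ⟨_, _, hc, fun s hs => by simp [jacobiSymbol, chainPoly], fun q hq => ?_,
      fun q hq R hR => ?_, fun q s hs => rfl⟩
    · intro s hs
      rcases eq_or_ne s 1 with rfl | hs1
      · have hqa : (q : ℝ) < a := by
          have : (q : ℝ) + 1 ≤ ℓ := by exact_mod_cast hq
          linarith
        have h0 := abs_jacobi_profile_eq m (b := b) hqa.ne' zero_le_one
        rw [sub_self, abs_zero, Real.zero_rpow (sub_pos.2 hqa).ne', zero_mul, abs_eq_zero] at h0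
        rw [ContinuousWithinAt, sub_self, abs_zero, h0]
        refine squeeze_zero_norm' (a := fun s => |1 - s| ^ (a - q) * ((1 + s) ^ (b - q) *
          |(chainPoly m jacobiDen (jacobiLog a b) 1 q).eval s|)) ?_ ?_
        · filter_upwards [self_mem_nhdsWithin] with s hs
          rw [Real.norm_eq_abs, abs_jacobi_profile_eq m hqa.ne' hs]
        · have hcont : ContinuousAt (fun s : ℝ => |1 - s| ^ (a - q) * ((1 + s) ^ (b - q) *
              |(chainPoly m jacobiDen (jacobiLog a b) 1 q).eval s|)) 1 := by
            refine ContinuousAt.mul ?_ (ContinuousAt.mul ?_ (by fun_prop))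
            · exact ContinuousAt.rpow_const (by fun_prop) (Or.inr (sub_pos.2 hqa).le)
            · exact ContinuousAt.rpow_const (by fun_prop) (Or.inl (by norm_num))
          have := hcont.tendsto
          rw [sub_self, abs_zero, Real.zero_rpow (sub_pos.2 hqa).ne', zero_mul] at this
          exact this.mono_left nhdsWithin_le_nhds
      · exact (hc.hasDerivAt q s hs hs1).continuousAt.continuousWithinAt
    · have hqa : -1 < a - q := by
        have : (q : ℝ) ≤ ℓ := by exact_mod_cast hq
        linarith
      have hg : ContinuousOn (fun r : ℝ => (1 + r) ^ (a - q) * ((1 + r ^ 2) ^ (b - q) *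
          |(chainPoly m jacobiDen (jacobiLog a b) 1 q).eval (r ^ 2)|)) (uIcc 0 R) := by
        rw [uIcc_of_le hR]
        refine ContinuousOn.mul ?_ (ContinuousOn.mul ?_ (by fun_prop))
        · exact ContinuousOn.rpow_const (by fun_prop) fun r hr => Or.inl (by linarith [hr.1])
        · exact ContinuousOn.rpow_const (by fun_prop) fun r hr => Or.inl (by positivity)
      refine ((intervalIntegrable_abs_one_sub_rpow hqa hR).mul_continuousOn hg).mono_fun ?_ ?_
      · refine Measurable.aestronglyMeasurable ?_
        have : Measurable (jacobiSymbol m a b q) := by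
          unfold jacobiSymbol
          exact (Polynomial.continuous _).measurable.div (by fun_prop)
        fun_prop
      · filter_upwards [ae_restrict_mem measurableSet_uIoc,
          (ae_restrict_of_ae (measure_eq_zero_iff_ae_notMem.1
            (measure_singleton (μ := volume) (1 : ℝ))))] with r hr hr1
        rw [uIoc_of_le hR] at hr
        have hr0 : 0 < r := hr.1
        -- For a = q the factorization fails only at r = 1, a null set.
        rcases eq_or_ne a q with haq | haq
        · have hr2 : 1 - r ≠ 0 := fun h => hr1 (by simp; linarith)
          have h2 : (1 - r ^ 2) ≠ 0 := by
            have : (1 - r ^ 2) = (1 - r) * (1 + r) := by ring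
            rw [this]
            exact mul_ne_zero hr2 (by linarith)
          have hpos : (0:ℝ) < 1 + r ^ 2 := by positivity
          have h3 : (1 - (r ^ 2) ^ 2) = (1 - r ^ 2) * (1 + r ^ 2) := by ring
          simp only [haq, sub_self, Real.rpow_zero, one_mul, jacobiSymbol, h3, Real.rpow_natCast,
            norm_mul, norm_div, norm_pow, Real.norm_eq_abs, abs_abs]
          rw [abs_of_nonneg (Real.rpow_nonneg hpos.le _), abs_of_nonneg
            (Real.rpow_nonneg hpos.le _), Real.rpow_sub_natCast hpos.ne', abs_of_pos hpos]
          have := abs_pos.2 h2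
          apply le_of_eq
          rw [mul_pow]
          field_simp
        · rw [Real.norm_eq_abs, Real.norm_eq_abs, abs_jacobi_profile_eq m haq (sq_nonneg r)]
          refine le_trans (le_of_eq ?_) (le_abs_self _)
          have : 1 - r ^ 2 = (1 - r) * (1 + r) := by ring
          rw [this, abs_mul, abs_of_pos (by linarith : 0 < 1 + r),
            Real.mul_rpow (abs_nonneg _) (by linarith)]
          ring
  -- The factor (1 - s)^{2n} now belongs to the polynomial numerator, so the denominators are powers
  -- of 1 + s and every profile is continuous.
  · have hc := radialChain_chainPoly m (1 + Polynomial.X) (Polynomial.C b)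
      ((1 - Polynomial.X) ^ (2 * n)) (fun s => (1 + s) ^ b)
      (fun s hs hs1 => by simp; linarith) (fun s hs hs1 => by
        have hpos : 0 < 1 + s := by linarith
        have := ((hasDerivAt_id s).const_add 1).rpow_const (p := b) (Or.inl hpos.ne')
        refine this.congr_deriv ?_
        simp only [id, Polynomial.eval_C, Polynomial.eval_add, Polynomial.eval_one,
          Polynomial.eval_X]
        rw [Real.rpow_sub_one hpos.ne']
        field_simp)
    have hcont : ∀ q, ContinuousOn (fun s : ℝ => (1 + s) ^ b *
        (chainPoly m (1 + Polynomial.X) (Polynomial.C b)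
          ((1 - Polynomial.X) ^ (2 * n)) q).eval s /
        (1 + Polynomial.X : Polynomial ℝ).eval s ^ q) (Ici 0) := by
      intro q
      refine ContinuousOn.div (ContinuousOn.mul ?_ (by fun_prop)) (by fun_prop) ?_
      · exact ContinuousOn.rpow_const (by fun_prop) fun r hr => Or.inl (by
          have : (0:ℝ) ≤ r := hr
          linarith)
      · intro r hr
        have : (0:ℝ) ≤ r := hr
        refine pow_ne_zero _ ?_
        simp only [Polynomial.eval_add, Polynomial.eval_one, Polynomial.eval_X]
        linarith
    have h0 : ∀ s : ℝ, |1 - s| ^ a = (1 - s) ^ (2 * n) := fun s => by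
      rw [hn, ← Nat.cast_ofNat, ← Nat.cast_mul, Real.rpow_natCast]
      exact Even.pow_abs (even_two_mul n) _
    have h00 : ∀ s : ℝ, (1 + s) ^ b *
        (chainPoly m (1 + Polynomial.X) (Polynomial.C b)
          ((1 - Polynomial.X) ^ (2 * n)) 0).eval s /
        (1 + Polynomial.X : Polynomial ℝ).eval s ^ 0 = |1 - s| ^ a * (1 + s) ^ b := fun s => by
      simp [chainPoly, h0, mul_comm]
    refine ⟨_, _, hc, fun s hs => h00 s, fun q hq => hcont q,
      fun q hq R hR => ?_, fun q => ?_⟩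
    · exact ((hcont q).comp (f := fun r : ℝ => r ^ 2) (by fun_prop)
        (fun r _ => sq_nonneg r)).intervalIntegrable
    · refine hc.eq_of_zero_eq (radialChain_jacobi m a b) (fun s hs => ?_) q
      rw [h00]
      simp [jacobiSymbol, chainPoly]

end

/-! ### The Bessel–Clifford function. -/

noncomputable section

/-- The coefficients of the Bessel–Clifford function. -/
def besselCoeff (c : ℝ) (n : ℕ) : ℝ := (-1) ^ n / ((n.factorial : ℝ) * Real.Gamma (n + c))

/-- The Bessel–Clifford function `∑ (-y)^n / (n! Γ(n + c))`. -/
def besselClifford (c y : ℝ) : ℝ := ∑' n : ℕ, besselCoeff c n * y ^ n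

/-- Γ(x + 1) = xΓ(x) ≥ Γ(x) for x ≥ 1, so the values from Γ(c + 1) onwards increase; Γ(c) enters
separately since c may be less than 1. A positive lower bound suffices, as the factorial in the
coefficients ensures convergence. -/
theorem min_le_Gamma_nat_add {c : ℝ} (hc : 0 < c) (n : ℕ) :
    min (Real.Gamma c) (Real.Gamma (c + 1)) ≤ Real.Gamma (n + c) := by
  rcases n with _ | n
  · simp
  · refine (min_le_right _ _).trans ?_
    induction n with
    | zero => simp [add_comm]
    | succ n ih =>
      refine ih.trans ?_
      have h : ((n + 1 + 1 : ℕ) : ℝ) + c = ((n + 1 : ℕ) + c) + 1 := by push_cast; ring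
      have h0 : 0 < ((n + 1 : ℕ) : ℝ) + c := by positivity
      rw [h, Real.Gamma_add_one h0.ne']
      refine le_mul_of_one_le_left (Real.Gamma_pos_of_pos h0).le ?_
      push_cast
      have : (0:ℝ) ≤ n := n.cast_nonneg
      linarith

theorem exists_besselCoeff_le {c : ℝ} (hc : 0 < c) :
    ∃ K, 0 ≤ K ∧ ∀ n, |besselCoeff c n| ≤ K / n.factorial := by
  have hδ : 0 < min (Real.Gamma c) (Real.Gamma (c + 1)) :=
    lt_min (Real.Gamma_pos_of_pos hc) (Real.Gamma_pos_of_pos (by linarith))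
  refine ⟨(min (Real.Gamma c) (Real.Gamma (c + 1)))⁻¹, by positivity, fun n => ?_⟩
  have hf : (0:ℝ) < n.factorial := by positivity
  have h := min_le_Gamma_nat_add hc n
  rw [besselCoeff, abs_div, abs_pow, abs_neg, abs_one, one_pow, abs_mul, abs_of_pos hf,
    abs_of_pos (hδ.trans_le h), one_div, mul_inv, mul_comm, ← div_eq_mul_inv]
  gcongr

theorem summable_besselClifford {c : ℝ} (hc : 0 < c) (y : ℝ) :
    Summable fun n => besselCoeff c n * y ^ n := by
  obtain ⟨K, hK0, hK⟩ := exists_besselCoeff_le hc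
  refine Summable.of_norm_bounded ((Real.summable_pow_div_factorial |y|).mul_left K) fun n => ?_
  rw [Real.norm_eq_abs, abs_mul, abs_pow]
  calc |besselCoeff c n| * |y| ^ n ≤ K / n.factorial * |y| ^ n := by gcongr; exact hK n
    _ = _ := by ring

theorem besselCoeff_succ_mul {c : ℝ} (n : ℕ) :
    besselCoeff c (n + 1) * (n + 1) = -besselCoeff (c + 1) n := by
  have hf : (n.factorial : ℝ) ≠ 0 := by positivity
  have h : ((n + 1 : ℕ) : ℝ) + c = n + (c + 1) := by push_cast; ring
  rw [besselCoeff, besselCoeff, Nat.factorial_succ, h]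
  push_cast
  have : (n : ℝ) + 1 ≠ 0 := by positivity
  -- Nothing is assumed about c; if Γ vanishes, both coefficients are zero by division by zero.
  by_cases hG : Real.Gamma (n + (c + 1)) = 0
  · simp [hG]
  field_simp
  ring

theorem hasDerivAt_besselClifford {c : ℝ} (hc : 0 < c) (y : ℝ) :
    HasDerivAt (besselClifford c) (-besselClifford (c + 1) y) y := by
  obtain ⟨K, hK0, hK⟩ := exists_besselCoeff_le hc
  set M := |y| + 1 with hM
  have hM0 : 0 ≤ M := by positivity
  have hu : Summable fun n : ℕ => K / n.factorial * (n * M ^ (n - 1)) := by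
    rw [← summable_nat_add_iff 1]
    refine ((Real.summable_pow_div_factorial M).mul_left K).congr fun n => ?_
    rw [Nat.factorial_succ, Nat.add_sub_cancel]
    push_cast
    have : (n : ℝ) + 1 ≠ 0 := by positivity
    field_simp
  have hd := hasDerivAt_tsum_of_isPreconnected (g := fun n y => besselCoeff c n * y ^ n)
    (g' := fun n y => besselCoeff c n * (n * y ^ (n - 1))) hu
    (Metric.isOpen_ball (x := (0:ℝ)) (ε := M)) (convex_ball (0:ℝ) M).isPreconnected
    (fun n z _ => (hasDerivAt_pow n z).const_mul _)
    (fun n z hz => by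
      rw [mem_ball_zero_iff, Real.norm_eq_abs] at hz
      rw [Real.norm_eq_abs, abs_mul, abs_mul, abs_pow, Nat.abs_cast]
      gcongr
      exact hK n)
    (Metric.mem_ball_self (by positivity)) (summable_besselClifford hc 0)
    (y := y) (by rw [mem_ball_zero_iff, Real.norm_eq_abs]; linarith)
  refine hd.congr_deriv ?_
  have hs : Summable fun n : ℕ => besselCoeff c n * (n * y ^ (n - 1)) := by
    refine Summable.of_norm_bounded hu fun n => ?_
    rw [Real.norm_eq_abs, abs_mul, abs_mul, abs_pow, Nat.abs_cast]
    gcongr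
    · exact hK n
    · linarith
  rw [hs.tsum_eq_zero_add]
  simp only [Nat.cast_zero, zero_mul, mul_zero, zero_add, Nat.add_sub_cancel, besselClifford]
  rw [← tsum_neg]
  refine tsum_congr fun n => ?_
  push_cast
  rw [← mul_assoc, besselCoeff_succ_mul, neg_mul]

theorem continuous_besselClifford {c : ℝ} (hc : 0 < c) : Continuous (besselClifford c) :=
  continuous_iff_continuousAt.2 fun y => (hasDerivAt_besselClifford hc y).continuousAt

/-- Compare coefficients: multiplying the n-th coefficient for c + 1 by n + c gives that for c, and
the part with factor n sums to -y times the function for c + 2. -/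
theorem besselClifford_recurrence {c : ℝ} (hc : 0 < c) (y : ℝ) :
    c * besselClifford (c + 1) y - y * besselClifford (c + 2) y = besselClifford c y := by
  have h1 := (summable_besselClifford (by linarith : 0 < c + 1) y).hasSum.mul_left c
  have h2 : HasSum (fun n : ℕ => n * besselCoeff (c + 1) n * y ^ n)
      (-(y * besselClifford (c + 2) y)) := by
    rw [← hasSum_nat_add_iff' 1]
    have h := (summable_besselClifford (by linarith : 0 < c + 2) y).hasSum.mul_left (-y)
    simp only [Finset.range_one, Finset.sum_singleton, Nat.cast_zero, zero_mul, sub_zero]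
    rw [← neg_mul]
    refine Eq.mp (congrArg (HasSum · _) (funext fun n => ?_)) h
    have hc2 : c + 2 = c + 1 + 1 := by ring
    have h3 := besselCoeff_succ_mul (c := c + 1) n
    rw [← hc2] at h3
    push_cast
    linear_combination -y ^ (n + 1) * h3
  have h3 := h1.add h2
  rw [sub_eq_add_neg]
  refine h3.unique
    (Eq.mp (congrArg (HasSum · _) (funext fun n => ?_)) (summable_besselClifford hc y).hasSum)
  have hpos : 0 < (n : ℝ) + c := by positivity
  have h4 : besselCoeff (c + 1) n * (n + c) = besselCoeff c n := by
    rw [besselCoeff, besselCoeff, ← add_assoc, Real.Gamma_add_one hpos.ne']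
    have := (Real.Gamma_pos_of_pos hpos).ne'
    field_simp
  rw [← h4]
  ring

theorem besselJ_eq {ν z : ℝ} (hz : 0 < z) :
    besselJ ν z = (z / 2) ^ ν * besselClifford (ν + 1) (z ^ 2 / 4) := by
  rw [besselJ, besselClifford, ← tsum_mul_left]
  refine tsum_congr fun n => ?_
  have h : (z ^ 2 / 4) ^ n = (z / 2) ^ (2 * n) := by
    rw [pow_mul]; congr 1; ring
  have hz2 : 0 < z / 2 := by positivity
  rw [besselCoeff, Real.rpow_add hz2, h, ← add_assoc]
  have : (z / 2) ^ (2 * (n : ℝ)) = (z / 2) ^ (2 * n) := by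
    rw [← Real.rpow_natCast]; push_cast; rfl
  rw [this]
  ring

/-! ### Polar coordinates and Gaussian moments. -/

variable {m : ℕ}

/-- Polar coordinates in Euclidean space. -/
theorem integral_eq_integral_sphere [NeZero m] {F : EuclideanSpace ℝ (Fin m) → ℝ}
    (hF : Integrable F) :
    ∫ x, F x = ∫ r in Ioi (0 : ℝ), r ^ (m - 1) *
      ∫ w : Metric.sphere (0 : EuclideanSpace ℝ (Fin m)) 1, F (r • (w : EuclideanSpace ℝ (Fin m)))
        ∂(volume : Measure (EuclideanSpace ℝ (Fin m))).toSphere := by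
  have hmp :=
    (volume : Measure (EuclideanSpace ℝ (Fin m))).measurePreserving_homeomorphUnitSphereProd
  have hemb := (homeomorphUnitSphereProd (EuclideanSpace ℝ (Fin m))).measurableEmbedding
  set G : (Metric.sphere (0 : EuclideanSpace ℝ (Fin m)) 1) × Ioi (0:ℝ) → ℝ :=
    fun p => F ((p.2 : ℝ) • (p.1 : EuclideanSpace ℝ (Fin m))) with hG
  have hGF : ∀ x : ({0}ᶜ : Set (EuclideanSpace ℝ (Fin m))),
      G (homeomorphUnitSphereProd _ x) = F x := by
    intro x
    have := congrArg Subtype.val ((homeomorphUnitSphereProd _).symm_apply_apply x)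
    rw [homeomorphUnitSphereProd_symm_apply_coe] at this
    simp only [hG, this]
  have hint : Integrable G ((volume : Measure (EuclideanSpace ℝ (Fin m))).toSphere.prod
      (Measure.volumeIoiPow (Module.finrank ℝ (EuclideanSpace ℝ (Fin m)) - 1))) := by
    rw [← hmp.integrable_comp_emb hemb]
    have : (G ∘ homeomorphUnitSphereProd _) =
        fun x : ({0}ᶜ : Set (EuclideanSpace ℝ (Fin m))) => F x :=
      funext hGF
    rw [this]
    exact (integrableOn_iff_comap_subtypeVal (measurableSet_singleton _).compl).1 hF.integrableOn
  calc ∫ x, F x =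
      ∫ x : ({0}ᶜ : Set (EuclideanSpace ℝ (Fin m))), F x ∂(volume.comap Subtype.val) := by
        rw [integral_subtype_comap (measurableSet_singleton _).compl F, restrict_compl_singleton]
    _ = ∫ p, G p ∂((volume : Measure (EuclideanSpace ℝ (Fin m))).toSphere.prod
          (Measure.volumeIoiPow (Module.finrank ℝ (EuclideanSpace ℝ (Fin m)) - 1))) := by
        rw [← hmp.integral_comp hemb]
        simp only [hGF]
    _ = _ := by
        rw [integral_prod_symm _ hint, finrank_euclideanSpace_fin]
        simp only [Measure.volumeIoiPow, ENNReal.ofReal, hG]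
        rw [integral_withDensity_eq_integral_smul
          ((measurable_subtype_coe.pow_const _).real_toNNReal),
          integral_subtype_comap measurableSet_Ioi fun a : ℝ => Real.toNNReal (a ^ (m - 1)) •
            ∫ w : Metric.sphere (0 : EuclideanSpace ℝ (Fin m)) 1,
              F (a • (w : EuclideanSpace ℝ (Fin m)))
              ∂(volume : Measure (EuclideanSpace ℝ (Fin m))).toSphere]
        refine setIntegral_congr_fun measurableSet_Ioi fun r hr => ?_
        rw [NNReal.smul_def, Real.coe_toNNReal _ (pow_nonneg (le_of_lt hr) _), smul_eq_mul]

theorem integral_pow_mul_exp_neg_sq (n : ℕ) :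
    ∫ t : ℝ, t ^ (2 * n) * Real.exp (-t ^ 2) = Real.Gamma (n + 1 / 2) := by
  have h := integral_comp_abs (f := fun t : ℝ => t ^ (2 * n) * Real.exp (-t ^ 2))
  simp only [Even.pow_abs (even_two_mul n), sq_abs] at h
  rw [h]
  have h2 := integral_rpow_mul_exp_neg_rpow (p := 2) (q := (2 * n : ℕ)) two_pos
    (by have : (0:ℝ) ≤ (2 * n : ℕ) := Nat.cast_nonneg _
        linarith)
  simp only [Real.rpow_natCast, Real.rpow_two] at h2
  rw [h2]
  push_cast
  have : ((2 * n + 1) / 2 : ℝ) = n + 1 / 2 := by ring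
  rw [this]
  ring

theorem integrable_pow_mul_exp_neg_sq (n : ℕ) :
    Integrable fun t : ℝ => t ^ (2 * n) * Real.exp (-t ^ 2) := by
  -- A non-integrable function would have integral zero, whereas the value just computed is
  -- positive.
  by_contra h
  have := integral_pow_mul_exp_neg_sq n
  rw [integral_undef h] at this
  exact (Real.Gamma_pos_of_pos (by positivity : (0:ℝ) < n + 1 / 2)).ne this

theorem exp_neg_norm_sq (x : EuclideanSpace ℝ (Fin m)) :
    Real.exp (-‖x‖ ^ 2) = ∏ i, Real.exp (-x i ^ 2) := by
  rw [← Real.exp_sum, EuclideanSpace.norm_sq_eq]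
  simp [Finset.sum_neg_distrib]

theorem coord_gaussian_eq_prod (i₀ : Fin m) (n : ℕ) (x : Fin m → ℝ) :
    x i₀ ^ (2 * n) * ∏ i, Real.exp (-x i ^ 2) =
      ∏ i, x i ^ (2 * if i = i₀ then n else 0) * Real.exp (-x i ^ 2) := by
  rw [Finset.prod_mul_distrib]
  congr 1
  rw [Finset.prod_eq_single i₀]
  · simp
  · intro i _ hi; simp [hi]
  · simp

theorem integrable_coord_pow_gaussian (i₀ : Fin m) (n : ℕ) :
    Integrable fun x : EuclideanSpace ℝ (Fin m) => x i₀ ^ (2 * n) * Real.exp (-‖x‖ ^ 2) := by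
  have h : Integrable fun x : Fin m → ℝ => ∏ i, x i ^ (2 * if i = i₀ then n else 0) *
      Real.exp (-x i ^ 2) :=
    Integrable.fintype_prod (f := fun i t => t ^ (2 * if i = i₀ then n else 0) *
      Real.exp (-t ^ 2)) fun i => integrable_pow_mul_exp_neg_sq _
  have h2 := (PiLp.volume_preserving_ofLp (Fin m)).integrable_comp_emb
    (MeasurableEquiv.toLp 2 (Fin m → ℝ)).symm.measurableEmbedding |>.2 h
  refine h2.congr (ae_of_all _ fun x => ?_)
  simp only [Function.comp]
  rw [exp_neg_norm_sq, coord_gaussian_eq_prod]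

theorem integral_coord_pow_gaussian (i₀ : Fin m) (n : ℕ) :
    ∫ x : EuclideanSpace ℝ (Fin m), x i₀ ^ (2 * n) * Real.exp (-‖x‖ ^ 2) =
      Real.Gamma (n + 1 / 2) * Real.sqrt Real.pi ^ (m - 1) := by
  simp only [exp_neg_norm_sq, coord_gaussian_eq_prod]
  have h2 := (PiLp.volume_preserving_ofLp (Fin m)).integral_comp
    (MeasurableEquiv.toLp 2 (Fin m → ℝ)).symm.measurableEmbedding
    (fun x : Fin m → ℝ => ∏ i, x i ^ (2 * if i = i₀ then n else 0) * Real.exp (-x i ^ 2))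
  refine h2.trans ?_
  rw [integral_fintype_prod_volume_eq_prod (fun i t => t ^ (2 * if i = i₀ then n else 0) *
      Real.exp (-t ^ 2))]
  simp only [integral_pow_mul_exp_neg_sq]
  rw [← Finset.mul_prod_erase _ _ (Finset.mem_univ i₀), if_pos rfl,
    Finset.prod_congr rfl (g := fun _ => Real.sqrt Real.pi)]
  · simp
  · intro i hi
    rw [if_neg (Finset.ne_of_mem_erase hi), ← Real.Gamma_one_half_eq]
    simp

end

/-! ### Spherical integrals of cosine and sine. -/

noncomputable section

variable {m : ℕ}

/-- The surface measure of the unit sphere. -/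
abbrev sphereMeasure (m : ℕ) : Measure (Metric.sphere (0 : EuclideanSpace ℝ (Fin m)) 1) :=
  (volume : Measure (EuclideanSpace ℝ (Fin m))).toSphere

theorem exists_isometry_map_eq {v w : EuclideanSpace ℝ (Fin m)} (h : ‖v‖ = ‖w‖) :
    ∃ e : EuclideanSpace ℝ (Fin m) ≃ₗᵢ[ℝ] EuclideanSpace ℝ (Fin m), e v = w :=
  ⟨_, Submodule.reflection_sub h⟩

theorem integral_inner_pow_gaussian [NeZero m] {ξ : EuclideanSpace ℝ (Fin m)} (hξ : ‖ξ‖ = 1)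
    (n : ℕ) :
    Integrable (fun x : EuclideanSpace ℝ (Fin m) =>
      inner ℝ x ξ ^ (2 * n) * Real.exp (-‖x‖ ^ 2)) ∧
    ∫ x : EuclideanSpace ℝ (Fin m), inner ℝ x ξ ^ (2 * n) * Real.exp (-‖x‖ ^ 2) =
      Real.Gamma (n + 1 / 2) * Real.sqrt Real.pi ^ (m - 1) := by
  obtain ⟨e, he⟩ := exists_isometry_map_eq (v := ξ) (w := EuclideanSpace.single (0 : Fin m) 1)
    (by simp [hξ])
  have hx : ∀ x : EuclideanSpace ℝ (Fin m), inner ℝ x ξ ^ (2 * n) * Real.exp (-‖x‖ ^ 2) =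
      (fun y : EuclideanSpace ℝ (Fin m) => y 0 ^ (2 * n) * Real.exp (-‖y‖ ^ 2)) (e x) := by
    intro x
    simp only [e.norm_map]
    rw [← e.inner_map_map, he, EuclideanSpace.inner_single_right]
    simp
  simp only [hx]
  have hemb : MeasurableEmbedding e := e.toHomeomorph.measurableEmbedding
  exact ⟨(e.measurePreserving.integrable_comp_emb hemb).2 (integrable_coord_pow_gaussian 0 n),
    (e.measurePreserving.integral_comp hemb _).trans (integral_coord_pow_gaussian 0 n)⟩

theorem integral_Ioi_pow_mul_exp_neg_sq (k : ℕ) :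
    ∫ r in Ioi (0 : ℝ), r ^ k * Real.exp (-r ^ 2) = Real.Gamma ((k + 1) / 2) / 2 := by
  have h2 := integral_rpow_mul_exp_neg_rpow (p := 2) (q := k) two_pos
    (by have : (0:ℝ) ≤ k := Nat.cast_nonneg _
        linarith)
  simp only [Real.rpow_natCast, Real.rpow_two] at h2
  rw [h2]
  ring

/-- The moment of the Gaussian e^{-|x|²} is computed twice: as a product of one-dimensional
integrals, after rotating ξ to a coordinate axis, and in polar coordinates, where the spherical
moment factors out. -/
theorem integral_sphere_inner_pow [NeZero m] {ξ : EuclideanSpace ℝ (Fin m)} (hξ : ‖ξ‖ = 1)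
    (n : ℕ) :
    ∫ w, inner ℝ (w : EuclideanSpace ℝ (Fin m)) ξ ^ (2 * n) ∂sphereMeasure m =
      2 * Real.Gamma (n + 1 / 2) * Real.sqrt Real.pi ^ (m - 1) / Real.Gamma (n + m / 2) := by
  obtain ⟨hi, h⟩ := integral_inner_pow_gaussian hξ n
  rw [integral_eq_integral_sphere hi] at h
  have hm : 1 ≤ m := NeZero.one_le
  have h1 : ∀ r ∈ Ioi (0:ℝ), r ^ (m - 1) * ∫ w : Metric.sphere (0 : EuclideanSpace ℝ (Fin m)) 1,
      inner ℝ (r • (w : EuclideanSpace ℝ (Fin m))) ξ ^ (2 * n) *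
        Real.exp (-‖r • (w : EuclideanSpace ℝ (Fin m))‖ ^ 2) ∂sphereMeasure m =
      (r ^ (m - 1 + 2 * n) * Real.exp (-r ^ 2)) *
        ∫ w, inner ℝ (w : EuclideanSpace ℝ (Fin m)) ξ ^ (2 * n) ∂sphereMeasure m := by
    intro r hr
    rw [← integral_const_mul, ← integral_const_mul]
    congr 1
    ext w
    have hw : ‖(w : EuclideanSpace ℝ (Fin m))‖ = 1 := norm_eq_of_mem_sphere w
    rw [real_inner_smul_left, norm_smul, hw, mul_one, Real.norm_eq_abs, sq_abs, mul_pow, pow_add]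
    ring
  rw [setIntegral_congr_fun measurableSet_Ioi h1, integral_mul_const,
    integral_Ioi_pow_mul_exp_neg_sq] at h
  have h3 : (((m - 1 + 2 * n : ℕ) : ℝ) + 1) / 2 = n + m / 2 := by
    push_cast [Nat.cast_sub hm]; ring
  rw [h3] at h
  have hm0 : (0:ℝ) < m := by exact_mod_cast hm
  have hG : 0 < Real.Gamma (n + m / 2) := Real.Gamma_pos_of_pos (by positivity)
  rw [eq_div_iff hG.ne']
  linarith

/-- Legendre duplication at half-integers: it matches the (2n)! of the trigonometric series with the
Γ(n + 1/2) of the spherical moments. -/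
theorem factorial_two_mul_mul_sqrt_pi (n : ℕ) :
    ((2 * n).factorial : ℝ) * Real.sqrt Real.pi = 4 ^ n * n.factorial * Real.Gamma (n + 1 / 2) := by
  induction n with
  | zero => simp [← Real.Gamma_one_half_eq]
  | succ n ih =>
    have h : ((n + 1 : ℕ) : ℝ) + 1 / 2 = (n + 1 / 2) + 1 := by push_cast; ring
    have h2 : 2 * (n + 1) = 2 * n + 1 + 1 := by ring
    rw [h, Real.Gamma_add_one (by positivity), h2, Nat.factorial_succ, Nat.factorial_succ,
      Nat.factorial_succ]
    push_cast
    linear_combination (2 * (n : ℝ) + 2) * (2 * n + 1) * ih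

/-- The integral of `cos (z ⟨w, ξ⟩)` over the unit sphere. -/
def sphereCos (m : ℕ) (z : ℝ) : ℝ := 2 * Real.sqrt Real.pi ^ m * besselClifford (m / 2) (z ^ 2 / 4)

/-- The integral of `sin (z ⟨w, ξ⟩) ⟨w, ξ⟩` over the unit sphere. -/
def sphereSin (m : ℕ) (z : ℝ) : ℝ :=
  Real.sqrt Real.pi ^ m * z * besselClifford (m / 2 + 1) (z ^ 2 / 4)

theorem abs_inner_sphere_le {ξ : EuclideanSpace ℝ (Fin m)} (hξ : ‖ξ‖ = 1)
    (w : Metric.sphere (0 : EuclideanSpace ℝ (Fin m)) 1) :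
    |inner ℝ (w : EuclideanSpace ℝ (Fin m)) ξ| ≤ 1 := by
  have := abs_real_inner_le_norm (w : EuclideanSpace ℝ (Fin m)) ξ
  rwa [norm_eq_of_mem_sphere w, hξ, one_mul] at this

theorem hasSum_integral_sphere_of_le {f : ℕ → Metric.sphere (0 : EuclideanSpace ℝ (Fin m)) 1 → ℝ}
    {u : ℕ → ℝ} (hf : ∀ n, Continuous (f n)) (hu : Summable u) (hfu : ∀ n w, |f n w| ≤ u n) :
    HasSum (fun n => ∫ w, f n w ∂sphereMeasure m) (∫ w, ∑' n, f n w ∂sphereMeasure m) := by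
  refine hasSum_integral_of_summable_integral_norm (fun n => ?_) ?_
  · exact Integrable.of_bound (hf n).aestronglyMeasurable (u n) (ae_of_all _ (hfu n))
  · refine Summable.of_nonneg_of_le (fun n => integral_nonneg fun _ => norm_nonneg _) (fun n => ?_)
      (hu.mul_left ((sphereMeasure m).real univ))
    rw [← smul_eq_mul, ← integral_const]
    refine integral_mono_of_nonneg (ae_of_all _ fun _ => norm_nonneg _) (integrable_const _)
      (ae_of_all _ (hfu n))

/-- Integrate the cosine series term by term. The even moments turn it into the Bessel–Clifford
series of index m/2. -/
theorem integral_sphere_cos [NeZero m] {ξ : EuclideanSpace ℝ (Fin m)} (hξ : ‖ξ‖ = 1) (z : ℝ) :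
    ∫ w, Real.cos (z * inner ℝ (w : EuclideanSpace ℝ (Fin m)) ξ) ∂sphereMeasure m =
      sphereCos m z := by
  have hm : 1 ≤ m := NeZero.one_le
  have hm0 : (0:ℝ) < m := by exact_mod_cast hm
  have hs := hasSum_integral_sphere_of_le (m := m)
    (f := fun n w => (-1) ^ n * (z * inner ℝ (w : EuclideanSpace ℝ (Fin m)) ξ) ^ (2 * n) /
      ((2 * n).factorial : ℝ)) (u := fun n => |z| ^ (2 * n) / ((2 * n).factorial : ℝ))
    (fun n => by fun_prop)
    ((Real.summable_pow_div_factorial |z|).comp_injective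
      (fun a b h => by simpa using h : Function.Injective fun n => 2 * n))
    (fun n w => by
      rw [abs_div, abs_mul, abs_pow, abs_neg, abs_one, one_pow, one_mul, abs_pow, abs_mul,
        Nat.abs_cast]
      gcongr
      exact mul_le_of_le_one_right (abs_nonneg z) (abs_inner_sphere_le hξ w))
  simp only [(Real.hasSum_cos _).tsum_eq] at hs
  refine hs.unique ?_
  have h2 := (summable_besselClifford (by positivity : (0:ℝ) < m / 2) (z ^ 2 / 4)).hasSum.mul_left
    (2 * Real.sqrt Real.pi ^ m)
  refine Eq.mp (congrArg (HasSum · _) (funext fun n => ?_)) h2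
  have h3 : ∀ t : ℝ, (-1) ^ n * (z * t) ^ (2 * n) / ((2 * n).factorial : ℝ) =
      (-1) ^ n * z ^ (2 * n) / ((2 * n).factorial : ℝ) * t ^ (2 * n) := fun t => by ring
  simp only [h3]
  rw [integral_const_mul, integral_sphere_inner_pow hξ, besselCoeff]
  have hG : 0 < Real.Gamma (n + m / 2) := Real.Gamma_pos_of_pos (by positivity)
  have h4 := factorial_two_mul_mul_sqrt_pi n
  have hπ : 0 < Real.sqrt Real.pi := Real.sqrt_pos.2 Real.pi_pos
  have h5 : Real.sqrt Real.pi ^ m = Real.sqrt Real.pi ^ (m - 1) * Real.sqrt Real.pi := by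
    rw [← pow_succ, Nat.sub_add_cancel hm]
  have h6 : (z ^ 2 / 4) ^ n = z ^ (2 * n) / 4 ^ n := by rw [div_pow, ← pow_mul]
  rw [h5, h6]
  generalize Real.Gamma (n + 1 / 2) = G at h4 ⊢
  field_simp
  linear_combination z ^ (2 * n) * h4

theorem integral_sphere_sin [NeZero m] {ξ : EuclideanSpace ℝ (Fin m)} (hξ : ‖ξ‖ = 1) (z : ℝ) :
    ∫ w, Real.sin (z * inner ℝ (w : EuclideanSpace ℝ (Fin m)) ξ) *
      inner ℝ (w : EuclideanSpace ℝ (Fin m)) ξ ∂sphereMeasure m = sphereSin m z := by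
  have hm : 1 ≤ m := NeZero.one_le
  have hm0 : (0:ℝ) < m := by exact_mod_cast hm
  have hs := hasSum_integral_sphere_of_le (m := m)
    (f := fun n w => (-1) ^ n * (z * inner ℝ (w : EuclideanSpace ℝ (Fin m)) ξ) ^ (2 * n + 1) /
      ((2 * n + 1).factorial : ℝ) * inner ℝ (w : EuclideanSpace ℝ (Fin m)) ξ)
    (u := fun n => |z| ^ (2 * n + 1) / ((2 * n + 1).factorial : ℝ))
    (fun n => by fun_prop)
    ((Real.summable_pow_div_factorial |z|).comp_injective
      (fun a b h => by simpa using h : Function.Injective fun n => 2 * n + 1))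
    (fun n w => by
      have hw := abs_inner_sphere_le hξ w
      rw [abs_mul, abs_div, abs_mul, abs_pow, abs_neg, abs_one, one_pow, one_mul, abs_pow, abs_mul,
        Nat.abs_cast]
      refine (mul_le_of_le_one_right (by positivity) hw).trans ?_
      gcongr
      exact mul_le_of_le_one_right (abs_nonneg z) hw)
  simp only [tsum_mul_right, (Real.hasSum_sin _).tsum_eq] at hs
  refine hs.unique ?_
  have h2 := (summable_besselClifford (by positivity : (0:ℝ) < m / 2 + 1)
    (z ^ 2 / 4)).hasSum.mul_left (Real.sqrt Real.pi ^ m * z)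
  refine Eq.mp (congrArg (HasSum · _) (funext fun n => ?_)) h2
  have h3 : ∀ t : ℝ, (-1) ^ n * (z * t) ^ (2 * n + 1) / ((2 * n + 1).factorial : ℝ) * t =
      (-1) ^ n * z ^ (2 * n + 1) / ((2 * n + 1).factorial : ℝ) * t ^ (2 * (n + 1)) :=
    fun t => by ring
  simp only [h3]
  have h7 : ((n + 1 : ℕ) : ℝ) + m / 2 = n + (m / 2 + 1) := by push_cast; ring
  rw [integral_const_mul, integral_sphere_inner_pow hξ, besselCoeff, h7]
  have hG : 0 < Real.Gamma (n + (m / 2 + 1)) := Real.Gamma_pos_of_pos (by positivity)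
  have h4 := factorial_two_mul_mul_sqrt_pi (n + 1)
  have h8 : 2 * (n + 1) = 2 * n + 1 + 1 := by ring
  rw [h8, Nat.factorial_succ (2 * n + 1), Nat.factorial_succ n] at h4
  have hπ : 0 < Real.sqrt Real.pi := Real.sqrt_pos.2 Real.pi_pos
  have h5 : Real.sqrt Real.pi ^ m = Real.sqrt Real.pi ^ (m - 1) * Real.sqrt Real.pi := by
    rw [← pow_succ, Nat.sub_add_cancel hm]
  have h6 : (z ^ 2 / 4) ^ n = z ^ (2 * n) / 4 ^ n := by rw [div_pow, ← pow_mul]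
  have h9 : ((2 * n + 1).factorial : ℝ) * Real.sqrt Real.pi =
      2 * 4 ^ n * n.factorial * Real.Gamma ((n + 1 : ℕ) + 1 / 2) := by
    have h0 : (2 * (n : ℝ) + 2) ≠ 0 := by positivity
    refine mul_left_cancel₀ h0 ?_
    push_cast at h4 ⊢
    linear_combination h4
  rw [h5, h6]
  generalize Real.Gamma ((n + 1 : ℕ) + 1 / 2) = G at h9 ⊢
  field_simp
  linear_combination z ^ (2 * n + 1) * h9

theorem hasDerivAt_sphereCos [NeZero m] (z : ℝ) :
    HasDerivAt (sphereCos m) (-sphereSin m z) z := by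
  have hm0 : (0:ℝ) < m := by exact_mod_cast (NeZero.one_le : 1 ≤ m)
  have h1 : HasDerivAt (fun z : ℝ => z ^ 2 / 4) (z / 2) z :=
    ((hasDerivAt_pow 2 z).div_const 4).congr_deriv (by simp; ring)
  have h := ((hasDerivAt_besselClifford (by positivity : (0:ℝ) < m / 2) (z ^ 2 / 4)).comp z
    h1).const_mul (2 * Real.sqrt Real.pi ^ m)
  refine h.congr_deriv ?_
  rw [sphereSin]
  ring

/-- Together with C' = -S this makes the kernels dual to the profiles: integrating by parts leads
from one kernel to the other. The identity is the three-term recurrence with c = m/2. -/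
theorem hasDerivAt_pow_mul_sphereSin [NeZero m] (z : ℝ) :
    HasDerivAt (fun z => z ^ (m - 1) * sphereSin m z) (z ^ (m - 1) * sphereCos m z) z := by
  have hm : 1 ≤ m := NeZero.one_le
  have hm0 : (0:ℝ) < m := by exact_mod_cast hm
  have h1 : HasDerivAt (fun z : ℝ => z ^ 2 / 4) (z / 2) z :=
    ((hasDerivAt_pow 2 z).div_const 4).congr_deriv (by simp; ring)
  have h := ((hasDerivAt_pow m z).mul ((hasDerivAt_besselClifford
    (by positivity : (0:ℝ) < m / 2 + 1) (z ^ 2 / 4)).comp z h1)).const_mul (Real.sqrt Real.pi ^ m)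
  have hz : ∀ z : ℝ, z ^ m = z ^ (m - 1) * z := fun z => by
    rw [← pow_succ, Nat.sub_add_cancel hm]
  have hf : (fun z => z ^ (m - 1) * sphereSin m z) = fun z => Real.sqrt Real.pi ^ m *
      (((fun z : ℝ => z ^ m) * (besselClifford (m / 2 + 1) ∘ fun z : ℝ => z ^ 2 / 4) : ℝ → ℝ)
        z) := by
    ext z
    simp only [sphereSin, Pi.mul_apply, Function.comp, hz z]
    ring
  rw [hf]
  refine h.congr_deriv ?_
  have hr := besselClifford_recurrence (by positivity : (0:ℝ) < m / 2) (z ^ 2 / 4)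
  have h2 : (m : ℝ) / 2 + 1 + 1 = m / 2 + 2 := by ring
  rw [sphereCos, ← hr, h2, hz z]
  simp only [Function.comp]
  ring

theorem integral_cos_mul_radial [NeZero m] {ξ : EuclideanSpace ℝ (Fin m)} (hξ : ‖ξ‖ = 1) (ρ : ℝ)
    {f : ℝ → ℝ} (hf : Integrable fun x : EuclideanSpace ℝ (Fin m) => f ‖x‖) :
    ∫ x : EuclideanSpace ℝ (Fin m), Real.cos (ρ * inner ℝ x ξ) * f ‖x‖ =
      ∫ r in Ioi (0:ℝ), f r * (r ^ (m - 1) * sphereCos m (r * ρ)) := by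
  have hi : Integrable fun x : EuclideanSpace ℝ (Fin m) => Real.cos (ρ * inner ℝ x ξ) * f ‖x‖ :=
    hf.bdd_mul (c := 1) (by fun_prop : Continuous fun x : EuclideanSpace ℝ (Fin m) =>
      Real.cos (ρ * inner ℝ x ξ)).aestronglyMeasurable
      (ae_of_all _ fun x => by rw [Real.norm_eq_abs]; exact Real.abs_cos_le_one _)
  rw [integral_eq_integral_sphere hi]
  refine setIntegral_congr_fun measurableSet_Ioi fun r hr => ?_
  have hr0 : (0:ℝ) < r := hr
  have h1 : ∀ w : Metric.sphere (0 : EuclideanSpace ℝ (Fin m)) 1,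
      Real.cos (ρ * inner ℝ (r • (w : EuclideanSpace ℝ (Fin m))) ξ) *
        f ‖r • (w : EuclideanSpace ℝ (Fin m))‖ =
      Real.cos ((r * ρ) * inner ℝ (w : EuclideanSpace ℝ (Fin m)) ξ) * f r := by
    intro w
    rw [real_inner_smul_left, norm_smul, norm_eq_of_mem_sphere w, mul_one, Real.norm_eq_abs,
      abs_of_pos hr0]
    ring_nf
  simp only [h1]
  rw [integral_mul_const, integral_sphere_cos hξ]
  ring

theorem integral_sin_mul_radial [NeZero m] {ξ : EuclideanSpace ℝ (Fin m)} (hξ : ‖ξ‖ = 1) (ρ : ℝ)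
    {f : ℝ → ℝ} (hfm : AEStronglyMeasurable fun x : EuclideanSpace ℝ (Fin m) => f ‖x‖)
    (hf : Integrable fun x : EuclideanSpace ℝ (Fin m) => ‖x‖ * f ‖x‖) :
    ∫ x : EuclideanSpace ℝ (Fin m), Real.sin (ρ * inner ℝ x ξ) * inner ℝ x ξ * f ‖x‖ =
      ∫ r in Ioi (0:ℝ), f r * (r ^ m * sphereSin m (r * ρ)) := by
  have hm : 1 ≤ m := NeZero.one_le
  have hi : Integrable fun x : EuclideanSpace ℝ (Fin m) =>
      Real.sin (ρ * inner ℝ x ξ) * inner ℝ x ξ * f ‖x‖ := by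
    refine hf.mono ?_ (ae_of_all _ fun x => ?_)
    · exact (by fun_prop : Continuous fun x : EuclideanSpace ℝ (Fin m) =>
        Real.sin (ρ * inner ℝ x ξ) * inner ℝ x ξ).aestronglyMeasurable.mul hfm
    · have h1 := abs_real_inner_le_norm x ξ
      rw [hξ, mul_one] at h1
      rw [norm_mul, norm_mul, norm_mul, Real.norm_eq_abs, Real.norm_eq_abs, norm_norm]
      gcongr
      calc _ ≤ 1 * |inner ℝ x ξ| := by gcongr; exact Real.abs_sin_le_one _
        _ ≤ _ := by rwa [one_mul]
  rw [integral_eq_integral_sphere hi]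
  refine setIntegral_congr_fun measurableSet_Ioi fun r hr => ?_
  have hr0 : (0:ℝ) < r := hr
  have h1 : ∀ w : Metric.sphere (0 : EuclideanSpace ℝ (Fin m)) 1,
      Real.sin (ρ * inner ℝ (r • (w : EuclideanSpace ℝ (Fin m))) ξ) *
        inner ℝ (r • (w : EuclideanSpace ℝ (Fin m))) ξ * f ‖r • (w : EuclideanSpace ℝ (Fin m))‖ =
      Real.sin ((r * ρ) * inner ℝ (w : EuclideanSpace ℝ (Fin m)) ξ) *
        inner ℝ (w : EuclideanSpace ℝ (Fin m)) ξ * (r * f r) := by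
    intro w
    rw [real_inner_smul_left, norm_smul, norm_eq_of_mem_sphere w, mul_one, Real.norm_eq_abs,
      abs_of_pos hr0]
    ring_nf
  simp only [h1]
  rw [integral_mul_const, integral_sphere_sin hξ]
  have : r ^ m = r ^ (m - 1) * r := by rw [← pow_succ, Nat.sub_add_cancel hm]
  rw [this]
  ring

end

/-! ### Integration by parts along the chain and vanishing radial moments. -/

noncomputable section

/-- A radial chain that starts with the Jacobi weight `|1 - s|^a (1 + s)^b`, together with the
regularity of its first `ℓ` members. -/
structure JacobiChain (m ℓ : ℕ) (a b : ℝ) (H dH : ℕ → ℝ → ℝ) : Prop extends RadialChain m H dH where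
  zero_eq : ∀ s, 0 ≤ s → H 0 s = |1 - s| ^ a * (1 + s) ^ b
  continuousOn : ∀ q < ℓ, ContinuousOn (H q) (Ici 0)
  intervalIntegrable : ∀ q ≤ ℓ, ∀ R, 0 ≤ R → IntervalIntegrable (fun r => H q (r ^ 2)) volume 0 R
  eq_symbol : ∀ q s, 1 < s → H q s = |1 - s| ^ a * (1 + s) ^ b * jacobiSymbol m a b q s

theorem exists_jacobiChain (m ℓ : ℕ) (a b : ℝ) (ha : (ℓ : ℝ) - 1 < a ∨ ∃ n : ℕ, a = 2 * n) :
    ∃ H dH : ℕ → ℝ → ℝ, JacobiChain m ℓ a b H dH := by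
  obtain ⟨H, dH, h1, h2, h3, h4, h5⟩ := exists_radialChain m ℓ a b ha
  exact ⟨H, dH, h1, h2, h3, h4, h5⟩

/-- The unit sphere is the single exceptional radius; continuity of u there means that it
contributes no jump. -/
theorem integral_deriv_mul_eq_sub_off_one {u u' v v' : ℝ → ℝ} {R : ℝ} (hR : 0 ≤ R)
    (hu : ContinuousOn u (Icc 0 R)) (hu' : ∀ r, 0 < r → r ≠ 1 → HasDerivAt u (u' r) r)
    (hui : IntervalIntegrable u' volume 0 R) (hv : ∀ r, HasDerivAt v (v' r) r)
    (hv' : Continuous v') :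
    ∫ r in (0:ℝ)..R, u' r * v r = u R * v R - u 0 * v 0 - ∫ r in (0:ℝ)..R, u r * v' r := by
  have hvc : Continuous v := continuous_iff_continuousAt.2 fun r => (hv r).continuousAt
  have h1 : IntervalIntegrable (fun r => u' r * v r) volume 0 R :=
    hui.mul_continuousOn hvc.continuousOn
  have h2 : IntervalIntegrable (fun r => u r * v' r) volume 0 R := by
    refine ContinuousOn.intervalIntegrable ?_
    rw [uIcc_of_le hR]
    exact hu.mul hv'.continuousOn
  have h := integral_eq_of_hasDerivAt_off_countable_of_le (fun r => u r * v r)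
    (fun r => u' r * v r + u r * v' r) hR (countable_singleton 1) (hu.mul hvc.continuousOn)
    (fun r hr => (hu' r hr.1.1 hr.2).mul (hv r)) (h1.add h2)
  rw [intervalIntegral.integral_add h1 h2] at h
  linarith

variable {m ℓ : ℕ} {a b : ℝ} {H dH : ℕ → ℝ → ℝ}

theorem RadialChain.hasDerivAt_comp_sq (hH : RadialChain m H dH) (q : ℕ) {r : ℝ} (hr : 0 < r)
    (hr1 : r ≠ 1) : HasDerivAt (fun r => H q (r ^ 2)) (dH q (r ^ 2) * (2 * r)) r := by
  have hs1 : r ^ 2 ≠ 1 := fun h => hr1 ((pow_eq_one_iff_of_nonneg hr.le two_ne_zero).1 h)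
  have := HasDerivAt.comp (h₂ := H q) (h := fun r : ℝ => r ^ 2) r
    (hH.hasDerivAt q (r ^ 2) (sq_nonneg r) hs1) (hasDerivAt_pow 2 r)
  exact this.congr_deriv (by simp)

theorem JacobiChain.continuousOn_comp_sq (hH : JacobiChain m ℓ a b H dH) {q : ℕ} (hq : q < ℓ)
    (s : Set ℝ) : ContinuousOn (fun r => H q (r ^ 2)) s :=
  (hH.continuousOn q hq).comp (f := fun r : ℝ => r ^ 2) (by fun_prop) fun r _ => sq_nonneg r

/-- For even q, r H_{q+1}(r²) is the derivative of H_q(r²). The boundary term at 0 is removed by G 0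
= 0. -/
theorem JacobiChain.integral_even_succ (hH : JacobiChain m ℓ a b H dH) {q : ℕ} (hq : q < ℓ)
    (he : Even q) {G g : ℝ → ℝ} (hG : ∀ r, HasDerivAt G (g r) r) (hg : Continuous g)
    (hG0 : G 0 = 0) {R : ℝ} (hR : 0 ≤ R) :
    ∫ r in (0:ℝ)..R, H (q + 1) (r ^ 2) * (r * G r) =
      H q (R ^ 2) * G R - ∫ r in (0:ℝ)..R, H q (r ^ 2) * g r := by
  have h := integral_deriv_mul_eq_sub_off_one (u := fun r => H q (r ^ 2))
    (u' := fun r => H (q + 1) (r ^ 2) * r) hR (hH.continuousOn_comp_sq hq _)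
    (fun r hr hr1 => by
      have hs1 : r ^ 2 ≠ 1 := fun h => hr1 ((pow_eq_one_iff_of_nonneg hr.le two_ne_zero).1 h)
      refine (hH.hasDerivAt_comp_sq q hr hr1).congr_deriv ?_
      rw [hH.even_succ q _ he (sq_nonneg r) hs1]
      ring)
    ((hH.intervalIntegrable (q + 1) hq R hR).mul_continuousOn continuousOn_id) hG hg
  rw [hG0, mul_zero, sub_zero] at h
  rw [← h]
  simp only [mul_assoc]

/-- For odd q, r^{m-1} H_{q+1}(r²) is minus the derivative of r^m H_q(r²). The factor r^m removes
the boundary term at 0. -/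
theorem JacobiChain.integral_odd_succ (hH : JacobiChain m ℓ a b H dH) (hm : m ≠ 0) {q : ℕ}
    (hq : q < ℓ) (ho : Odd q) {G g : ℝ → ℝ} (hG : ∀ r, HasDerivAt G (g r) r) (hg : Continuous g)
    {R : ℝ} (hR : 0 ≤ R) :
    ∫ r in (0:ℝ)..R, H (q + 1) (r ^ 2) * (r ^ (m - 1) * G r) =
      -(H q (R ^ 2) * (R ^ m * G R)) + ∫ r in (0:ℝ)..R, H q (r ^ 2) * (r ^ m * g r) := by
  have hpow : ∀ r : ℝ, r ^ m = r ^ (m - 1) * r := fun r => by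
    rw [← pow_succ, Nat.sub_add_cancel (Nat.one_le_iff_ne_zero.2 hm)]
  have h := integral_deriv_mul_eq_sub_off_one (u := fun r => r ^ m * H q (r ^ 2))
    (u' := fun r => -(H (q + 1) (r ^ 2) * r ^ (m - 1))) hR
    ((by fun_prop : ContinuousOn (fun r : ℝ => r ^ m) _).mul (hH.continuousOn_comp_sq hq _))
    (fun r hr hr1 => by
      have hs1 : r ^ 2 ≠ 1 := fun h => hr1 ((pow_eq_one_iff_of_nonneg hr.le two_ne_zero).1 h)
      refine ((hasDerivAt_pow m r).mul (hH.hasDerivAt_comp_sq q hr hr1)).congr_deriv ?_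
      rw [hH.odd_succ q _ ho (sq_nonneg r) hs1, hpow]
      ring)
    ((hH.intervalIntegrable (q + 1) hq R hR).mul_continuousOn (by fun_prop)).neg hG hg
  simp only [zero_pow hm, zero_mul, sub_zero, neg_mul, intervalIntegral.integral_neg] at h
  have h1 : ∀ r, H (q + 1) (r ^ 2) * (r ^ (m - 1) * G r) =
      H (q + 1) (r ^ 2) * r ^ (m - 1) * G r := fun r => by ring
  have h2 : ∀ r, H q (r ^ 2) * (r ^ m * g r) = r ^ m * H q (r ^ 2) * g r := fun r => by ring
  simp only [h1, h2]
  linear_combination -h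

theorem rpow_le_of_comparable {x y c : ℝ} (hy : 0 < y) (h1 : y / 2 ≤ x) (h2 : x ≤ 2 * y) :
    x ^ c ≤ 2 ^ |c| * y ^ c := by
  rcases le_total 0 c with hc | hc
  · rw [abs_of_nonneg hc, ← Real.mul_rpow zero_le_two hy.le]
    exact Real.rpow_le_rpow (by linarith) h2 hc
  · rw [abs_of_nonpos hc]
    calc x ^ c ≤ (y / 2) ^ c := Real.rpow_le_rpow_of_nonpos (by positivity) h1 hc
      _ = _ := by
        rw [Real.div_rpow hy.le zero_le_two, Real.rpow_neg zero_le_two]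
        field_simp

/-- For s = r² ≥ 2 both |1 - s| and 1 + s lie between s/2 and 2s, so the weight is comparable to
s^{a+b}; the symbol supplies the further s^{-⌈q/2⌉}. -/
theorem JacobiChain.exists_abs_le (hH : JacobiChain m ℓ a b H dH) (q : ℕ) :
    ∃ C, 0 ≤ C ∧ ∀ r : ℝ, 2 ≤ r →
      |H q (r ^ 2)| ≤ C * r ^ (2 * (a + b) - 2 * ((q + 1) / 2 : ℕ)) := by
  obtain ⟨C, hC0, hC⟩ := exists_jacobiSymbol_le m a b q
  refine ⟨2 ^ |a| * 2 ^ |b| * C, by positivity, fun r hr => ?_⟩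
  have hr0 : 0 < r := by linarith
  have hs : 2 ≤ r ^ 2 := by nlinarith
  have hs0 : 0 < r ^ 2 := by positivity
  have h1 : |1 - r ^ 2| ^ a ≤ 2 ^ |a| * (r ^ 2) ^ a := by
    rw [abs_of_nonpos (by linarith)]
    exact rpow_le_of_comparable hs0 (by linarith) (by linarith)
  have h2 : (1 + r ^ 2) ^ b ≤ 2 ^ |b| * (r ^ 2) ^ b :=
    rpow_le_of_comparable hs0 (by linarith) (by linarith)
  have h3 : |jacobiSymbol m a b q (r ^ 2)| ≤ C / (r ^ 2) ^ ((q + 1) / 2) :=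
    (le_div_iff₀ (by positivity)).2 (hC _ hs)
  rw [hH.eq_symbol q _ (by linarith), abs_mul, abs_mul,
    abs_of_nonneg (Real.rpow_nonneg (abs_nonneg _) _),
    abs_of_nonneg (Real.rpow_nonneg (by linarith : 0 ≤ 1 + r ^ 2) _)]
  have h4 : r ^ (2 * (a + b) - 2 * ((q + 1) / 2 : ℕ)) =
      (r ^ 2) ^ a * (r ^ 2) ^ b / (r ^ 2) ^ ((q + 1) / 2) := by
    rw [← Real.rpow_add hs0, ← Real.rpow_natCast (r ^ 2), ← Real.rpow_sub hs0,
      ← Real.rpow_natCast r 2, ← Real.rpow_mul hr0.le]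
    congr 1
    push_cast
    ring
  rw [h4]
  calc _ ≤ (2 ^ |a| * (r ^ 2) ^ a) * (2 ^ |b| * (r ^ 2) ^ b) * (C / (r ^ 2) ^ ((q + 1) / 2)) := by
        gcongr
    _ = _ := by ring

theorem JacobiChain.tendsto_mul_pow (hH : JacobiChain m ℓ a b H dH) (q n : ℕ)
    (h : (n : ℝ) + 2 * (a + b) - 2 * ((q + 1) / 2 : ℕ) < 0) :
    Tendsto (fun R => H q (R ^ 2) * R ^ n) atTop (𝓝 0) := by
  obtain ⟨C, hC0, hC⟩ := hH.exists_abs_le q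
  have h1 := (tendsto_rpow_neg_atTop (neg_pos.2 h)).const_mul C
  rw [mul_zero, neg_neg] at h1
  refine squeeze_zero_norm' ?_ h1
  filter_upwards [eventually_ge_atTop 2] with r hr
  have hr0 : 0 < r := by linarith
  rw [Real.norm_eq_abs, abs_mul, abs_of_nonneg (pow_nonneg hr0.le n)]
  calc _ ≤ C * r ^ (2 * (a + b) - 2 * ((q + 1) / 2 : ℕ)) * r ^ n := by gcongr; exact hC r hr
    _ = _ := by
      rw [mul_assoc, ← Real.rpow_natCast r n, ← Real.rpow_add hr0]
      congr 2
      ring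

/-- Integration by parts replaces (k, q) by (k - 1, q - 1). This preserves the parity relation, the
inequality k < q and the decay condition, which is just what makes each boundary term vanish at
infinity. -/
theorem JacobiChain.tendsto_integral_mul_pow (hH : JacobiChain m ℓ a b H dH) (hm : m ≠ 0) (k : ℕ) :
    ∀ q ≤ ℓ, k < q → (Even k ↔ Even q) → (m : ℝ) + k - q + 2 * (a + b) < 0 →
      Tendsto (fun R => ∫ r in (0:ℝ)..R,
        H q (r ^ 2) * (r ^ (if Even q then m - 1 else m) * r ^ k)) atTop (𝓝 0) := by
  induction k with
  | zero =>
    intro q hq hkq hpar hlt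
    have hqe : Even q := hpar.1 Even.zero
    -- With k = 0 the integrand is an exact derivative (test function G = 1), so only the boundary
    -- term remains.
    obtain ⟨q, rfl⟩ : ∃ p, q = p + 1 := ⟨q - 1, by omega⟩
    have hqo : Odd q := by simpa [Nat.even_add_one] using hqe
    simp only [if_pos hqe, pow_zero]
    have h1 := (hH.tendsto_mul_pow q m (by
      obtain ⟨n, rfl⟩ := hqo
      have : (2 * n + 1 + 1) / 2 = n + 1 := by omega
      rw [this]
      push_cast at hlt ⊢
      linarith)).neg
    rw [neg_zero] at h1
    refine h1.congr' ?_
    filter_upwards [eventually_ge_atTop 0] with R hR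
    rw [hH.integral_odd_succ hm (by omega) hqo (G := fun _ => 1) (g := fun _ => 0)
      (fun r => hasDerivAt_const r 1) continuous_const hR]
    simp
  | succ k ih =>
    intro q hq hkq hpar hlt
    obtain ⟨q, rfl⟩ : ∃ p, q = p + 1 := ⟨q - 1, by omega⟩
    have hpar' : Even k ↔ Even q := by
      rw [Nat.even_add_one, Nat.even_add_one] at hpar
      exact not_iff_not.1 hpar
    have ih' := ih q (by omega) (by omega) hpar' (by push_cast at hlt ⊢; linarith)
    rcases Nat.even_or_odd q with hqe | hqo
    · have hne : ¬ Even (q + 1) := by simpa [Nat.even_add_one] using hqe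
      simp only [if_neg hne]
      simp only [if_pos hqe] at ih'
      have h1 := (hH.tendsto_mul_pow q (m + k) (by
        obtain ⟨n, rfl⟩ := hqe
        have : (n + n + 1) / 2 = n := by omega
        rw [this]
        push_cast at hlt ⊢
        linarith)).sub (ih'.const_mul ((m + k : ℕ) : ℝ))
      rw [mul_zero, sub_zero] at h1
      refine h1.congr' ?_
      filter_upwards [eventually_ge_atTop 0] with R hR
      have h2 := hH.integral_even_succ (by omega) hqe (G := fun r => r ^ (m + k))
        (fun r => hasDerivAt_pow (m + k) r) (by fun_prop) (by simp [hm]) hR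
      have h3 : ∀ r : ℝ, r ^ m * r ^ (k + 1) = r * r ^ (m + k) := fun r => by ring
      simp only [h3]
      rw [h2, ← intervalIntegral.integral_const_mul]
      congr 2
      ext r
      have : m + k - 1 = m - 1 + k := by omega
      rw [this, pow_add]
      ring
    · have hne : ¬ Even q := Nat.not_even_iff_odd.2 hqo
      have hqe : Even (q + 1) := by simpa [Nat.even_add_one] using hqo
      simp only [if_pos hqe]
      simp only [if_neg hne] at ih'
      have h1 := (hH.tendsto_mul_pow q (m + k + 1) (by
        obtain ⟨n, rfl⟩ := hqo
        have : (2 * n + 1 + 1) / 2 = n + 1 := by omega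
        rw [this]
        push_cast at hlt ⊢
        linarith)).neg.add (ih'.const_mul ((k + 1 : ℕ) : ℝ))
      rw [mul_zero, add_zero, neg_zero] at h1
      refine h1.congr' ?_
      filter_upwards [eventually_ge_atTop 0] with R hR
      rw [hH.integral_odd_succ hm (by omega) hqo (G := fun r => r ^ (k + 1))
        (fun r => hasDerivAt_pow (k + 1) r) (by fun_prop) hR,
        ← intervalIntegral.integral_const_mul]
      congr 2
      · ring
      · ext r
        simp only [Nat.add_sub_cancel]
        ring

end

/-! ### Averaging over dyadic intervals and slowly varying weights. -/

noncomputable section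

/-- A quadratic weight on `[N, 2N]` of total mass one, vanishing at the end points. -/
def bump (N r : ℝ) : ℝ := 6 * ((r - N) * (2 * N - r)) / N ^ 3

/-- The derivative of `bump`. -/
def bumpDeriv (N r : ℝ) : ℝ := 6 * (3 * N - 2 * r) / N ^ 3

theorem hasDerivAt_bump (N r : ℝ) : HasDerivAt (bump N) (bumpDeriv N r) r := by
  have h := ((((hasDerivAt_id r).sub_const N).mul ((hasDerivAt_id r).const_sub (2 * N))).const_mul
    6).div_const (N ^ 3)
  refine h.congr_deriv ?_
  simp only [bumpDeriv, id]
  ring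

theorem hasDerivAt_bumpDeriv (N r : ℝ) : HasDerivAt (bumpDeriv N) (-12 / N ^ 3) r := by
  have h := ((((hasDerivAt_id r).const_mul 2).const_sub (3 * N)).const_mul 6).div_const (N ^ 3)
  refine h.congr_deriv ?_
  ring

theorem abs_bump_le {N r : ℝ} (hN : 0 < N) (h1 : N ≤ r) (h2 : r ≤ 2 * N) : |bump N r| ≤ 2 / N := by
  have h0 : 0 ≤ (r - N) * (2 * N - r) := mul_nonneg (by linarith) (by linarith)
  rw [bump, abs_of_nonneg (by positivity), div_le_div_iff₀ (by positivity) hN]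
  have : 6 * ((r - N) * (2 * N - r)) ≤ 2 * N ^ 2 := by nlinarith [sq_nonneg (2 * r - 3 * N)]
  calc _ ≤ 2 * N ^ 2 * N := by gcongr
    _ = _ := by ring

theorem abs_bumpDeriv_le {N r : ℝ} (hN : 0 < N) (h1 : N ≤ r) (h2 : r ≤ 2 * N) :
    |bumpDeriv N r| ≤ 6 / N ^ 2 := by
  have : |3 * N - 2 * r| ≤ N := abs_le.2 ⟨by linarith, by linarith⟩
  rw [bumpDeriv, abs_div, abs_mul, abs_of_pos (by positivity : 0 < N ^ 3),
    div_le_div_iff₀ (by positivity) (by positivity), abs_of_pos (by norm_num : (0:ℝ) < 6)]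
  calc 6 * |3 * N - 2 * r| * N ^ 2 ≤ 6 * N * N ^ 2 := by gcongr
    _ = _ := by ring

theorem continuous_bump (N : ℝ) : Continuous (bump N) :=
  continuous_iff_continuousAt.2 fun r => (hasDerivAt_bump N r).continuousAt

theorem continuous_bumpDeriv (N : ℝ) : Continuous (bumpDeriv N) :=
  continuous_iff_continuousAt.2 fun r => (hasDerivAt_bumpDeriv N r).continuousAt

theorem integral_bump {N : ℝ} (hN : N ≠ 0) : ∫ r in N..2 * N, bump N r = 1 := by
  have h : ∀ r ∈ uIcc N (2 * N), HasDerivAt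
      (fun r : ℝ => 6 * (3 * N * (r ^ 2 / 2) - r ^ 3 / 3 - 2 * N ^ 2 * r) / N ^ 3)
      (bump N r) r := by
    intro r _
    have := (((((hasDerivAt_pow 2 r).div_const 2).const_mul (3 * N)).sub
      ((hasDerivAt_pow 3 r).div_const 3)).sub ((hasDerivAt_id r).const_mul (2 * N ^ 2))).const_mul 6
      |>.div_const (N ^ 3)
    refine this.congr_deriv ?_
    rw [bump]
    push_cast
    ring
  rw [intervalIntegral.integral_eq_sub_of_hasDerivAt h
    ((continuous_bump N).intervalIntegrable _ _)]
  field_simp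
  ring

/-- Averages of a convergent function converge to the same limit. -/
theorem tendsto_bump_average {f : ℝ → ℝ} {L : ℝ} (hf : Tendsto f atTop (𝓝 L))
    (hfc : ContinuousOn f (Ici 0)) :
    Tendsto (fun N => ∫ r in N..2 * N, bump N r * f r) atTop (𝓝 L) := by
  rw [Metric.tendsto_atTop] at hf ⊢
  intro ε hε
  obtain ⟨N₀, hN₀⟩ := hf (ε / 3) (by positivity)
  refine ⟨max N₀ 1, fun N hN => ?_⟩
  have hN1 : 1 ≤ N := (le_max_right _ _).trans hN
  have hN0 : 0 < N := by linarith
  have hle : N ≤ 2 * N := by linarith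
  have hi : IntervalIntegrable (fun r => bump N r * f r) volume N (2 * N) := by
    refine ContinuousOn.intervalIntegrable ?_
    rw [uIcc_of_le hle]
    exact (continuous_bump N).continuousOn.mul
      (hfc.mono fun r hr => mem_Ici.2 (hN0.le.trans hr.1))
  have hi2 : IntervalIntegrable (fun r => bump N r * L) volume N (2 * N) :=
    ((continuous_bump N).mul continuous_const).intervalIntegrable _ _
  have hL : L = ∫ r in N..2 * N, bump N r * L := by
    rw [intervalIntegral.integral_mul_const, integral_bump hN0.ne', one_mul]
  rw [Real.dist_eq]
  conv_lhs => rw [hL]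
  rw [← intervalIntegral.integral_sub hi hi2]
  -- The interval has length N and the weight is at most 2/N, so the error is at most 2ε/3.
  have hb := intervalIntegral.norm_integral_le_of_norm_le_const (a := N) (b := 2 * N)
    (f := fun r => bump N r * f r - bump N r * L) (C := 2 / N * (ε / 3)) (fun r hr => by
      rw [uIoc_of_le hle] at hr
      rw [← mul_sub, norm_mul, Real.norm_eq_abs, Real.norm_eq_abs]
      have h1 := abs_bump_le hN0 hr.1.le hr.2
      have h2 := hN₀ r ((le_max_left _ _).trans (hN.trans hr.1.le))
      rw [Real.dist_eq] at h2
      gcongr)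
  rw [Real.norm_eq_abs] at hb
  refine hb.trans_lt ?_
  have : |2 * N - N| = N := by rw [abs_of_nonneg (by linarith)]; ring
  rw [this]
  field_simp
  norm_num

/-- Averages, against slowly varying weights, of the derivative of a bounded function. -/
theorem tendsto_integral_mul_of_bounded_primitive {κ κ' : ℝ → ℝ → ℝ} {P h : ℝ → ℝ} {c T : ℝ}
    (hP : ∀ r, 2 ≤ r → HasDerivAt P (h r) r) (hh : ContinuousOn h (Ici 2))
    (hT : ∀ᶠ r in atTop, |P r| ≤ T)
    (hκ : ∀ N r, 2 ≤ N → N ≤ r → r ≤ 2 * N →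
      HasDerivAt (κ N) (κ' N r) r ∧ |κ N r| ≤ c / N ∧ |κ' N r| ≤ c / N ^ 2)
    (hκ' : ∀ N, 2 ≤ N → ContinuousOn (κ' N) (Icc N (2 * N))) :
    Tendsto (fun N => ∫ r in N..2 * N, κ N r * h r) atTop (𝓝 0) := by
  obtain ⟨N₀, hN₀⟩ := eventually_atTop.1 hT
  have hlim : Tendsto (fun N : ℝ => 3 * c * T / N) atTop (𝓝 0) :=
    tendsto_const_nhds.div_atTop tendsto_id
  refine squeeze_zero_norm' ?_ hlim
  filter_upwards [eventually_ge_atTop (max N₀ 2)] with N hN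
  have hN2 : 2 ≤ N := (le_max_right _ _).trans hN
  have hN0 : 0 < N := by linarith
  have hle : N ≤ 2 * N := by linarith
  have hT' : ∀ r, N ≤ r → |P r| ≤ T := fun r hr => hN₀ r ((le_max_left _ _).trans (hN.trans hr))
  have hT0 : 0 ≤ T := (abs_nonneg _).trans (hT' N le_rfl)
  have hcN : 0 ≤ c / N := (abs_nonneg _).trans (hκ N N hN2 le_rfl hle).2.1
  -- The derivative passes from the bounded P to the weight: two boundary values of size O(1/N), and
  -- O(1/N²) integrated over length N.
  have hibp := intervalIntegral.integral_mul_deriv_eq_deriv_mul (a := N) (b := 2 * N)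
    (u := κ N) (u' := κ' N) (v := P) (v' := h)
    (fun r hr => by rw [uIcc_of_le hle] at hr; exact (hκ N r hN2 hr.1 hr.2).1)
    (fun r hr => by rw [uIcc_of_le hle] at hr; exact hP r (hN2.trans hr.1))
    (ContinuousOn.intervalIntegrable (by rw [uIcc_of_le hle]; exact hκ' N hN2))
    (ContinuousOn.intervalIntegrable (by
      rw [uIcc_of_le hle]; exact hh.mono fun r hr => mem_Ici.2 (hN2.trans hr.1)))
  rw [hibp]
  have hb := intervalIntegral.norm_integral_le_of_norm_le_const (a := N) (b := 2 * N)
    (f := fun r => κ' N r * P r) (C := c / N ^ 2 * T) (fun r hr => by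
      rw [uIoc_of_le hle] at hr
      rw [norm_mul, Real.norm_eq_abs, Real.norm_eq_abs]
      exact mul_le_mul (hκ N r hN2 hr.1.le hr.2).2.2 (hT' r hr.1.le) (abs_nonneg _)
        ((abs_nonneg _).trans (hκ N r hN2 hr.1.le hr.2).2.2))
  have h1 : ‖κ N (2 * N) * P (2 * N)‖ ≤ c / N * T := by
    rw [norm_mul, Real.norm_eq_abs, Real.norm_eq_abs]
    exact mul_le_mul (hκ N _ hN2 hle le_rfl).2.1 (hT' _ hle) (abs_nonneg _) hcN
  have h2 : ‖κ N N * P N‖ ≤ c / N * T := by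
    rw [norm_mul, Real.norm_eq_abs, Real.norm_eq_abs]
    exact mul_le_mul (hκ N _ hN2 le_rfl hle).2.1 (hT' _ le_rfl) (abs_nonneg _) hcN
  have h3 : |2 * N - N| = N := by rw [abs_of_nonneg (by linarith)]; ring
  rw [h3] at hb
  calc _ ≤ c / N * T + c / N * T + c / N ^ 2 * T * N :=
        (norm_sub_le _ _).trans (add_le_add ((norm_sub_le _ _).trans (add_le_add h1 h2)) hb)
    _ = _ := by field_simp; ring

/-- Bounded functions whose derivative is `O(1 / r)`. -/
structure IsSymbol (σ σ' : ℝ → ℝ) (C : ℝ) : Prop where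
  hasDerivAt : ∀ r, 2 ≤ r → HasDerivAt σ (σ' r) r
  continuousOn : ContinuousOn σ' (Ici 2)
  abs_le : ∀ r, 2 ≤ r → |σ r| ≤ C
  abs_deriv_le : ∀ r, 2 ≤ r → |σ' r| ≤ C / r

namespace IsSymbol

variable {σ σ' τ τ' : ℝ → ℝ} {C D c : ℝ}

theorem nonneg (h : IsSymbol σ σ' C) : 0 ≤ C := (abs_nonneg _).trans (h.abs_le 2 le_rfl)

theorem contOn (h : IsSymbol σ σ' C) : ContinuousOn σ (Ici 2) :=
  fun r hr => (h.hasDerivAt r hr).continuousAt.continuousWithinAt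

theorem add (h : IsSymbol σ σ' C) (k : IsSymbol τ τ' D) :
    IsSymbol (fun r => σ r + τ r) (fun r => σ' r + τ' r) (C + D) where
  hasDerivAt r hr := (h.hasDerivAt r hr).add (k.hasDerivAt r hr)
  continuousOn := h.continuousOn.add k.continuousOn
  abs_le r hr := (abs_add_le _ _).trans (add_le_add (h.abs_le r hr) (k.abs_le r hr))
  abs_deriv_le r hr := (abs_add_le _ _).trans (by
    rw [add_div]; exact add_le_add (h.abs_deriv_le r hr) (k.abs_deriv_le r hr))

theorem mul (h : IsSymbol σ σ' C) (k : IsSymbol τ τ' D) :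
    IsSymbol (fun r => σ r * τ r) (fun r => σ' r * τ r + σ r * τ' r) (2 * (C * D)) where
  hasDerivAt r hr := (h.hasDerivAt r hr).mul (k.hasDerivAt r hr)
  continuousOn := (h.continuousOn.mul k.contOn).add (h.contOn.mul k.continuousOn)
  abs_le r hr := by
    rw [abs_mul]
    have := mul_le_mul (h.abs_le r hr) (k.abs_le r hr) (abs_nonneg _) h.nonneg
    nlinarith [mul_nonneg h.nonneg k.nonneg]
  abs_deriv_le r hr := by
    have h1 := mul_le_mul (h.abs_deriv_le r hr) (k.abs_le r hr) (abs_nonneg _)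
      ((abs_nonneg _).trans (h.abs_deriv_le r hr))
    have h2 := mul_le_mul (h.abs_le r hr) (k.abs_deriv_le r hr) (abs_nonneg _) h.nonneg
    refine (abs_add_le _ _).trans ?_
    rw [abs_mul, abs_mul]
    refine (add_le_add h1 h2).trans (le_of_eq ?_)
    ring

theorem const (c : ℝ) : IsSymbol (fun _ => c) (fun _ => 0) |c| where
  hasDerivAt r _ := hasDerivAt_const r c
  continuousOn := continuousOn_const
  abs_le _ _ := le_rfl
  abs_deriv_le r hr := by
    rw [abs_zero]
    have : 0 < r := by linarith
    positivity

theorem inv : IsSymbol (fun r => r⁻¹) (fun r => -(r ^ 2)⁻¹) 1 where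
  hasDerivAt r hr := hasDerivAt_inv (by linarith)
  continuousOn := (ContinuousOn.inv₀ (by fun_prop) fun r hr => by
    have : (2:ℝ) ≤ r := hr
    positivity).neg
  abs_le r hr := by
    rw [abs_of_nonneg (by positivity)]
    exact inv_le_one_of_one_le₀ (by linarith)
  abs_deriv_le r hr := by
    have : 0 < r := by linarith
    rw [abs_neg, abs_of_nonneg (by positivity), one_div]
    exact inv_anti₀ this (by nlinarith)

/-- A symbol loses a factor r under differentiation, just as `bump` loses a factor N, so their
product is still a slowly varying weight. In the application P collects the partial integrals of the
assumed convergent pairing. -/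
theorem tendsto_integral_bump_mul {P h : ℝ → ℝ} {T : ℝ} (hσ : IsSymbol σ σ' C)
    (hP : ∀ r, 2 ≤ r → HasDerivAt P (h r) r) (hh : ContinuousOn h (Ici 2))
    (hT : ∀ᶠ r in atTop, |P r| ≤ T) :
    Tendsto (fun N => ∫ r in N..2 * N, bump N r * σ r * h r) atTop (𝓝 0) := by
  have hC := hσ.nonneg
  -- The constant is 6 + 2, from the bounds on `bumpDeriv` and `bump` in the derivative of the
  -- product.
  refine tendsto_integral_mul_of_bounded_primitive (c := 8 * C)
    (κ := fun N r => bump N r * σ r) (κ' := fun N r => bumpDeriv N r * σ r + bump N r * σ' r)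
    hP hh hT (fun N r hN h1 h2 => ?_) fun N hN => ?_
  · have hr : 2 ≤ r := hN.trans h1
    have hN0 : 0 < N := by linarith
    refine ⟨(hasDerivAt_bump N r).mul (hσ.hasDerivAt r hr), ?_, ?_⟩
    · rw [abs_mul]
      calc _ ≤ 2 / N * C := mul_le_mul (abs_bump_le hN0 h1 h2) (hσ.abs_le r hr) (abs_nonneg _)
            (by positivity)
        _ = 2 * C / N := by ring
        _ ≤ 8 * C / N := by gcongr; norm_num
    · refine (abs_add_le _ _).trans ?_
      rw [abs_mul, abs_mul]
      calc _ ≤ 6 / N ^ 2 * C + 2 / N * (C / N) := by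
            gcongr
            · exact abs_bumpDeriv_le hN0 h1 h2
            · exact hσ.abs_le r hr
            · exact abs_bump_le hN0 h1 h2
            · exact (hσ.abs_deriv_le r hr).trans (by gcongr)
        _ = 8 * C / N ^ 2 := by field_simp; ring
  · have hsub : Icc N (2 * N) ⊆ Ici 2 := fun r hr => mem_Ici.2 (hN.trans hr.1)
    exact ((continuous_bumpDeriv N).continuousOn.mul (hσ.contOn.mono hsub)).add
      ((continuous_bump N).continuousOn.mul (hσ.continuousOn.mono hsub))

theorem tendsto_integral_bumpDeriv_mul {P h : ℝ → ℝ} {T : ℝ} (hσ : IsSymbol σ σ' C)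
    (hP : ∀ r, 2 ≤ r → HasDerivAt P (h r) r) (hh : ContinuousOn h (Ici 2))
    (hT : ∀ᶠ r in atTop, |P r| ≤ T) :
    Tendsto (fun N => ∫ r in N..2 * N, bumpDeriv N r * σ r * h r) atTop (𝓝 0) := by
  have hC := hσ.nonneg
  -- The constant is 12 + 6; the weight is smaller than required by a factor N, which is given away
  -- using N ≥ 1.
  refine tendsto_integral_mul_of_bounded_primitive (c := 18 * C)
    (κ := fun N r => bumpDeriv N r * σ r)
    (κ' := fun N r => -12 / N ^ 3 * σ r + bumpDeriv N r * σ' r)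
    hP hh hT (fun N r hN h1 h2 => ?_) fun N hN => ?_
  · have hr : 2 ≤ r := hN.trans h1
    have hN0 : 0 < N := by linarith
    have hN1 : 1 ≤ N := by linarith
    refine ⟨(hasDerivAt_bumpDeriv N r).mul (hσ.hasDerivAt r hr), ?_, ?_⟩
    · rw [abs_mul]
      calc _ ≤ 6 / N ^ 2 * C := mul_le_mul (abs_bumpDeriv_le hN0 h1 h2) (hσ.abs_le r hr)
            (abs_nonneg _) (by positivity)
        _ ≤ 6 / N * C := by
            gcongr
            nlinarith
        _ = 6 * C / N := by ring
        _ ≤ 18 * C / N := by gcongr; norm_num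
    · refine (abs_add_le _ _).trans ?_
      have h12 : |-12 / N ^ 3| = 12 / N ^ 3 := by
        rw [abs_div, abs_of_pos (by positivity : 0 < N ^ 3)]; norm_num
      rw [abs_mul, abs_mul, h12]
      calc _ ≤ 12 / N ^ 2 * C + 6 / N ^ 2 * C := by
            gcongr ?_ * ?_ + ?_ * ?_
            · gcongr
              norm_num
            · exact hσ.abs_le r hr
            · exact abs_bumpDeriv_le hN0 h1 h2
            · exact (hσ.abs_deriv_le r hr).trans (div_le_self hC (by linarith))
        _ = 18 * C / N ^ 2 := by field_simp; ring
  · have hsub : Icc N (2 * N) ⊆ Ici 2 := fun r hr => mem_Ici.2 (hN.trans hr.1)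
    exact (continuousOn_const.mul (hσ.contOn.mono hsub)).add
      ((continuous_bumpDeriv N).continuousOn.mul (hσ.continuousOn.mono hsub))

end IsSymbol

theorem continuousOn_jacobiSymbol (m : ℕ) (a b : ℝ) (q : ℕ) :
    ContinuousOn (jacobiSymbol m a b q) (Ici 2) := fun s hs =>
  (hasDerivAt_jacobiSymbol m a b q
    (by have : (2:ℝ) ≤ s := hs
        linarith)).continuousAt.continuousWithinAt

theorem continuousOn_jacobiSymbolDeriv (m : ℕ) (a b : ℝ) (q : ℕ) :
    ContinuousOn (jacobiSymbolDeriv m a b q) (Ici 2) := by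
  refine ContinuousOn.div (by fun_prop) (by fun_prop) fun s hs => pow_ne_zero _ ?_
  have : (2:ℝ) ≤ s := hs
  exact one_sub_sq_ne_zero (by linarith) (by linarith)

theorem hasDerivAt_jacobiSymbol_sq (m : ℕ) (a b : ℝ) (q : ℕ) {r : ℝ} (hr : 2 ≤ r) :
    HasDerivAt (fun r => jacobiSymbol m a b q (r ^ 2))
      (2 * r * jacobiSymbolDeriv m a b q (r ^ 2)) r := by
  have h := HasDerivAt.comp (h₂ := jacobiSymbol m a b q) (h := fun r : ℝ => r ^ 2) r
    (hasDerivAt_jacobiSymbol m a b q (by nlinarith)) (hasDerivAt_pow 2 r)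
  exact h.congr_deriv (by simp; ring)

theorem isSymbol_jacobiSymbol (m : ℕ) (a b : ℝ) (q : ℕ) :
    ∃ C, IsSymbol (fun r => jacobiSymbol m a b q (r ^ 2))
      (fun r => 2 * r * jacobiSymbolDeriv m a b q (r ^ 2)) C := by
  obtain ⟨C, hC0, hC⟩ := exists_jacobiSymbol_le m a b q
  obtain ⟨D, hD0, hD⟩ := exists_jacobiSymbolDeriv_le m a b q
  refine ⟨C + 2 * D, fun r hr => hasDerivAt_jacobiSymbol_sq m a b q hr, ?_, fun r hr => ?_,
    fun r hr => ?_⟩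
  · exact (by fun_prop : ContinuousOn (fun r : ℝ => 2 * r) _).mul
      ((continuousOn_jacobiSymbolDeriv m a b q).comp (f := fun r : ℝ => r ^ 2) (by fun_prop)
        fun r (hr : 2 ≤ r) => mem_Ici.2 (by nlinarith))
  · have h2 : 2 ≤ r ^ 2 := by nlinarith
    have := (le_mul_of_one_le_right (abs_nonneg _)
      (one_le_pow₀ (by linarith : 1 ≤ r ^ 2))).trans (hC _ h2)
    linarith
  · have h2 : 2 ≤ r ^ 2 := by nlinarith
    have hr0 : 0 < r := by linarith
    have h3 := hD _ h2
    have h4 : |jacobiSymbolDeriv m a b q (r ^ 2)| * r ^ 2 ≤ D := by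
      refine le_trans ?_ h3
      gcongr
      exact le_self_pow₀ (by linarith) (by omega)
    rw [abs_mul, abs_of_pos (by linarith : 0 < 2 * r), le_div_iff₀ hr0]
    nlinarith

/-- For odd q one has ⌈q/2⌉ ≥ 1, so the symbol is O(s^{-1}) = O(r^{-2}) and absorbs the extra factor
r. -/
theorem isSymbol_mul_jacobiSymbol (m : ℕ) (a b : ℝ) {q : ℕ} (hq : Odd q) :
    ∃ C, IsSymbol (fun r => r * jacobiSymbol m a b q (r ^ 2))
      (fun r => 1 * jacobiSymbol m a b q (r ^ 2) +
        r * (2 * r * jacobiSymbolDeriv m a b q (r ^ 2))) C := by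
  obtain ⟨C, hC0, hC⟩ := exists_jacobiSymbol_le m a b q
  obtain ⟨D, hD0, hD⟩ := exists_jacobiSymbolDeriv_le m a b q
  have he : (q + 1) / 2 ≠ 0 := by obtain ⟨n, rfl⟩ := hq; omega
  have hmaps : MapsTo (fun r : ℝ => r ^ 2) (Ici 2) (Ici 2) :=
    fun r (hr : 2 ≤ r) => mem_Ici.2 (by nlinarith)
  have h3 : ∀ r : ℝ, 2 ≤ r → |jacobiSymbol m a b q (r ^ 2)| * r ^ 2 ≤ C := fun r hr => by
    refine le_trans ?_ (hC (r ^ 2) (by nlinarith))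
    gcongr
    exact le_self_pow₀ (by nlinarith) he
  have h4 : ∀ r : ℝ, 2 ≤ r → |jacobiSymbolDeriv m a b q (r ^ 2)| * (r ^ 2 * r ^ 2) ≤ D :=
    fun r hr => by
      refine le_trans ?_ (hD (r ^ 2) (by nlinarith))
      rw [pow_succ _ ((q + 1) / 2)]
      gcongr
      exact le_self_pow₀ (by nlinarith) he
  refine ⟨C + 2 * D, fun r hr => (hasDerivAt_id r).mul (hasDerivAt_jacobiSymbol_sq m a b q hr), ?_,
    fun r hr => ?_, fun r hr => ?_⟩
  · exact (continuousOn_const.mul ((continuousOn_jacobiSymbol m a b q).comp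
      (f := fun r : ℝ => r ^ 2) (by fun_prop) hmaps)).add (continuousOn_id.mul
      ((by fun_prop : ContinuousOn (fun r : ℝ => 2 * r) _).mul
      ((continuousOn_jacobiSymbolDeriv m a b q).comp (f := fun r : ℝ => r ^ 2)
      (by fun_prop) hmaps)))
  · have hr0 : 0 < r := by linarith
    rw [abs_mul, abs_of_pos hr0]
    have h5 := h3 r hr
    have h6 : r ≤ r ^ 2 := by nlinarith
    nlinarith [mul_le_mul_of_nonneg_left h6 (abs_nonneg (jacobiSymbol m a b q (r ^ 2)))]
  · have hr0 : 0 < r := by linarith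
    rw [le_div_iff₀ hr0]
    have h5 := h3 r hr
    have h6 := h4 r hr
    have h7 : r ≤ r ^ 2 := by nlinarith
    have h8 : r * (r * r) ≤ r ^ 2 * r ^ 2 := by nlinarith [sq_nonneg r]
    have h9 : |1 * jacobiSymbol m a b q (r ^ 2) +
        r * (2 * r * jacobiSymbolDeriv m a b q (r ^ 2))| ≤ |jacobiSymbol m a b q (r ^ 2)| +
        2 * (r * r) * |jacobiSymbolDeriv m a b q (r ^ 2)| := by
      refine (abs_add_le _ _).trans (le_of_eq ?_)
      rw [one_mul, abs_mul, abs_mul, abs_of_pos hr0, abs_of_pos (by linarith : 0 < 2 * r)]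
      ring
    have h10 := mul_le_mul_of_nonneg_left h7 (abs_nonneg (jacobiSymbol m a b q (r ^ 2)))
    have h11 := mul_le_mul_of_nonneg_left h8 (abs_nonneg (jacobiSymbolDeriv m a b q (r ^ 2)))
    calc _ ≤ (|jacobiSymbol m a b q (r ^ 2)| +
        2 * (r * r) * |jacobiSymbolDeriv m a b q (r ^ 2)|) * r := by gcongr
      _ = |jacobiSymbol m a b q (r ^ 2)| * r +
        2 * (|jacobiSymbolDeriv m a b q (r ^ 2)| * (r * (r * r))) := by ring
      _ ≤ _ := by linarith

end

/-! ### Pairing the profiles with the Fourier kernels. -/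

noncomputable section

/-- The radial kernel that the Fourier transform pairs with the profile `H q`. -/
def fourierKernel (m : ℕ) (ρ : ℝ) (q : ℕ) (r : ℝ) : ℝ :=
  if Even q then r ^ (m - 1) * sphereCos m (r * ρ) else r ^ m * sphereSin m (r * ρ)

/-- The boundary term of an integration by parts against `fourierKernel`. -/
def boundaryTerm (m : ℕ) (ρ : ℝ) (H : ℕ → ℝ → ℝ) (q : ℕ) (R : ℝ) : ℝ :=
  if Even q then H q (R ^ 2) * (R ^ (m - 1) * sphereSin m (R * ρ))
  else -(H q (R ^ 2) * (R ^ m * sphereCos m (R * ρ)))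

variable {m ℓ : ℕ} {a b : ℝ} {H dH : ℕ → ℝ → ℝ}

theorem continuous_sphereSin : Continuous (sphereSin m) := by
  have hm0 : (0:ℝ) < m / 2 + 1 := by positivity
  exact (by fun_prop : Continuous fun z : ℝ => Real.sqrt Real.pi ^ m * z).mul
    ((continuous_besselClifford hm0).comp (by fun_prop))

section Kernels

variable [NeZero m]

theorem hasDerivAt_sphereCos_mul (ρ r : ℝ) :
    HasDerivAt (fun r => sphereCos m (r * ρ)) (-ρ * sphereSin m (r * ρ)) r := by
  have h := HasDerivAt.comp (h₂ := sphereCos m) (h := fun r : ℝ => r * ρ) r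
    (hasDerivAt_sphereCos (r * ρ)) ((hasDerivAt_id r).mul_const ρ)
  exact h.congr_deriv (by ring)

theorem hasDerivAt_pow_mul_sphereSin_mul {ρ : ℝ} (hρ : ρ ≠ 0) (r : ℝ) :
    HasDerivAt (fun r => r ^ (m - 1) * sphereSin m (r * ρ))
      (ρ * (r ^ (m - 1) * sphereCos m (r * ρ))) r := by
  have h := (HasDerivAt.comp (h₂ := fun z => z ^ (m - 1) * sphereSin m z)
    (h := fun r : ℝ => r * ρ) r (hasDerivAt_pow_mul_sphereSin (r * ρ))
    ((hasDerivAt_id r).mul_const ρ)).const_mul ((ρ ^ (m - 1))⁻¹)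
  have hp : ρ ^ (m - 1) ≠ 0 := pow_ne_zero _ hρ
  have hf : (fun r => r ^ (m - 1) * sphereSin m (r * ρ)) = fun r => (ρ ^ (m - 1))⁻¹ *
      ((fun z => z ^ (m - 1) * sphereSin m z) ∘ fun r : ℝ => r * ρ) r := by
    ext r
    simp only [Function.comp, mul_pow]
    field_simp
  rw [hf]
  refine h.congr_deriv ?_
  rw [mul_pow]
  field_simp

theorem continuous_sphereCos : Continuous (sphereCos m) :=
  continuous_iff_continuousAt.2 fun z => (hasDerivAt_sphereCos z).continuousAt

theorem continuous_fourierKernel (ρ : ℝ) (q : ℕ) : Continuous (fourierKernel m ρ q) := by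
  have h1 := continuous_sphereCos (m := m)
  have h2 := continuous_sphereSin (m := m)
  unfold fourierKernel
  split_ifs <;> fun_prop

/-- The two kernel derivative formulas turn each step down the chain into multiplication by -ρ, up
to the boundary term at R; the one at 0 vanishes. -/
theorem JacobiChain.integral_fourierKernel_succ (hH : JacobiChain m ℓ a b H dH) {ρ : ℝ}
    (hρ : ρ ≠ 0) {q : ℕ} (hq : q < ℓ) {R : ℝ} (hR : 0 ≤ R) :
    ∫ r in (0:ℝ)..R, H (q + 1) (r ^ 2) * fourierKernel m ρ (q + 1) r =
      boundaryTerm m ρ H q R - ρ * ∫ r in (0:ℝ)..R, H q (r ^ 2) * fourierKernel m ρ q r := by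
  have hm : m ≠ 0 := NeZero.ne m
  have h1 := continuous_sphereCos (m := m)
  have h2 := continuous_sphereSin (m := m)
  rcases Nat.even_or_odd q with he | ho
  · have hne : ¬ Even (q + 1) := by simpa [Nat.even_add_one] using he
    have hpow : ∀ r : ℝ, r ^ m * sphereSin m (r * ρ) =
        r * (r ^ (m - 1) * sphereSin m (r * ρ)) := fun r => by
      rw [← mul_assoc, ← pow_succ', Nat.sub_add_cancel (Nat.one_le_iff_ne_zero.2 hm)]
    simp only [fourierKernel, boundaryTerm, if_pos he, if_neg hne, hpow]
    rw [hH.integral_even_succ hq he (hasDerivAt_pow_mul_sphereSin_mul hρ) (by fun_prop)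
      (by simp [sphereSin]) hR, ← intervalIntegral.integral_const_mul]
    congr 2
    ext r
    ring
  · have hne : ¬ Even q := Nat.not_even_iff_odd.2 ho
    have he : Even (q + 1) := by simpa [Nat.even_add_one] using ho
    simp only [fourierKernel, boundaryTerm, if_pos he, if_neg hne]
    rw [hH.integral_odd_succ hm hq ho (hasDerivAt_sphereCos_mul ρ) (by fun_prop) hR,
      ← intervalIntegral.integral_const_mul, sub_eq_add_neg, ← intervalIntegral.integral_neg]
    congr 2
    ext r
    ring

end Kernels

theorem RadialChain.continuousOn_comp_sq_Ici (hH : RadialChain m H dH) (q : ℕ) :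
    ContinuousOn (fun r => H q (r ^ 2)) (Ici 2) := fun r (hr : 2 ≤ r) =>
  (hH.hasDerivAt_comp_sq q (by linarith) (by linarith)).continuousAt.continuousWithinAt

theorem JacobiChain.eq_zero_mul_symbol (hH : JacobiChain m ℓ a b H dH) (q : ℕ) {r : ℝ}
    (hr : 2 ≤ r) : H q (r ^ 2) = H 0 (r ^ 2) * jacobiSymbol m a b q (r ^ 2) := by
  rw [hH.eq_symbol q _ (by nlinarith), hH.zero_eq _ (sq_nonneg r)]

theorem JacobiChain.continuousOn_integral_fourierKernel [NeZero m]
    (hH : JacobiChain m ℓ a b H dH) (ρ : ℝ) {q : ℕ} (hq : q ≤ ℓ) :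
    ContinuousOn (fun R => ∫ r in (0:ℝ)..R, H q (r ^ 2) * fourierKernel m ρ q r) (Ici 0) := by
  intro R (hR : 0 ≤ R)
  have hi : IntervalIntegrable (fun r => H q (r ^ 2) * fourierKernel m ρ q r) volume 0 (R + 1) :=
    (hH.intervalIntegrable q hq (R + 1) (by linarith)).mul_continuousOn
      (continuous_fourierKernel ρ q).continuousOn
  have hc := intervalIntegral.continuousOn_primitive_interval' hi left_mem_uIcc
  rw [uIcc_of_le (by linarith)] at hc
  refine (hc R ⟨hR, by linarith⟩).mono_of_mem_nhdsWithin ?_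
  rw [← Ici_inter_Iic]
  exact inter_mem self_mem_nhdsWithin (mem_nhdsWithin_of_mem_nhds (Iic_mem_nhds (by linarith)))

theorem JacobiChain.hasDerivAt_integral_fourierKernel [NeZero m]
    (hH : JacobiChain m ℓ a b H dH) (ρ : ℝ) {r : ℝ} (hr : 2 ≤ r) :
    HasDerivAt (fun R => ∫ r in (0:ℝ)..R, H 0 (r ^ 2) * fourierKernel m ρ 0 r)
      (H 0 (r ^ 2) * fourierKernel m ρ 0 r) r := by
  have hi : ∀ R, 0 ≤ R → IntervalIntegrable (fun r => H 0 (r ^ 2) * fourierKernel m ρ 0 r)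
      volume 0 R := fun R hR =>
    (hH.intervalIntegrable 0 (Nat.zero_le _) R hR).mul_continuousOn
      (continuous_fourierKernel ρ 0).continuousOn
  have hca : ∀ r, 1 < r → ContinuousAt (fun r => H 0 (r ^ 2) * fourierKernel m ρ 0 r) r :=
    fun r hr => (hH.hasDerivAt_comp_sq 0 (by linarith) (by linarith)).continuousAt.mul
      (continuous_fourierKernel ρ 0).continuousAt
  refine intervalIntegral.integral_hasDerivAt_right (hi r (by linarith)) ?_ (hca r (by linarith))
  exact ContinuousOn.stronglyMeasurableAtFilter isOpen_Ioi
    (fun r (hr : 1 < r) => (hca r hr).continuousWithinAt) r (by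
      show (1:ℝ) < r
      linarith)

/-- The boundary terms vanish on average if the pairing with the weight itself converges. -/
theorem JacobiChain.tendsto_bump_boundaryTerm [NeZero m] (hH : JacobiChain m ℓ a b H dH) {ρ : ℝ}
    (hρ : ρ ≠ 0) {L : ℝ}
    (hL : Tendsto (fun R => ∫ r in (0:ℝ)..R, H 0 (r ^ 2) * fourierKernel m ρ 0 r) atTop (𝓝 L))
    (q : ℕ) :
    Tendsto (fun N => ∫ r in N..2 * N, bump N r * boundaryTerm m ρ H q r) atTop (𝓝 0) := by
  have hm : 1 ≤ m := NeZero.one_le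
  have hP := fun r hr => hH.hasDerivAt_integral_fourierKernel ρ (r := r) hr
  have hh : ContinuousOn (fun r => H 0 (r ^ 2) * fourierKernel m ρ 0 r) (Ici 2) :=
    (hH.continuousOn_comp_sq_Ici 0).mul (continuous_fourierKernel ρ 0).continuousOn
  have hT : ∀ᶠ R in atTop, |∫ r in (0:ℝ)..R, H 0 (r ^ 2) * fourierKernel m ρ 0 r| ≤ |L| + 1 :=
    (hL.abs.eventually_lt_const (lt_add_one _)).mono fun _ h => h.le
  have hpow : ∀ r : ℝ, r ^ m = r ^ (m - 1) * r := fun r => by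
    rw [← pow_succ, Nat.sub_add_cancel hm]
  rcases Nat.even_or_odd q with he | ho
  · obtain ⟨C₁, h₁⟩ := isSymbol_jacobiSymbol m a b q
    obtain ⟨C₂, h₂⟩ := isSymbol_mul_jacobiSymbol m a b (q := q + 1) he.add_one
    -- This symbol is the derivative of H_q(r²) r^{m-1}, divided by H_0(r²) r^{m-1}. It arises
    -- because for even q the boundary term contains S, which is first written as -1/ρ times the
    -- derivative of C(rρ) and integrated by parts.
    have h₃ := h₂.add ((IsSymbol.const ((m - 1 : ℕ) : ℝ)).mul (IsSymbol.inv.mul h₁))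
    have t₁ := h₁.tendsto_integral_bumpDeriv_mul hP hh hT
    have t₂ := h₃.tendsto_integral_bump_mul hP hh hT
    have t := (t₁.add t₂).const_mul ρ⁻¹
    rw [add_zero, mul_zero] at t
    refine t.congr' ?_
    filter_upwards [eventually_ge_atTop 2] with N hN
    have hN0 : 0 < N := by linarith
    have hle : N ≤ 2 * N := by linarith
    have hsub : uIcc N (2 * N) ⊆ Ici 2 := by
      rw [uIcc_of_le hle]; exact fun r hr => mem_Ici.2 (hN.trans hr.1)
    have hbc := (continuous_bump N).continuousOn (s := uIcc N (2 * N))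
    have hbc' := (continuous_bumpDeriv N).continuousOn (s := uIcc N (2 * N))
    have hi₁ : IntervalIntegrable (fun r => bumpDeriv N r * jacobiSymbol m a b q (r ^ 2) *
        (H 0 (r ^ 2) * fourierKernel m ρ 0 r)) volume N (2 * N) :=
      ((hbc'.mul (h₁.contOn.mono hsub)).mul (hh.mono hsub)).intervalIntegrable
    have hi₂ : IntervalIntegrable (fun r => bump N r *
        (r * jacobiSymbol m a b (q + 1) (r ^ 2) +
          ((m - 1 : ℕ) : ℝ) * (r⁻¹ * jacobiSymbol m a b q (r ^ 2))) *
        (H 0 (r ^ 2) * fourierKernel m ρ 0 r)) volume N (2 * N) :=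
      ((hbc.mul (h₃.contOn.mono hsub)).mul (hh.mono hsub)).intervalIntegrable
    rw [← intervalIntegral.integral_add hi₁ hi₂]
    have hu : ∀ r ∈ uIcc N (2 * N), HasDerivAt (fun r => bump N r * (H q (r ^ 2) * r ^ (m - 1)))
        (bumpDeriv N r * (H q (r ^ 2) * r ^ (m - 1)) + bump N r *
          (r * H (q + 1) (r ^ 2) * r ^ (m - 1) +
            H q (r ^ 2) * (((m - 1 : ℕ) : ℝ) * r ^ (m - 1 - 1)))) r := by
      intro r hr
      have hr2 : 2 ≤ r := hsub hr
      refine (hasDerivAt_bump N r).mul (((hH.hasDerivAt_comp_sq q (by linarith)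
        (by linarith)).congr_deriv ?_).mul (hasDerivAt_pow (m - 1) r))
      rw [hH.even_succ q _ he (sq_nonneg r) (by nlinarith)]
      ring
    have hHc := fun q => (hH.continuousOn_comp_sq_Ici q).mono hsub
    have hui : IntervalIntegrable (fun r => bumpDeriv N r * (H q (r ^ 2) * r ^ (m - 1)) +
        bump N r * (r * H (q + 1) (r ^ 2) * r ^ (m - 1) +
            H q (r ^ 2) * (((m - 1 : ℕ) : ℝ) * r ^ (m - 1 - 1)))) volume N (2 * N) := by
      have hq1 := hHc q
      have hq2 := hHc (q + 1)
      exact ((hbc'.mul (hq1.mul (by fun_prop))).add (hbc.mul (((continuousOn_id.mul hq2).mul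
        (by fun_prop)).add (hq1.mul (by fun_prop))))).intervalIntegrable
    have hvi : IntervalIntegrable (fun r => -ρ * sphereSin m (r * ρ)) volume N (2 * N) := by
      have h2 := continuous_sphereSin (m := m)
      exact (by fun_prop : Continuous fun r => -ρ * sphereSin m (r * ρ)).intervalIntegrable _ _
    have hibp := intervalIntegral.integral_mul_deriv_eq_deriv_mul hu
      (fun r _ => hasDerivAt_sphereCos_mul (m := m) ρ r) hui hvi
    -- The weight vanishes at both ends, so this integration by parts has no boundary terms.
    have hb0 : bump N N = 0 := by simp [bump]
    have hb1 : bump N (2 * N) = 0 := by simp [bump]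
    rw [hb0, hb1, zero_mul, zero_mul, zero_mul, zero_mul, sub_zero, zero_sub] at hibp
    have e1 : ∫ r in N..2 * N, bump N r * (H q (r ^ 2) * r ^ (m - 1)) * (-ρ * sphereSin m (r * ρ)) =
        -ρ * ∫ r in N..2 * N, bump N r * boundaryTerm m ρ H q r := by
      rw [← intervalIntegral.integral_const_mul]
      congr 1
      ext r
      simp only [boundaryTerm, if_pos he]
      ring
    rw [e1] at hibp
    rw [inv_mul_eq_iff_eq_mul₀ hρ, ← neg_inj, ← neg_mul, hibp]
    congr 1
    refine intervalIntegral.integral_congr fun r hr => ?_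
    have hr2 : 2 ≤ r := hsub hr
    have hr0 : r ≠ 0 := by linarith
    -- For m = 1 the exponent m - 1 - 1 is truncated, but the factor m - 1 vanishes.
    have hpow2 : ((m - 1 : ℕ) : ℝ) * r ^ (m - 1 - 1) = ((m - 1 : ℕ) : ℝ) * (r⁻¹ * r ^ (m - 1)) := by
      rcases Nat.eq_zero_or_pos (m - 1) with h0 | h0
      · simp [h0]
      · congr 1
        conv_rhs => rw [← Nat.sub_add_cancel (Nat.succ_le_of_lt h0), pow_succ']
        field_simp
    simp only [fourierKernel, if_pos Even.zero]
    rw [hpow2, hH.eq_zero_mul_symbol q hr2, hH.eq_zero_mul_symbol (q + 1) hr2]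
    ring
  · have hne : ¬ Even q := Nat.not_even_iff_odd.2 ho
    obtain ⟨C, h₁⟩ := isSymbol_mul_jacobiSymbol m a b ho
    -- For odd q the boundary term already contains C: it is minus the symbol r σ_q(r²) times P',
    -- where σ_q = H_q/H_0 is `jacobiSymbol`.
    have t := (h₁.tendsto_integral_bump_mul hP hh hT).neg
    rw [neg_zero] at t
    refine t.congr' ?_
    filter_upwards [eventually_ge_atTop 2] with N hN
    have hle : N ≤ 2 * N := by linarith
    rw [← intervalIntegral.integral_neg]
    refine intervalIntegral.integral_congr fun r hr => ?_
    rw [uIcc_of_le hle] at hr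
    simp only [boundaryTerm, if_neg hne, fourierKernel, if_pos Even.zero]
    rw [hH.eq_zero_mul_symbol q (hN.trans hr.1), hpow]
    ring

/-- If the pairing of the weight with the kernel converges, so does, on average, the pairing of
each of its iterated Dirac derivatives, to the expected limit. -/
theorem JacobiChain.tendsto_bump_integral_fourierKernel [NeZero m] (hH : JacobiChain m ℓ a b H dH)
    {ρ : ℝ} (hρ : ρ ≠ 0) {L : ℝ}
    (hL : Tendsto (fun R => ∫ r in (0:ℝ)..R, H 0 (r ^ 2) * fourierKernel m ρ 0 r) atTop (𝓝 L))
    {q : ℕ} (hq : q ≤ ℓ) :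
    Tendsto (fun N => ∫ R in N..2 * N, bump N R *
      ∫ r in (0:ℝ)..R, H q (r ^ 2) * fourierKernel m ρ q r) atTop (𝓝 ((-ρ) ^ q * L)) := by
  induction q with
  | zero =>
    simpa using tendsto_bump_average hL (hH.continuousOn_integral_fourierKernel ρ hq)
  | succ q ih =>
    have t := (hH.tendsto_bump_boundaryTerm hρ hL q).sub ((ih (by omega)).const_mul ρ)
    have e : 0 - ρ * ((-ρ) ^ q * L) = (-ρ) ^ (q + 1) * L := by ring
    rw [e] at t
    refine t.congr' ?_
    filter_upwards [eventually_ge_atTop 2] with N hN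
    have hle : N ≤ 2 * N := by linarith
    have hsub : uIcc N (2 * N) ⊆ Ici 2 := by
      rw [uIcc_of_le hle]; exact fun r hr => mem_Ici.2 (hN.trans hr.1)
    have hsub0 : uIcc N (2 * N) ⊆ Ici 0 := hsub.trans (Ici_subset_Ici.2 zero_le_two)
    have hbc := (continuous_bump N).continuousOn (s := uIcc N (2 * N))
    have hB : ContinuousOn (boundaryTerm m ρ H q) (uIcc N (2 * N)) := by
      have h1 := continuous_sphereCos (m := m)
      have h2 := continuous_sphereSin (m := m)
      have h3 := (hH.continuousOn_comp_sq_Ici q).mono hsub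
      unfold boundaryTerm
      split_ifs
      · exact h3.mul (by fun_prop)
      · exact (h3.mul (by fun_prop)).neg
    have hi1 : IntervalIntegrable (fun R => bump N R * boundaryTerm m ρ H q R) volume N (2 * N) :=
      (hbc.mul hB).intervalIntegrable
    have hi2 : IntervalIntegrable (fun R => ρ * (bump N R *
        ∫ r in (0:ℝ)..R, H q (r ^ 2) * fourierKernel m ρ q r)) volume N (2 * N) :=
      (continuousOn_const.mul (hbc.mul ((hH.continuousOn_integral_fourierKernel ρ
        (by omega)).mono hsub0))).intervalIntegrable
    rw [← intervalIntegral.integral_const_mul, ← intervalIntegral.integral_sub hi1 hi2]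
    refine intervalIntegral.integral_congr fun R hR => ?_
    rw [hH.integral_fourierKernel_succ hρ (by omega) (hsub0 hR)]
    ring

/-- The limit of the pairing of the last profile with the kernel. -/
theorem JacobiChain.integral_Ioi_fourierKernel_eq [NeZero m] (hH : JacobiChain m ℓ a b H dH)
    {ρ : ℝ} (hρ : ρ ≠ 0) {L : ℝ}
    (hL : Tendsto (fun R => ∫ r in (0:ℝ)..R, H 0 (r ^ 2) * fourierKernel m ρ 0 r) atTop (𝓝 L))
    (hi : IntegrableOn (fun r => H ℓ (r ^ 2) * fourierKernel m ρ ℓ r) (Ioi 0)) :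
    ∫ r in Ioi (0:ℝ), H ℓ (r ^ 2) * fourierKernel m ρ ℓ r = (-ρ) ^ ℓ * L :=
  -- Absolute convergence identifies the limit of the averages with the integral itself.
  tendsto_nhds_unique (tendsto_bump_average
    (intervalIntegral_tendsto_integral_Ioi 0 hi tendsto_id)
    (hH.continuousOn_integral_fourierKernel ρ le_rfl))
    (hH.tendsto_bump_integral_fourierKernel hρ hL le_rfl)

end

/-! ### Integrability and vanishing moments of the wavelet. -/

noncomputable section

variable {m ℓ : ℕ} {a b : ℝ} {H dH : ℕ → ℝ → ℝ}

theorem JacobiChain.integrableOn_mul_pow (hH : JacobiChain m ℓ a b H dH) {q : ℕ} (hq : q ≤ ℓ)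
    (n : ℕ) (h : (n : ℝ) + 2 * (a + b) - 2 * ((q + 1) / 2 : ℕ) < -1) :
    IntegrableOn (fun r => H q (r ^ 2) * r ^ n) (Ioi 0) := by
  rw [← Ioc_union_Ioi_eq_Ioi (zero_le_two : (0:ℝ) ≤ 2)]
  refine IntegrableOn.union ?_ ?_
  · exact ((hH.intervalIntegrable q hq 2 zero_le_two).mul_continuousOn
      (g := fun r : ℝ => r ^ n) (by fun_prop)).1
  · obtain ⟨C, hC0, hC⟩ := hH.exists_abs_le q
    refine ((integrableOn_Ioi_rpow_of_lt h zero_lt_two).const_mul C).mono' ?_ ?_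
    · exact (((hH.continuousOn_comp_sq_Ici q).mono Ioi_subset_Ici_self).mul
        (by fun_prop)).aestronglyMeasurable measurableSet_Ioi
    · refine (ae_restrict_iff' measurableSet_Ioi).2 (ae_of_all _ fun r hr => ?_)
      have hr2 : (2:ℝ) < r := hr
      have hr0 : 0 < r := by linarith
      rw [Real.norm_eq_abs, abs_mul, abs_of_nonneg (pow_nonneg hr0.le n)]
      calc _ ≤ C * r ^ (2 * (a + b) - 2 * ((q + 1) / 2 : ℕ)) * r ^ n := by
            gcongr; exact hC r hr2.le
        _ = _ := by
          rw [mul_assoc, ← Real.rpow_natCast r n, ← Real.rpow_add hr0]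
          congr 2
          ring

theorem integrable_radial_iff [NeZero m] {f : ℝ → ℝ} :
    Integrable (fun x : EuclideanSpace ℝ (Fin m) => f ‖x‖) ↔
      IntegrableOn (fun r => r ^ (m - 1) * f r) (Ioi 0) := by
  rw [integrable_fun_norm_addHaar, finrank_euclideanSpace_fin]
  rfl

theorem JacobiChain.integrable_radial_mul_pow [NeZero m] (hH : JacobiChain m ℓ a b H dH) (p : ℕ)
    (h : (m : ℝ) + p + 2 * (a + b) - 2 * ((ℓ + 1) / 2 : ℕ) < 0) :
    Integrable fun x : EuclideanSpace ℝ (Fin m) => H ℓ (‖x‖ ^ 2) * ‖x‖ ^ p := by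
  have hm : 1 ≤ m := NeZero.one_le
  refine (integrable_radial_iff (f := fun r => H ℓ (r ^ 2) * r ^ p)).2 ?_
  have h1 := hH.integrableOn_mul_pow le_rfl (m - 1 + p) (by
    push_cast [Nat.cast_sub hm]
    linarith)
  refine h1.congr_fun (fun r _ => ?_) measurableSet_Ioi
  simp only [pow_add]
  ring

/-- The exponent governing the decay of the wavelet, by parity. -/
theorem decay_exponent_eq (α β : ℝ) (m ℓ k : ℕ) :
    (m : ℝ) + (k + (if Even ℓ then 0 else 1) : ℕ) + 2 * ((α + ℓ) + (β + ℓ)) -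
      2 * ((ℓ + 1) / 2 : ℕ) = m + k + 3 * ℓ + 2 * (α + β) := by
  rcases Nat.even_or_odd ℓ with he | ho
  · obtain ⟨n, rfl⟩ := he
    have : (n + n + 1) / 2 = n := by omega
    rw [this, if_pos (Even.add_self n)]
    push_cast
    ring
  · rw [if_neg (Nat.not_even_iff_odd.2 ho)]
    obtain ⟨n, rfl⟩ := ho
    have : (2 * n + 1 + 1) / 2 = n + 1 := by omega
    rw [this]
    push_cast
    ring

theorem ae_norm_sq_ne_one [NeZero m] : ∀ᵐ x : EuclideanSpace ℝ (Fin m), ‖x‖ ^ 2 ≠ 1 := by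
  have h := Measure.addHaar_sphere (volume : Measure (EuclideanSpace ℝ (Fin m))) 0 1
  filter_upwards [measure_eq_zero_iff_ae_notMem.1 h] with x hx h1
  exact hx (mem_sphere_zero_iff_norm.2
    ((pow_eq_one_iff_of_nonneg (norm_nonneg x) two_ne_zero).1 h1))

theorem jacobiWavelet_eq {α β : ℝ} (hH : JacobiChain m ℓ (α + ℓ) (β + ℓ) H dH)
    {x : EuclideanSpace ℝ (Fin m)} (hx : ‖x‖ ^ 2 ≠ 1) :
    jacobiWavelet m ℓ α β x =
      (((-1) ^ ℓ * H ℓ (‖x‖ ^ 2) : ℝ) : ℂ) • Cl.vec x ^ (if Even ℓ then 0 else 1) := by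
  have h0 : (fun y : EuclideanSpace ℝ (Fin m) =>
      algebraMap ℂ (Cl m) ((jacobiWeight (α + ℓ) (β + ℓ) y : ℝ) : ℂ)) =
      cliffordRadial 0 (H 0) := by
    ext y
    rw [cliffordRadial, if_pos Even.zero, hH.zero_eq _ (sq_nonneg _), jacobiWeight,
      Algebra.algebraMap_eq_smul_one]
  rw [jacobiWavelet, h0, hH.diracOp_iterate ℓ hx, cliffordRadial, mul_smul_comm]
  have h1 : ((-1 : Cl m) ^ ℓ) = (((-1) ^ ℓ : ℝ) : ℂ) • (1 : Cl m) := by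
    push_cast
    rw [← Algebra.algebraMap_eq_smul_one, map_pow, map_neg, map_one]
  rw [h1, smul_mul_assoc, one_mul, smul_smul]
  have h2 : (if Even ℓ then (1 : Cl m) else Cl.vec x) = Cl.vec x ^ (if Even ℓ then 0 else 1) := by
    split_ifs <;> simp
  rw [h2]
  push_cast
  rw [mul_comm]

theorem integral_eq_zero_of_odd {E F : Type*} [NormedAddCommGroup E] [NormedSpace ℝ E]
    [NormedAddCommGroup F] [NormedSpace ℝ F] [MeasurableSpace F] [BorelSpace F]
    {μ : Measure F} [μ.IsNegInvariant] {f : F → E} (hf : ∀ x, f (-x) = -f x) :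
    ∫ x, f x ∂μ = 0 := by
  have h := integral_neg_eq_self f μ
  simp only [hf, integral_neg] at h
  have h2 : (2 : ℝ) • ∫ x, f x ∂μ = 0 := by
    rw [two_smul]
    nth_rewrite 1 [← h]
    exact neg_add_cancel _
  exact (smul_eq_zero.1 h2).resolve_left two_ne_zero

theorem exists_norm_vec_le (m : ℕ) :
    ∃ C, ∀ x : EuclideanSpace ℝ (Fin m), ‖Cl.vec x‖ ≤ C * ‖x‖ := by
  obtain ⟨C, _, hC⟩ := (Cl.vecL (m := m)).toContinuousLinearMap.isBoundedLinearMap.bound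
  exact ⟨C, hC⟩

theorem integrable_smul_vec {c : EuclideanSpace ℝ (Fin m) → ℂ} (hc : AEStronglyMeasurable c)
    (hi : Integrable fun x => ‖x‖ * ‖c x‖) : Integrable fun x => c x • Cl.vec x := by
  obtain ⟨C, hC⟩ := exists_norm_vec_le m
  refine (hi.const_mul C).mono' (hc.smul Cl.continuous_vec.aestronglyMeasurable)
    (ae_of_all _ fun x => ?_)
  rw [norm_smul]
  calc ‖c x‖ * ‖Cl.vec x‖ ≤ ‖c x‖ * (C * ‖x‖) := by gcongr; exact hC x
    _ = _ := by ring

/-- Continuity off the unit sphere, which is a null set, is enough; the value on the sphere plays no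
role. -/
theorem JacobiChain.aestronglyMeasurable_radial [NeZero m] (hH : JacobiChain m ℓ a b H dH)
    (q : ℕ) : AEStronglyMeasurable fun x : EuclideanSpace ℝ (Fin m) => H q (‖x‖ ^ 2) := by
  have h1 : AEStronglyMeasurable (fun x : EuclideanSpace ℝ (Fin m) => H q (‖x‖ ^ 2))
      (volume.restrict {x : EuclideanSpace ℝ (Fin m) | ‖x‖ ^ 2 ≠ 1}) := by
    refine ContinuousOn.aestronglyMeasurable (fun x hx => ?_) (by measurability)
    refine ContinuousAt.continuousWithinAt ?_
    exact ContinuousAt.comp (g := H q) (f := fun x : EuclideanSpace ℝ (Fin m) => ‖x‖ ^ 2)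
      (hH.hasDerivAt q _ (sq_nonneg _) hx).continuousAt (by fun_prop)
  have h2 := Measure.restrict_eq_self_of_ae_mem
    (s := {x : EuclideanSpace ℝ (Fin m) | ‖x‖ ^ 2 ≠ 1}) ae_norm_sq_ne_one
  rwa [h2] at h1

/-- Vanishing moments of the wavelet. -/
theorem JacobiChain.integral_vec_pow_mul_wavelet [NeZero m] {α β : ℝ}
    (hH : JacobiChain m ℓ (α + ℓ) (β + ℓ) H dH) {k : ℕ}
    (hk : (k : ℝ) < -m - 3 * ℓ - 2 * (α + β)) :
    Integrable (fun x : EuclideanSpace ℝ (Fin m) => Cl.vec x ^ k * jacobiWavelet m ℓ α β x) ∧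
      (k < ℓ → ∫ x : EuclideanSpace ℝ (Fin m), Cl.vec x ^ k * jacobiWavelet m ℓ α β x = 0) := by
  have hm0 : m ≠ 0 := NeZero.ne m
  have hm1 : 1 ≤ m := NeZero.one_le
  set p : ℕ := k + (if Even ℓ then 0 else 1) with hp
  have hexp := decay_exponent_eq α β m ℓ k
  rw [← hp] at hexp
  have hint := hH.integrable_radial_mul_pow p (by rw [hexp]; linarith)
  have hae : (fun x : EuclideanSpace ℝ (Fin m) => Cl.vec x ^ k * jacobiWavelet m ℓ α β x) =ᵐ[volume]
      fun x => (((-1) ^ ℓ * H ℓ (‖x‖ ^ 2) : ℝ) : ℂ) • Cl.vec x ^ p := by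
    filter_upwards [ae_norm_sq_ne_one] with x hx
    rw [jacobiWavelet_eq hH hx, mul_smul_comm, ← pow_add]
  rw [integrable_congr hae, integral_congr_ae hae]
  rcases Nat.even_or_odd p with ⟨j, hj⟩ | ⟨j, hj⟩
  · have hf : (fun x : EuclideanSpace ℝ (Fin m) =>
        (((-1) ^ ℓ * H ℓ (‖x‖ ^ 2) : ℝ) : ℂ) • Cl.vec x ^ p) =
        fun x => (((-1) ^ ℓ * (-1) ^ j * (H ℓ (‖x‖ ^ 2) * ‖x‖ ^ p) : ℝ) : ℂ) • (1 : Cl m) := by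
      ext x
      rw [hj, ← two_mul, Cl.vec_pow_two_mul, smul_smul, ← Complex.ofReal_mul]
      have : (-‖x‖ ^ 2) ^ j = (-1) ^ j * ‖x‖ ^ (2 * j) := by rw [neg_pow (‖x‖ ^ 2), ← pow_mul]
      rw [this]
      congr 2
      ring
    rw [hf]
    refine ⟨((hint.const_mul _).ofReal).smul_const _, fun hkl => ?_⟩
    rw [integral_smul_const]
    have hz : ∫ x : EuclideanSpace ℝ (Fin m), H ℓ (‖x‖ ^ 2) * ‖x‖ ^ p = 0 := by
      have h1 := integral_fun_norm_addHaar (volume : Measure (EuclideanSpace ℝ (Fin m)))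
        (fun r => H ℓ (r ^ 2) * r ^ p)
      refine h1.trans ?_
      have hi2 := (integrable_radial_iff (m := m) (f := fun r => H ℓ (r ^ 2) * r ^ p)).1 hint
      have ht := intervalIntegral_tendsto_integral_Ioi 0 hi2 tendsto_id
      -- The total power p of the vector variable is even exactly when k and ℓ have the same parity,
      -- the case treated by the radial moments.
      have hpar : Even k ↔ Even ℓ := by
        have hpe : Even p := ⟨j, hj⟩
        rw [hp, Nat.even_add] at hpe
        by_cases he : Even ℓ
        · simp [he] at hpe ⊢; exact hpe
        · simp only [he, if_false, Nat.not_even_one, iff_false] at hpe ⊢; exact hpe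
      have ht2 := hH.tendsto_integral_mul_pow hm0 k ℓ le_rfl hkl hpar (by linarith)
      have heq : ∀ r : ℝ, H ℓ (r ^ 2) * (r ^ (if Even ℓ then m - 1 else m) * r ^ k) =
          r ^ (m - 1) * (H ℓ (r ^ 2) * r ^ p) := by
        intro r
        rw [hp]
        split_ifs
        · rw [add_zero]; ring
        · have : r ^ m = r ^ (m - 1) * r := by rw [← pow_succ, Nat.sub_add_cancel hm1]
          rw [this]; ring
      simp only [heq] at ht2
      have h0 := tendsto_nhds_unique ht ht2
      rw [finrank_euclideanSpace_fin]
      simp only [smul_eq_mul]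
      rw [h0]
      simp
    have hz' : ∫ x : EuclideanSpace ℝ (Fin m),
        (((-1) ^ ℓ * (-1) ^ j * (H ℓ (‖x‖ ^ 2) * ‖x‖ ^ p) : ℝ) : ℂ) = 0 := by
      rw [integral_complex_ofReal, integral_const_mul, hz, mul_zero, Complex.ofReal_zero]
    rw [hz', zero_smul]
  · have hf : (fun x : EuclideanSpace ℝ (Fin m) =>
        (((-1) ^ ℓ * H ℓ (‖x‖ ^ 2) : ℝ) : ℂ) • Cl.vec x ^ p) =
        fun x => (((-1) ^ ℓ * H ℓ (‖x‖ ^ 2) * (-‖x‖ ^ 2) ^ j : ℝ) : ℂ) • Cl.vec x := by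
      ext x
      rw [hj, Cl.vec_pow_two_mul_add_one, smul_smul, ← Complex.ofReal_mul]
    rw [hf]
    -- An odd total power leaves a radial function times x, whose integral vanishes by symmetry for
    -- every k.
    refine ⟨integrable_smul_vec ?_ ?_, fun _ => integral_eq_zero_of_odd fun x => ?_⟩
    · refine Complex.continuous_ofReal.comp_aestronglyMeasurable ?_
      exact ((hH.aestronglyMeasurable_radial ℓ).const_mul _).mul
        (by fun_prop : Continuous fun x : EuclideanSpace ℝ (Fin m) =>
          (-‖x‖ ^ 2) ^ j).aestronglyMeasurable
    · refine hint.norm.congr (ae_of_all _ fun x => ?_)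
      simp only [norm_mul, norm_pow, Complex.norm_real, norm_neg, norm_one, one_pow, norm_norm, hj]
      ring
    · have : Cl.vec (-x) = -Cl.vec x := (Cl.vecL (m := m)).map_neg x
      rw [norm_neg, this, smul_neg]

end

/-! ### Reduction of the Fourier transform to a radial integral. -/

noncomputable section

variable {m ℓ : ℕ} {a b : ℝ} {H dH : ℕ → ℝ → ℝ}

theorem radialWeight_eq {α β r : ℝ} (hr : 0 ≤ r) : radialWeight m ℓ α β r =
    |1 - r ^ 2| ^ (α + ℓ) * (1 + r ^ 2) ^ (β + ℓ) * r ^ ((m : ℝ) / 2) := by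
  have h : (1 - r ^ 2) * Real.sign (1 - r) = |1 - r ^ 2| := by
    have h2 : 1 - r ^ 2 = (1 - r) * (1 + r) := by ring
    have h3 : (1 - r) * Real.sign (1 - r) = |1 - r| := by
      rcases lt_trichotomy (1 - r) 0 with h | h | h
      · rw [Real.sign_of_neg h, abs_of_neg h]; ring
      · rw [h]; simp
      · rw [Real.sign_of_pos h, abs_of_pos h, mul_one]
    rw [h2, abs_mul, abs_of_nonneg (by linarith : 0 ≤ 1 + r), ← h3]
    ring
  rw [radialWeight, h]

/-- This is C(z) = (2π)^{m/2} z^{1-m/2} J_{m/2-1}(z) at z = rρ; the powers of r combine to r^{m/2}.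
-/
theorem JacobiChain.mul_fourierKernel_eq {α β : ℝ} (hH : JacobiChain m ℓ (α + ℓ) (β + ℓ) H dH)
    (hm : 1 ≤ m) {ρ r : ℝ} (hρ : 0 < ρ) (hr : 0 < r) :
    H 0 (r ^ 2) * fourierKernel m ρ 0 r =
      (2 * Real.pi) ^ ((m : ℝ) / 2) * ρ ^ (1 - (m : ℝ) / 2) *
        (radialWeight m ℓ α β r * besselJ ((m : ℝ) / 2 - 1) (r * ρ)) := by
  rw [hH.zero_eq _ (sq_nonneg r), radialWeight_eq hr.le, besselJ_eq (by positivity), fourierKernel,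
    if_pos Even.zero, sphereCos, sub_add_cancel]
  have h1 : Real.sqrt Real.pi ^ m = Real.pi ^ ((m : ℝ) / 2) := by
    rw [Real.sqrt_eq_rpow, ← Real.rpow_natCast, ← Real.rpow_mul Real.pi_pos.le]
    congr 1; ring
  have h2 : (r * ρ / 2) ^ ((m : ℝ) / 2 - 1) =
      r ^ ((m : ℝ) / 2 - 1) * ρ ^ ((m : ℝ) / 2 - 1) / 2 ^ ((m : ℝ) / 2 - 1) := by
    rw [Real.div_rpow (by positivity) zero_le_two, Real.mul_rpow hr.le hρ.le]
  have h3 : r ^ (m - 1) = r ^ ((m : ℝ) / 2) * r ^ ((m : ℝ) / 2 - 1) := by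
    rw [← Real.rpow_add hr, ← Real.rpow_natCast]
    congr 1
    push_cast [Nat.cast_sub hm]
    ring
  have h4 : ρ ^ (1 - (m : ℝ) / 2) * ρ ^ ((m : ℝ) / 2 - 1) = 1 := by
    rw [← Real.rpow_add hρ]
    have : 1 - (m : ℝ) / 2 + (m / 2 - 1) = 0 := by ring
    rw [this, Real.rpow_zero]
  have h5 : (2:ℝ) ^ ((m : ℝ) / 2) = 2 * 2 ^ ((m : ℝ) / 2 - 1) := by
    rw [Real.rpow_sub_one two_ne_zero]
    field_simp
  rw [h1, h2, h3, Real.mul_rpow zero_le_two Real.pi_pos.le, h5]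
  have h6 : (0:ℝ) < 2 ^ ((m : ℝ) / 2 - 1) := by positivity
  generalize (2:ℝ) ^ ((m : ℝ) / 2 - 1) = t at h6
  generalize ρ ^ (1 - (m : ℝ) / 2) = u at h4 ⊢
  generalize ρ ^ ((m : ℝ) / 2 - 1) = v at h4 ⊢
  have h7 : t * t⁻¹ = 1 := mul_inv_cancel₀ h6.ne'
  generalize (m : ℝ) / 2 = d
  rw [div_eq_mul_inv (_ * v)]
  linear_combination (-2 * |1 - r ^ 2| ^ (α + ℓ) * (1 + r ^ 2) ^ (β + ℓ) * r ^ d *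
    r ^ (d - 1) * Real.pi ^ d * besselClifford d ((r * ρ) ^ 2 / 4)) * (h4 * (t * t⁻¹) + h7)

/-- The bound is immediate from the spherical integral, while the power series does not show it. -/
theorem exists_abs_sphereCos_le [NeZero m] : ∃ C, ∀ z, |sphereCos m z| ≤ C := by
  refine ⟨1 * (sphereMeasure m).real univ, fun z => ?_⟩
  rw [← integral_sphere_cos (ξ := EuclideanSpace.single (0 : Fin m) 1) (by simp),
    ← Real.norm_eq_abs]
  refine norm_integral_le_of_norm_le_const (ae_of_all _ fun w => ?_)
  rw [Real.norm_eq_abs]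
  exact Real.abs_cos_le_one _

theorem exists_abs_sphereSin_le [NeZero m] : ∃ C, ∀ z, |sphereSin m z| ≤ C := by
  refine ⟨1 * (sphereMeasure m).real univ, fun z => ?_⟩
  have hξ : ‖(EuclideanSpace.single (0 : Fin m) 1 : EuclideanSpace ℝ (Fin m))‖ = 1 := by simp
  rw [← integral_sphere_sin hξ, ← Real.norm_eq_abs]
  refine norm_integral_le_of_norm_le_const (ae_of_all _ fun w => ?_)
  rw [norm_mul, Real.norm_eq_abs, Real.norm_eq_abs]
  exact mul_le_one₀ (Real.abs_sin_le_one _) (abs_nonneg _) (abs_inner_sphere_le hξ w)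

theorem integral_cexp_mul {E : Type*} [MeasurableSpace E] {μ : Measure E} {t h : E → ℝ}
    (ht : AEStronglyMeasurable t μ) (hh : Integrable h μ) :
    ∫ x, Complex.exp (-Complex.I * (t x : ℂ)) * (h x : ℂ) ∂μ =
      ((∫ x, Real.cos (t x) * h x ∂μ : ℝ) : ℂ) -
        Complex.I * ((∫ x, Real.sin (t x) * h x ∂μ : ℝ) : ℂ) := by
  have hc : Integrable (fun x => Real.cos (t x) * h x) μ :=
    hh.bdd_mul (c := 1) (Real.continuous_cos.comp_aestronglyMeasurable ht)
      (ae_of_all _ fun x => by rw [Real.norm_eq_abs]; exact Real.abs_cos_le_one _)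
  have hs : Integrable (fun x => Real.sin (t x) * h x) μ :=
    hh.bdd_mul (c := 1) (Real.continuous_sin.comp_aestronglyMeasurable ht)
      (ae_of_all _ fun x => by rw [Real.norm_eq_abs]; exact Real.abs_sin_le_one _)
  rw [← integral_complex_ofReal, ← integral_complex_ofReal, ← integral_const_mul,
    ← integral_sub hc.ofReal (hs.ofReal.const_mul _)]
  congr 1
  ext x
  have : -Complex.I * (t x : ℂ) = ((-t x : ℝ) : ℂ) * Complex.I := by push_cast; ring
  rw [this, Complex.exp_mul_I, ← Complex.ofReal_cos, ← Complex.ofReal_sin, Real.cos_neg,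
    Real.sin_neg]
  push_cast
  ring

/-- The integral of a vector-valued function with axial symmetry about `ξ` points along `ξ`. -/
theorem integral_smul_vec_eq {ξ : EuclideanSpace ℝ (Fin m)} (hξ : ‖ξ‖ = 1)
    {c : EuclideanSpace ℝ (Fin m) → ℂ} {φ : ℝ → ℝ → ℂ}
    (hc : ∀ x, c x = φ (inner ℝ x ξ) ‖x‖) (hcm : AEStronglyMeasurable c)
    (hi : Integrable fun x => ‖x‖ * ‖c x‖) :
    ∫ x, c x • Cl.vec x = (∫ x, c x * ((inner ℝ x ξ : ℝ) : ℂ)) • Cl.vec ξ := by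
  have hiv := integrable_smul_vec hcm hi
  have hii : Integrable fun x => c x * ((inner ℝ x ξ : ℝ) : ℂ) := by
    refine hi.mono' (hcm.mul (by fun_prop : Continuous fun x : EuclideanSpace ℝ (Fin m) =>
      ((inner ℝ x ξ : ℝ) : ℂ)).aestronglyMeasurable) (ae_of_all _ fun x => ?_)
    rw [norm_mul, Complex.norm_real, mul_comm, Real.norm_eq_abs]
    have := abs_real_inner_le_norm x ξ
    rw [hξ, mul_one] at this
    gcongr
  -- The reflection in the axis through ξ preserves ⟨x, ξ⟩ and |x|, hence c, and x + e x = 2⟨x, ξ⟩ξ.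
  -- Averaging the integral over x and e x leaves only the component along ξ.
  set e : EuclideanSpace ℝ (Fin m) ≃ₗᵢ[ℝ] EuclideanSpace ℝ (Fin m) :=
    (Submodule.span ℝ {ξ}).reflection with he
  have hex : ∀ x, e x = (2 * inner ℝ x ξ) • ξ - x := fun x => by
    rw [he, Submodule.reflection_apply, Submodule.starProjection_unit_singleton ℝ hξ,
      real_inner_comm, two_smul, ← add_smul]
    congr 2
    ring
  have hce : ∀ x, c (e x) = c x := fun x => by
    rw [hc, hc, e.norm_map]
    congr 1
    rw [hex, inner_sub_left, real_inner_smul_left, real_inner_self_eq_norm_sq, hξ]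
    ring
  have h1 : ∫ x, c x • Cl.vec x = ∫ x, ((2 : ℂ) * (c x * ((inner ℝ x ξ : ℝ) : ℂ))) • Cl.vec ξ -
      c x • Cl.vec x := by
    rw [← e.measurePreserving.integral_comp e.toHomeomorph.measurableEmbedding]
    congr 1
    ext1 x
    have hv : Cl.vec (e x) = ((2 * inner ℝ x ξ : ℝ) : ℂ) • Cl.vec ξ - Cl.vec x := by
      rw [hex, ← Cl.vec_smul]
      exact (Cl.vecL (m := m)).map_sub _ _
    rw [hce, hv, smul_sub, smul_smul]
    congr 2
    push_cast
    ring
  rw [integral_sub ((hii.const_mul 2).smul_const _) hiv, integral_smul_const,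
    integral_const_mul] at h1
  have h2 : (2 : ℂ) • ∫ x, c x • Cl.vec x =
      (2 : ℂ) • ((∫ x, c x * ((inner ℝ x ξ : ℝ) : ℂ)) • Cl.vec ξ) := by
    rw [two_smul]
    nth_rewrite 1 [h1]
    rw [sub_add_cancel, smul_smul]
  exact smul_right_injective _ (two_ne_zero : (2 : ℂ) ≠ 0) h2

/-- The Fourier transform of the wavelet as a one-dimensional integral. -/
theorem JacobiChain.cliffordFourier_eq [NeZero m] {α β : ℝ}
    (hH : JacobiChain m ℓ (α + ℓ) (β + ℓ) H dH) (h0 : (0 : ℝ) < -m - 3 * ℓ - 2 * (α + β))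
    {ρ : ℝ} {ξ : EuclideanSpace ℝ (Fin m)} (hξ : ‖ξ‖ = 1) :
    IntegrableOn (fun r => H ℓ (r ^ 2) * fourierKernel m ρ ℓ r) (Ioi 0) ∧
    cliffordFourier (jacobiWavelet m ℓ α β) (ρ • ξ) =
      (((-1) ^ ℓ * ∫ r in Ioi (0:ℝ), H ℓ (r ^ 2) * fourierKernel m ρ ℓ r : ℝ) : ℂ) •
        ((-Complex.I) • Cl.vec ξ) ^ (if Even ℓ then 0 else 1) := by
  have hm1 : 1 ≤ m := NeZero.one_le
  have hexp := decay_exponent_eq α β m ℓ 0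
  rw [zero_add] at hexp
  have hint := hH.integrable_radial_mul_pow (if Even ℓ then 0 else 1)
    (by rw [hexp]; push_cast; linarith)
  have h1D := hH.integrableOn_mul_pow le_rfl (m - 1 + if Even ℓ then 0 else 1) (by
    push_cast [Nat.cast_sub hm1] at hexp ⊢
    linarith)
  have hinner : Continuous fun x : EuclideanSpace ℝ (Fin m) => ρ * inner ℝ x ξ := by fun_prop
  have hmeas := hH.aestronglyMeasurable_radial ℓ
  have hae : (fun x : EuclideanSpace ℝ (Fin m) =>
      Complex.exp (-Complex.I * ((inner ℝ x (ρ • ξ) : ℝ) : ℂ)) • jacobiWavelet m ℓ α β x)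
      =ᵐ[volume] fun x => (Complex.exp (-Complex.I * ((ρ * inner ℝ x ξ : ℝ) : ℂ)) *
        (((-1) ^ ℓ * H ℓ (‖x‖ ^ 2) : ℝ) : ℂ)) • Cl.vec x ^ (if Even ℓ then 0 else 1) := by
    filter_upwards [ae_norm_sq_ne_one] with x hx
    rw [jacobiWavelet_eq hH hx, real_inner_smul_right, smul_smul]
  rw [cliffordFourier, integral_congr_ae hae]
  by_cases he : Even ℓ
  · simp only [he, if_true, pow_zero, mul_one, add_zero] at hint h1D ⊢
    have hi : IntegrableOn (fun r => H ℓ (r ^ 2) * fourierKernel m ρ ℓ r) (Ioi 0) := by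
      obtain ⟨C, hC⟩ := exists_abs_sphereCos_le (m := m)
      have h2 : IntegrableOn (fun r => sphereCos m (r * ρ) * (H ℓ (r ^ 2) * r ^ (m - 1)))
          (Ioi 0) :=
        h1D.bdd_mul (c := C) (continuous_sphereCos.comp
          (continuous_id.mul continuous_const)).aestronglyMeasurable
          (ae_of_all _ fun r => by rw [Real.norm_eq_abs]; exact hC _)
      refine IntegrableOn.congr_fun h2 (fun r _ => ?_) measurableSet_Ioi
      simp only [fourierKernel, if_pos he]
      ring
    refine ⟨hi, ?_⟩
    rw [integral_smul_const, integral_cexp_mul hinner.aestronglyMeasurable (hint.const_mul _),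
      integral_cos_mul_radial hξ ρ (f := fun r => (-1) ^ ℓ * H ℓ (r ^ 2)) (hint.const_mul _)]
    -- For even ℓ the scalar profile is even, so only the cosine part survives.
    have hodd : ∫ x : EuclideanSpace ℝ (Fin m),
        Real.sin (ρ * inner ℝ x ξ) * ((-1) ^ ℓ * H ℓ (‖x‖ ^ 2)) = 0 :=
      integral_eq_zero_of_odd fun x => by
        rw [inner_neg_left, mul_neg, Real.sin_neg, norm_neg, neg_mul]
    rw [hodd, Complex.ofReal_zero, mul_zero, sub_zero, ← integral_const_mul]
    congr 3
    ext r
    simp only [fourierKernel, if_pos he]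
    ring
  · simp only [he, if_false, pow_one] at hint h1D ⊢
    rw [Nat.sub_add_cancel hm1] at h1D
    have hi : IntegrableOn (fun r => H ℓ (r ^ 2) * fourierKernel m ρ ℓ r) (Ioi 0) := by
      obtain ⟨C, hC⟩ := exists_abs_sphereSin_le (m := m)
      have h2 : IntegrableOn (fun r => sphereSin m (r * ρ) * (H ℓ (r ^ 2) * r ^ m)) (Ioi 0) :=
        h1D.bdd_mul (c := C) (continuous_sphereSin.comp
          (continuous_id.mul continuous_const)).aestronglyMeasurable
          (ae_of_all _ fun r => by rw [Real.norm_eq_abs]; exact hC _)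
      refine IntegrableOn.congr_fun h2 (fun r _ => ?_) measurableSet_Ioi
      simp only [fourierKernel, if_neg he]
      ring
    refine ⟨hi, ?_⟩
    have hexpc : Continuous fun x : EuclideanSpace ℝ (Fin m) =>
        Complex.exp (-Complex.I * ((ρ * inner ℝ x ξ : ℝ) : ℂ)) := by fun_prop
    have hnorm : Integrable fun x : EuclideanSpace ℝ (Fin m) =>
        ‖x‖ * ((-1) ^ ℓ * H ℓ (‖x‖ ^ 2)) :=
      (hint.const_mul ((-1) ^ ℓ)).congr (ae_of_all _ fun x => by ring)
    have hint2 : Integrable fun x : EuclideanSpace ℝ (Fin m) =>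
        (-1) ^ ℓ * H ℓ (‖x‖ ^ 2) * inner ℝ x ξ := by
      refine hnorm.mono ((hmeas.const_mul _).mul
        (by fun_prop : Continuous fun x : EuclideanSpace ℝ (Fin m) =>
          inner ℝ x ξ).aestronglyMeasurable) (ae_of_all _ fun x => ?_)
      rw [norm_mul, norm_mul ‖x‖, norm_norm, mul_comm]
      have := norm_inner_le_norm (𝕜 := ℝ) x ξ
      rw [hξ, mul_one] at this
      gcongr
    -- For odd ℓ axial symmetry replaces x by ⟨x, ξ⟩ξ. The extra factor is odd, so only the sine
    -- part survives, with its factor -i.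
    rw [integral_smul_vec_eq hξ (φ := fun t r => Complex.exp (-Complex.I * ((ρ * t : ℝ) : ℂ)) *
      (((-1) ^ ℓ * H ℓ (r ^ 2) : ℝ) : ℂ)) (fun x => rfl)
      (hexpc.aestronglyMeasurable.mul
        (Complex.continuous_ofReal.comp_aestronglyMeasurable (hmeas.const_mul _)))
      (hnorm.norm.congr (ae_of_all _ fun x => by
        have : -Complex.I * ((ρ * inner ℝ x ξ : ℝ) : ℂ) =
          ((-(ρ * inner ℝ x ξ) : ℝ) : ℂ) * Complex.I := by push_cast; ring
        simp only
        rw [this, norm_mul, norm_mul (Complex.exp _), Complex.norm_exp_ofReal_mul_I, one_mul,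
          norm_norm,
          Complex.norm_real]))]
    simp only [mul_assoc (Complex.exp _), ← Complex.ofReal_mul]
    rw [integral_cexp_mul hinner.aestronglyMeasurable hint2]
    have hodd : ∫ x : EuclideanSpace ℝ (Fin m),
        Real.cos (ρ * inner ℝ x ξ) * ((-1) ^ ℓ * H ℓ (‖x‖ ^ 2) * inner ℝ x ξ) = 0 :=
      integral_eq_zero_of_odd fun x => by
        rw [inner_neg_left, mul_neg, Real.cos_neg, norm_neg]
        ring
    have hsin : ∫ x : EuclideanSpace ℝ (Fin m),
        Real.sin (ρ * inner ℝ x ξ) * ((-1) ^ ℓ * H ℓ (‖x‖ ^ 2) * inner ℝ x ξ) =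
        (-1) ^ ℓ * ∫ r in Ioi (0:ℝ), H ℓ (r ^ 2) * fourierKernel m ρ ℓ r := by
      have h := integral_sin_mul_radial hξ ρ (f := fun r => (-1) ^ ℓ * H ℓ (r ^ 2))
        (hmeas.const_mul _) hnorm
      rw [← integral_const_mul]
      refine Eq.trans ?_ (h.trans ?_)
      · congr 1
        ext x
        ring
      · congr 1
        ext r
        simp only [fourierKernel, if_neg he]
        ring
    rw [hodd, hsin, Complex.ofReal_zero, zero_sub, smul_smul]
    congr 1
    ring

end

/-! ### The main theorem. -/

theorem mainTheorem4 (m ℓ : ℕ) (hm : 2 ≤ m) (α β : ℝ)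
    (hα : -1 < α ∨ ∃ n : ℕ, α + ℓ = 2 * n) :
    (∀ k : ℕ, 0 < k → (k : ℝ) < -m - 3 * ℓ - 2 * (α + β) → k < ℓ →
      Integrable (fun x : EuclideanSpace ℝ (Fin m) => Cl.vec x ^ k * jacobiWavelet m ℓ α β x) ∧
      ∫ x : EuclideanSpace ℝ (Fin m), Cl.vec x ^ k * jacobiWavelet m ℓ α β x = 0) ∧
    ((0 : ℝ) < -m - 3 * ℓ - 2 * (α + β) →
      Integrable (jacobiWavelet m ℓ α β) ∧
      ∀ (ρ : ℝ) (ξ : EuclideanSpace ℝ (Fin m)), 0 < ρ → ‖ξ‖ = 1 →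
        (∀ L : ℝ,
          Tendsto (fun R : ℝ => ∫ r in (0 : ℝ)..R,
            radialWeight m ℓ α β r * besselJ ((m : ℝ) / 2 - 1) (r * ρ)) atTop (𝓝 L) →
          cliffordFourier (jacobiWavelet m ℓ α β) (ρ • ξ) =
            (fourierFactor m ℓ ρ * (L : ℂ)) • Cl.vec ξ ^ ℓ) ∧
        ((0 : ℝ) < -m - 4 * ℓ - 2 * (α + β) →
          IntegrableOn (fun r : ℝ =>
            radialWeight m ℓ α β r * besselJ ((m : ℝ) / 2 - 1) (r * ρ)) (Ioi 0) ∧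
          cliffordFourier (jacobiWavelet m ℓ α β) (ρ • ξ) =
            (fourierFactor m ℓ ρ *
              ((∫ r in Ioi (0 : ℝ),
                radialWeight m ℓ α β r * besselJ ((m : ℝ) / 2 - 1) (r * ρ) : ℝ) : ℂ)) •
              Cl.vec ξ ^ ℓ)) := by
  have hm1 : 1 ≤ m := by omega
  have : NeZero m := ⟨by omega⟩
  obtain ⟨H, dH, hH⟩ := exists_jacobiChain m ℓ (α + ℓ) (β + ℓ)
    (hα.imp (fun h => by linarith) id)
  refine ⟨fun k _ hk hkl => ?_, fun h0 => ⟨?_, fun ρ ξ hρ hξ => ?_⟩⟩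
  · have h := hH.integral_vec_pow_mul_wavelet hk
    exact ⟨h.1, h.2 hkl⟩
  · simpa using (hH.integral_vec_pow_mul_wavelet (k := 0) (by simpa using h0)).1
  · set c : ℝ := (2 * Real.pi) ^ ((m : ℝ) / 2) * ρ ^ (1 - (m : ℝ) / 2) with hc
    have hc0 : 0 < c := by positivity
    have hker : ∀ r, 0 < r → H 0 (r ^ 2) * fourierKernel m ρ 0 r =
        c * (radialWeight m ℓ α β r * besselJ ((m : ℝ) / 2 - 1) (r * ρ)) :=
      fun r hr => hH.mul_fourierKernel_eq hm1 hρ hr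
    -- The signs (-1)^ℓ of the wavelet and (-ρ)^ℓ of the integrations by parts combine to ρ^ℓ; the
    -- constant c relates the kernel to the Bessel function.
    have hcond : ∀ L : ℝ,
        Tendsto (fun R : ℝ => ∫ r in (0 : ℝ)..R,
          radialWeight m ℓ α β r * besselJ ((m : ℝ) / 2 - 1) (r * ρ)) atTop (𝓝 L) →
        cliffordFourier (jacobiWavelet m ℓ α β) (ρ • ξ) =
          (fourierFactor m ℓ ρ * (L : ℂ)) • Cl.vec ξ ^ ℓ := by
      intro L hL
      obtain ⟨hi, hF⟩ := hH.cliffordFourier_eq h0 hξ (ρ := ρ)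
      have hL' : Tendsto (fun R => ∫ r in (0:ℝ)..R, H 0 (r ^ 2) * fourierKernel m ρ 0 r) atTop
          (𝓝 (c * L)) := by
        refine (hL.const_mul c).congr' ?_
        filter_upwards [eventually_ge_atTop 0] with R hR
        rw [← intervalIntegral.integral_const_mul, intervalIntegral.integral_of_le hR,
          intervalIntegral.integral_of_le hR]
        exact setIntegral_congr_fun measurableSet_Ioc fun r hr => (hker r hr.1).symm
      rw [hF, hH.integral_Ioi_fourierKernel_eq hρ.ne' hL' hi]
      have hρℓ : ρ ^ (1 - (m : ℝ) / 2 + ℓ) = ρ ^ (1 - (m : ℝ) / 2) * ρ ^ ℓ := by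
        rw [Real.rpow_add hρ, Real.rpow_natCast]
      have hff : fourierFactor m ℓ ρ = (-Complex.I) ^ ℓ * ((c * ρ ^ ℓ : ℝ) : ℂ) := by
        rw [fourierFactor, hρℓ, hc]
        push_cast
        ring
      have h1 : (-1) ^ ℓ * ((-ρ) ^ ℓ * (c * L)) = c * ρ ^ ℓ * L := by
        rw [← mul_assoc, ← mul_pow]
        ring
      rw [h1, hff]
      -- Since ξ² = -1, the element -iξ squares to 1, so its ℓ-th power depends only on the parity
      -- of ℓ.
      have hpow : (-Complex.I) ^ ℓ • Cl.vec ξ ^ ℓ =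
          ((-Complex.I) • Cl.vec ξ) ^ (if Even ℓ then 0 else 1) := by
        rw [← smul_pow]
        have hsq : ((-Complex.I) • Cl.vec ξ) ^ 2 = 1 := by
          rw [smul_pow, sq (Cl.vec ξ), Cl.vec_mul_vec_self, hξ, smul_smul]
          simp
        rcases Nat.even_or_odd ℓ with he | ho
        · rw [if_pos he]
          obtain ⟨n, rfl⟩ := he
          rw [← two_mul, pow_mul, hsq, one_pow, pow_zero]
        · rw [if_neg (Nat.not_even_iff_odd.2 ho)]
          obtain ⟨n, rfl⟩ := ho
          rw [pow_succ, pow_mul, hsq, one_pow, one_mul, pow_one]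
      rw [← hpow, smul_smul]
      congr 1
      push_cast
      ring
    refine ⟨hcond, fun h4 => ?_⟩
    have hi : IntegrableOn (fun r : ℝ =>
        radialWeight m ℓ α β r * besselJ ((m : ℝ) / 2 - 1) (r * ρ)) (Ioi 0) := by
      obtain ⟨C, hC⟩ := exists_abs_sphereCos_le (m := m)
      -- For q = 0 there is no gain in decay, and a + b = α + β + 2ℓ; this is where 4ℓ replaces 3ℓ.
      have h1 := hH.integrableOn_mul_pow (Nat.zero_le ℓ) (m - 1) (by
        push_cast [Nat.cast_sub hm1]
        linarith)
      have h2 : IntegrableOn (fun r => sphereCos m (r * ρ) * (H 0 (r ^ 2) * r ^ (m - 1)))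
          (Ioi 0) :=
        h1.bdd_mul (c := C) (continuous_sphereCos.comp
          (continuous_id.mul continuous_const)).aestronglyMeasurable
          (ae_of_all _ fun r => by rw [Real.norm_eq_abs]; exact hC _)
      refine IntegrableOn.congr_fun (h2.const_mul c⁻¹) (fun r hr => ?_) measurableSet_Ioi
      have h3 := hker r hr
      simp only [fourierKernel, if_pos Even.zero] at h3
      rw [inv_mul_eq_iff_eq_mul₀ hc0.ne', ← h3]
      ring
    exact ⟨hi, hcond _ (intervalIntegral_tendsto_integral_Ioi 0 hi tendsto_id)⟩
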